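/- Let $T, I, J\subseteq\mathbb R$ be nonempty open intervals, let $f\colon I\to\mathbb R$ and $D,K\colon J\to\mathbb R$ be $C^\infty$ functions with $f(x)\neq 0$ on $I$ and $D(u)\neq 0$ on $J$, and assume that the equation $$f(x)\,u_t=(D(u)u_x)_x+K(u)u_x \qquad (*)$$ is nonlinear, i.e. the derivatives $D_u$ and $K_u$ are not both identically zero on $J$. Suppose that there is a Lie algebra $\mathfrak g$, of dimension at least $4$ over $\mathbb R$, of smooth vector fields $$Q=\xi^t(t,x,u)\partial_t+\xi^x(t,x,u)\partial_x+\eta(t,x,u)\partial_u$$ on $T\times I\times J$, all of which are infinitesimal symmetries of $(*)$ (Lie's infinitesimal invariance criterion: the second prolongation of $Q$ applied to $f u_t-(Du_x)_x-Ku_x$ vanishes at all second-order jets over $T\times I\times J$ that satisfy $(*)$). Then $(*)$ can be reduced by a point transformation to an equation of the same class with $f=1$: there are open intervals $I_1,J_1$, functions $D_1,K_1\in C^\infty(J_1)$ with $D_1\ne0$ on $J_1$ and with $D_{1,u},K_{1,u}$ not both identically zero on $J_1$, and a smooth diffeomorphism $\Phi\colon(t,x,u)\mapsto(\tilde t,\tilde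 x,\tilde u)$ of $T\times I\times J$ onto an open subset of $\mathbb R\times I_1\times J_1$, which maps $(*)$ to $$\tilde u_{\tilde t}=(D_1(\tilde u)\tilde u_{\tilde x})_{\tilde x}+K_1(\tilde u)\tilde u_{\tilde x}.$$ Here "maps" means: whenever $\Phi$ takes the graph of a smooth function $u=v(t,x)$, defined on an open set, into the graph of a smooth function $\tilde u=w(\tilde t,\tilde x)$, defined on an open set, $v$ satisfies $(*)$ at a point if and only if $w$ satisfies the new equation at the corresponding point. -/

import Mathlib

open scoped ContDiff

noncomputable section

/-- `S` is a nonempty open interval of the real line (bounded or not). -/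
def IsOpenInterval (S : Set ℝ) : Prop :=
  IsOpen S ∧ S.OrdConnected ∧ S.Nonempty

/-- The space of the variables `(t, x, u)`. -/
abbrev PointSpace : Type := ℝ × ℝ × ℝ

/-- The domain `T × I × J` in the space of the variables `(t, x, u)`. -/
def box (T I J : Set ℝ) : Set PointSpace := T ×ˢ (I ×ˢ J)

/-- The functions `f` on the interval `I` and `D`, `K` on the interval `J` are admissible
arbitrary elements of the class `f(x) u_t = (D(u) u_x)_x + K(u) u_x`: they are smooth,
`f D ≠ 0`, and the equation is nonlinear, i.e. `D_u` and `K_u` are not both identically zero. -/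
structure IsAdmissible (I J : Set ℝ) (f D K : ℝ → ℝ) : Prop where
  interval_x : IsOpenInterval I
  interval_u : IsOpenInterval J
  smooth_f : ContDiffOn ℝ ∞ f I
  smooth_D : ContDiffOn ℝ ∞ D J
  smooth_K : ContDiffOn ℝ ∞ K J
  f_ne_zero : ∀ x ∈ I, f x ≠ 0
  D_ne_zero : ∀ u ∈ J, D u ≠ 0
  nonlinear : ∃ u ∈ J, deriv D u ≠ 0 ∨ deriv K u ≠ 0

/-- The function `v(t, x)` satisfies `f(x) u_t = (D(u) u_x)_x + K(u) u_x` at the point `(t, x)`. -/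
def SatisfiesAt (f D K : ℝ → ℝ) (v : ℝ → ℝ → ℝ) (t x : ℝ) : Prop :=
  f x * deriv (fun s => v s x) t =
    deriv (fun y => D (v t y) * deriv (fun z => v t z) y) x
      + K (v t x) * deriv (fun y => v t y) x

/-! ### Infinitesimal symmetries -/

/-- The left-hand side `f(x) u_t - D(u) u_xx - D'(u) u_x ^ 2 - K(u) u_x` of the equation, as
a function of the jet variables `(t, x, u, u_t, u_x, u_xx)`. -/
def equationLHS (f D K : ℝ → ℝ) : ℝ × ℝ × ℝ × ℝ × ℝ × ℝ → ℝ :=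
  fun (_, x, u, ut, ux, uxx) => f x * ut - D u * uxx - deriv D u * ux ^ 2 - K u * ux

/-- The total derivative with respect to `t` of a function `F(t, x, u)`, at a first-order jet. -/
def totalDt (F : PointSpace → ℝ) : ℝ × ℝ × ℝ × ℝ × ℝ → ℝ :=
  fun (t, x, u, ut, _) => fderiv ℝ F (t, x, u) (1, 0, ut)

/-- The total derivative with respect to `x` of a function `F(t, x, u)`, at a first-order jet. -/
def totalDx (F : PointSpace → ℝ) : ℝ × ℝ × ℝ × ℝ × ℝ → ℝ :=
  fun (t, x, u, _, ux) => fderiv ℝ F (t, x, u) (0, 1, ux)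

/-- Coefficient of `∂_t` of a vector field on the space of `(t, x, u)`. -/
def xiT (Q : PointSpace → PointSpace) (p : PointSpace) : ℝ := (Q p).1

/-- Coefficient of `∂_x` of a vector field on the space of `(t, x, u)`. -/
def xiX (Q : PointSpace → PointSpace) (p : PointSpace) : ℝ := (Q p).2.1

/-- Coefficient of `∂_u` of a vector field on the space of `(t, x, u)`. -/
def eta (Q : PointSpace → PointSpace) (p : PointSpace) : ℝ := (Q p).2.2

/-- Coefficient of `∂_{u_t}` in the prolongation of `Q`:
`η^t = D_t η - u_t D_t ξ^t - u_x D_t ξ^x`. -/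
def etaT (Q : PointSpace → PointSpace) (j : ℝ × ℝ × ℝ × ℝ × ℝ) : ℝ :=
  totalDt (eta Q) j - j.2.2.2.1 * totalDt (xiT Q) j - j.2.2.2.2 * totalDt (xiX Q) j

/-- Coefficient of `∂_{u_x}` in the prolongation of `Q`:
`η^x = D_x η - u_t D_x ξ^t - u_x D_x ξ^x`. -/
def etaX (Q : PointSpace → PointSpace) (j : ℝ × ℝ × ℝ × ℝ × ℝ) : ℝ :=
  totalDx (eta Q) j - j.2.2.2.1 * totalDx (xiT Q) j - j.2.2.2.2 * totalDx (xiX Q) j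

/-- Coefficient of `∂_{u_xx}` in the second prolongation of `Q`:
`η^xx = D_x η^x - u_tx D_x ξ^t - u_xx D_x ξ^x`, where
`D_x = ∂_x + u_x ∂_u + u_tx ∂_{u_t} + u_xx ∂_{u_x}` on functions of first-order jets. -/
def etaXX (Q : PointSpace → PointSpace) (j : ℝ × ℝ × ℝ × ℝ × ℝ) (utx uxx : ℝ) : ℝ :=
  fderiv ℝ (etaX Q) j (0, 1, j.2.2.2.2, utx, uxx)
    - utx * totalDx (xiT Q) j - uxx * totalDx (xiX Q) j

/-- Lie's criterion of infinitesimal invariance over the domain `Ω`: the second prolongation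
of `Q = ξ^t ∂_t + ξ^x ∂_x + η ∂_u`, applied to the left-hand side of the equation, vanishes at
all second-order jets over `Ω` that satisfy the equation. -/
def IsInfinitesimalSymmetry (f D K : ℝ → ℝ) (Ω : Set PointSpace)
    (Q : PointSpace → PointSpace) : Prop :=
  ∀ t x u ut ux utx uxx : ℝ, (t, x, u) ∈ Ω →
    equationLHS f D K (t, x, u, ut, ux, uxx) = 0 →
    fderiv ℝ (equationLHS f D K) (t, x, u, ut, ux, uxx)
      (xiT Q (t, x, u), xiX Q (t, x, u), eta Q (t, x, u),
        etaT Q (t, x, u, ut, ux), etaX Q (t, x, u, ut, ux),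
        etaXX Q (t, x, u, ut, ux) utx uxx) = 0

/-- `𝔤` is a Lie algebra of smooth vector fields on the open set `Ω`, all of which are
infinitesimal symmetries of the equation. A vector field on `Ω` is represented by its extension
by zero to the whole space, so that fields are equal, or linearly dependent, exactly if they are
so on `Ω`. -/
structure IsInvarianceAlgebra (f D K : ℝ → ℝ) (Ω : Set PointSpace)
    (𝔤 : Submodule ℝ (PointSpace → PointSpace)) : Prop where
  smooth : ∀ Q ∈ 𝔤, ContDiffOn ℝ ∞ Q Ω
  zero_outside : ∀ Q ∈ 𝔤, ∀ p, p ∉ Ω → Q p = 0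
  symmetry : ∀ Q ∈ 𝔤, IsInfinitesimalSymmetry f D K Ω Q
  bracket_mem : ∀ Q ∈ 𝔤, ∀ R ∈ 𝔤, VectorField.lieBracket ℝ Q R ∈ 𝔤

/-! ### Point transformations -/

/-- `Φ` is a point transformation with domain `Ω`: a smooth diffeomorphism of `Ω` onto an open
subset of the space of `(t, x, u)`. -/
def IsPointTransformation (Ω : Set PointSpace)
    (Φ : OpenPartialHomeomorph PointSpace PointSpace) : Prop :=
  Φ.source = Ω ∧ ContDiffOn ℝ ∞ Φ Φ.source ∧ ContDiffOn ℝ ∞ Φ.symm Φ.target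

/-- `Φ` takes the graph of `v` over `U` into the graph of `w` over `W`. -/
def MapsGraph (Φ : PointSpace → PointSpace) (U : Set (ℝ × ℝ)) (v : ℝ → ℝ → ℝ)
    (W : Set (ℝ × ℝ)) (w : ℝ → ℝ → ℝ) : Prop :=
  ∀ t x, (t, x) ∈ U →
    ((Φ (t, x, v t x)).1, (Φ (t, x, v t x)).2.1) ∈ W ∧
      (Φ (t, x, v t x)).2.2 = w (Φ (t, x, v t x)).1 (Φ (t, x, v t x)).2.1

/-- `Φ`, defined on `Ω`, maps the equation with arbitrary elements `f, D, K` to the equation with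
arbitrary elements `f₁, D₁, K₁`: whenever it takes the graph of a smooth function `v` (lying
in `Ω`) to the graph of a smooth function `w`, the function `v` satisfies the first equation at
a point exactly if `w` satisfies the second one at the corresponding point. -/
def MapsEquation (Ω : Set PointSpace) (Φ : PointSpace → PointSpace)
    (f D K f₁ D₁ K₁ : ℝ → ℝ) : Prop :=
  ∀ (U W : Set (ℝ × ℝ)) (v w : ℝ → ℝ → ℝ), IsOpen U → IsOpen W →
    ContDiffOn ℝ ∞ (fun z : ℝ × ℝ => v z.1 z.2) U →
    ContDiffOn ℝ ∞ (fun z : ℝ × ℝ => w z.1 z.2) W →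
    (∀ t x, (t, x) ∈ U → (t, x, v t x) ∈ Ω) →
    MapsGraph Φ U v W w →
    ∀ t x, (t, x) ∈ U →
      (SatisfiesAt f D K v t x ↔
        SatisfiesAt f₁ D₁ K₁ w (Φ (t, x, v t x)).1 (Φ (t, x, v t x)).2.1)

end

/-!
The determining equations force a symmetry to have the form
`τ(t) ∂_t + ξ(t, x) ∂_x + (a(t, x) u + b(t, x)) ∂_u`. Vanishing at a given point amounts to three
linear conditions, so in dimension at least four some nonzero symmetry vanishes at a chosen point.
When `f` is not constant, substituting this field into the determining equations forces `D` to be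
nonconstant and `K = k₁ D + k₀`. Either `k₀ = 0`, and then `(μ u + ν) D' = D` and `f` satisfies a
first-order equation with exponential solutions; or `k₁ = 0`, `μ = -2 / 3` and `1 / f` is affine.
In each case `f` is explicit enough to write down a transformation of `t`, `x` and `u` removing it,
in which `u` moves along the flow of `(μ u + ν) ∂_u`.
-/

/-! ### Functions on open intervals -/

theorem mul_pos_of_continuousOn_of_ne_zero {X : Type*} [TopologicalSpace X] {S : Set X}
    (hS : IsPreconnected S) {g : X → ℝ} (hg : ContinuousOn g S) (hne : ∀ x ∈ S, g x ≠ 0) {x y : X}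
    (hx : x ∈ S) (hy : y ∈ S) : 0 < g x * g y := by
  by_contra hneg
  obtain ⟨z, hz, hz₀⟩ := hS.intermediate_value hx hy (hg.mul_const (g y))
    (⟨not_lt.1 hneg, (mul_self_pos.2 (hne y hy)).le⟩ : (0 : ℝ) ∈ Set.Icc _ _)
  exact mul_ne_zero (hne z hz) (hne y hy) hz₀

section OpenInterval

variable {S : Set ℝ}

theorem IsOpenInterval.isPreconnected (hS : IsOpenInterval S) : IsPreconnected S :=
  hS.2.1.isPreconnected

theorem IsOpenInterval.mem_nhds (hS : IsOpenInterval S) {x : ℝ} (hx : x ∈ S) : S ∈ nhds x :=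
  hS.1.mem_nhds hx

theorem IsOpenInterval.infinite (hS : IsOpenInterval S) : S.Infinite :=
  infinite_of_mem_nhds _ (hS.mem_nhds hS.2.2.some_mem)

theorem IsOpenInterval.exists_ne (hS : IsOpenInterval S) (x : ℝ) : ∃ y ∈ S, y ≠ x :=
  hS.infinite.nontrivial.exists_ne x

theorem IsOpenInterval.eq_of_hasDerivAt_zero (hS : IsOpenInterval S) {g : ℝ → ℝ}
    (hg : ∀ x ∈ S, HasDerivAt g 0 x) {x y : ℝ} (hx : x ∈ S) (hy : y ∈ S) : g x = g y :=
  hS.1.is_const_of_deriv_eq_zero hS.isPreconnected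
    (fun z hz => (hg z hz).differentiableAt.differentiableWithinAt)
    (fun z hz => (hg z hz).deriv) hx hy

theorem eq_zero_of_hasDerivAt_of_const (hS : IsOpen S) {g g' : ℝ → ℝ} {c : ℝ}
    (hg : ∀ x ∈ S, HasDerivAt g (g' x) x) (hc : ∀ x ∈ S, g x = c) : ∀ x ∈ S, g' x = 0 :=
  fun x hx => (hg x hx).unique <| (hasDerivAt_const x c).congr_of_eventuallyEq <|
    Filter.eventually_of_mem (hS.mem_nhds hx) hc

theorem eq_zero_of_forall_ne_eq_zero (hS : IsOpen S) {g : ℝ → ℝ} (hg : ContinuousOn g S) (c : ℝ)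
    (h : ∀ x ∈ S, x ≠ c → g x = 0) : ∀ x ∈ S, g x = 0 :=
  Set.EqOn.of_subset_closure (s := S ∩ {c}ᶜ) (g := fun _ => 0) (fun x hx => h x hx.1 hx.2) hg
    continuousOn_const Set.inter_subset_left
    ((dense_compl_singleton c).open_subset_closure_inter hS)

theorem eq_zero_of_affine_mul_eq_zero (hS : IsOpen S) {g : ℝ → ℝ} (hg : ContinuousOn g S)
    {a b : ℝ} (hab : a ≠ 0 ∨ b ≠ 0) (h : ∀ x ∈ S, (a * x + b) * g x = 0) : ∀ x ∈ S, g x = 0 := by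
  refine eq_zero_of_forall_ne_eq_zero hS hg (-b / a) fun x hx hxc => ?_
  refine (mul_eq_zero.1 (h x hx)).resolve_left fun h0 => ?_
  by_cases ha : a = 0
  · simp_all
  · exact hxc (by field_simp; linarith)

theorem cubic_coeffs_eq_zero {R : Type*} [CommRing R] [IsDomain R] {s : Set R} (hs : s.Infinite)
    {a b c d : R} (h : ∀ y ∈ s, a + b * y + c * y ^ 2 + d * y ^ 3 = 0) :
    a = 0 ∧ b = 0 ∧ c = 0 ∧ d = 0 := by
  open Polynomial in
  have hp : (C a + C b * X + C c * X ^ 2 + C d * X ^ 3 : R[X]) = 0 :=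
    eq_zero_of_infinite_isRoot _ (hs.mono fun y hy => by simpa [IsRoot] using h y hy)
  have coeff_eq (n : ℕ) := congrArg (fun p => Polynomial.coeff p n) hp
  refine ⟨by simpa using coeff_eq 0, ?_, ?_, ?_⟩
  · simpa [Polynomial.coeff_X, Polynomial.coeff_C] using coeff_eq 1
  · simpa [Polynomial.coeff_X, Polynomial.coeff_C] using coeff_eq 2
  · simpa [Polynomial.coeff_X, Polynomial.coeff_C] using coeff_eq 3

theorem affine_coeffs_eq_zero {R : Type*} [CommRing R] [IsDomain R] {s : Set R} (hs : s.Infinite)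
    {a b : R} (h : ∀ y ∈ s, a + b * y = 0) : a = 0 ∧ b = 0 :=
  have ⟨ha, hb, _⟩ := cubic_coeffs_eq_zero (a := a) (b := b) (c := 0) (d := 0) hs
    (by simpa using h)
  ⟨ha, hb⟩

end OpenInterval

/-! ### Primitives of exponentials -/

theorem hasDerivAt_exp_const_mul (m x : ℝ) :
    HasDerivAt (fun x => Real.exp (m * x)) (m * Real.exp (m * x)) x :=
  ((hasDerivAt_id' x).const_mul m).exp.congr_deriv (by ring)

/-- The primitive of `s ↦ exp (m s)` vanishing at `0`, for all `m` including `m = 0`; it serves to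
write the flows of affine vector fields and the solutions of `g'' = m g'`. -/
noncomputable def expInt (m s : ℝ) : ℝ := ∫ r in (0 : ℝ)..s, Real.exp (m * r)

@[simp] theorem expInt_zero (m : ℝ) : expInt m 0 = 0 :=
  intervalIntegral.integral_same

theorem hasDerivAt_expInt (m s : ℝ) : HasDerivAt (expInt m) (Real.exp (m * s)) s :=
  ((by fun_prop : Continuous fun r : ℝ => Real.exp (m * r)).integral_hasStrictDerivAt
    0 s).hasDerivAt

theorem one_add_mul_expInt (m s : ℝ) : 1 + m * expInt m s = Real.exp (m * s) := by
  have hderiv : ∀ r, HasDerivAt (fun r => 1 + m * expInt m r - Real.exp (m * r)) 0 r := fun r =>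
    ((((hasDerivAt_expInt m r).const_mul m).const_add 1).sub
      (hasDerivAt_exp_const_mul m r)).congr_deriv (sub_self _)
  have hconst := is_const_of_deriv_eq_zero (fun r => (hderiv r).differentiableAt)
    (fun r => (hderiv r).deriv) s 0
  simpa [sub_eq_zero] using hconst

theorem contDiff_expInt (m : ℝ) : ContDiff ℝ ∞ (expInt m) := by
  have hderiv : deriv (expInt m) = fun s => Real.exp (m * s) :=
    funext fun s => (hasDerivAt_expInt m s).deriv
  refine contDiff_infty_iff_deriv.2 ⟨fun s => (hasDerivAt_expInt m s).differentiableAt, ?_⟩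
  rw [hderiv]
  fun_prop

@[fun_prop] theorem continuous_expInt (m : ℝ) : Continuous (expInt m) :=
  (contDiff_expInt m).continuous

theorem strictMono_expInt (m : ℝ) : StrictMono (expInt m) :=
  strictMono_of_deriv_pos fun s => (hasDerivAt_expInt m s).deriv ▸ Real.exp_pos _

theorem expInt_eq_zero_iff {m s : ℝ} : expInt m s = 0 ↔ s = 0 :=
  (strictMono_expInt m).injective.eq_iff' (expInt_zero m)

theorem hasDerivAt_expInt_sub (m c x : ℝ) :
    HasDerivAt (fun y => expInt m (y - c)) (Real.exp (m * (x - c))) x :=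
  (hasDerivAt_expInt m (x - c)).comp_sub_const x c

theorem IsOpenInterval.eq_mul_exp {S : Set ℝ} (hS : IsOpenInterval S) {g : ℝ → ℝ} {m : ℝ}
    (hg : ∀ x ∈ S, HasDerivAt g (m * g x) x) {c x : ℝ} (hc : c ∈ S) (hx : x ∈ S) :
    g x = g c * Real.exp (m * (x - c)) := by
  have hderiv : ∀ z ∈ S, HasDerivAt (fun z => g z * Real.exp (-(m * (z - c)))) 0 z := fun z hz =>
    ((hg z hz).mul (((hasDerivAt_id' z).sub_const c).const_mul m).neg.exp).congr_deriv (by ring)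
  have hconst := hS.eq_of_hasDerivAt_zero hderiv hx hc
  simp only [sub_self, mul_zero, neg_zero, Real.exp_zero, mul_one] at hconst
  rw [← hconst, mul_assoc, ← Real.exp_add, neg_add_cancel, Real.exp_zero, mul_one]

theorem IsOpenInterval.eq_add_mul_expInt {S : Set ℝ} (hS : IsOpenInterval S) {g g₁ : ℝ → ℝ} {m : ℝ}
    (hg : ∀ x ∈ S, HasDerivAt g (g₁ x) x) (hg₁ : ∀ x ∈ S, HasDerivAt g₁ (m * g₁ x) x)
    {c x : ℝ} (hc : c ∈ S) (hx : x ∈ S) : g x = g c + g₁ c * expInt m (x - c) := by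
  have hderiv : ∀ z ∈ S, HasDerivAt (fun z => g z - g₁ c * expInt m (z - c)) 0 z := fun z hz =>
    ((hg z hz).sub ((hasDerivAt_expInt_sub m c z).const_mul (g₁ c))).congr_deriv
      (by rw [hS.eq_mul_exp hg₁ hc hz, sub_self])
  have hconst := hS.eq_of_hasDerivAt_zero hderiv hx hc
  simp only [sub_self, expInt_zero, mul_zero, sub_zero] at hconst
  linarith

/-! ### Diffeomorphisms -/

theorem isOpenMap_domRestrict_of_hasStrictFDerivAt_equiv {𝕜 E F : Type*}
    [NontriviallyNormedField 𝕜] [NormedAddCommGroup E] [NormedSpace 𝕜 E] [CompleteSpace E]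
    [NormedAddCommGroup F] [NormedSpace 𝕜 F] {s : Set E} (hs : IsOpen s) {g : E → F}
    (hg : ∀ p ∈ s, ∃ L : E ≃L[𝕜] F, HasStrictFDerivAt g (L : E →L[𝕜] F) p) :
    IsOpenMap (s.domRestrict g) := by
  refine isOpenMap_iff_nhds_le.2 fun p => ?_
  obtain ⟨L, hL⟩ := hg p p.2
  have hmap : Filter.map ((↑) : s → E) (nhds p) = nhds (p : E) :=
    (map_nhds_subtype_val p).trans (hs.nhdsWithin_eq p.2)
  calc nhds (g p) = Filter.map g (Filter.map ((↑) : s → E) (nhds p)) := by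
        rw [hmap, hL.map_nhds_eq_of_equiv]
    _ ≤ Filter.map (s.domRestrict g) (nhds p) := Filter.map_map.le

theorem exists_equiv_coe_eq_of_injective {𝕜 E : Type*} [NontriviallyNormedField 𝕜]
    [CompleteSpace 𝕜] [NormedAddCommGroup E] [NormedSpace 𝕜 E] [FiniteDimensional 𝕜 E]
    {A : E →L[𝕜] E} (hA : ∀ v, A v = 0 → v = 0) : ∃ L : E ≃L[𝕜] E, (L : E →L[𝕜] E) = A :=
  have hinj : Function.Injective (A : E →ₗ[𝕜] E) := (injective_iff_map_eq_zero _).2 hA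
  ⟨(LinearEquiv.ofInjectiveEndo _ hinj).toContinuousLinearEquiv,
    ContinuousLinearMap.ext fun _ => rfl⟩

theorem exists_isPointTransformation {Ω : Set PointSpace} (hΩ : IsOpen Ω)
    {Φ : PointSpace → PointSpace} (hΦ : ContDiffOn ℝ ∞ Φ Ω) (hinj : Set.InjOn Φ Ω)
    (hker : ∀ p ∈ Ω, ∀ v, fderiv ℝ Φ p v = 0 → v = 0) :
    ∃ e : OpenPartialHomeomorph PointSpace PointSpace,
      IsPointTransformation Ω e ∧ (e : PointSpace → PointSpace) = Φ := by
  have hat : ∀ p ∈ Ω, ContDiffAt ℝ ∞ Φ p := fun p hp => hΦ.contDiffAt (hΩ.mem_nhds hp)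
  have hequiv : ∀ p ∈ Ω, ∃ L : PointSpace ≃L[ℝ] PointSpace,
      HasStrictFDerivAt Φ (L : PointSpace →L[ℝ] PointSpace) p := fun p hp => by
    obtain ⟨L, hL⟩ := exists_equiv_coe_eq_of_injective (hker p hp)
    exact ⟨L, hL ▸ (hat p hp).hasStrictFDerivAt (by simp)⟩
  let e := OpenPartialHomeomorph.ofContinuousOpenRestrict (hinj.toPartialEquiv Φ Ω)
    hΦ.continuousOn (isOpenMap_domRestrict_of_hasStrictFDerivAt_equiv hΩ hequiv) hΩ
  refine ⟨e, ⟨rfl, hΦ, fun y hy => ?_⟩, rfl⟩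
  have hmem : e.symm y ∈ Ω := e.map_target hy
  obtain ⟨L, hL⟩ := hequiv _ hmem
  exact (e.contDiffAt_symm (f₀' := L) hy hL.hasFDerivAt (hat _ hmem)).contDiffWithinAt

/-! ### Partial derivatives and prolongations -/

theorem isOpen_box {T I J : Set ℝ} (hT : IsOpen T) (hI : IsOpen I) (hJ : IsOpen J) :
    IsOpen (box T I J) :=
  hT.prod (hI.prod hJ)

/-- The partial derivative with respect to `t` of a function of `(t, x, u)`. -/
noncomputable def pdt (F : PointSpace → ℝ) (p : PointSpace) : ℝ := fderiv ℝ F p (1, 0, 0)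

/-- The partial derivative with respect to `x` of a function of `(t, x, u)`. -/
noncomputable def pdx (F : PointSpace → ℝ) (p : PointSpace) : ℝ := fderiv ℝ F p (0, 1, 0)

/-- The partial derivative with respect to `u` of a function of `(t, x, u)`. -/
noncomputable def pdu (F : PointSpace → ℝ) (p : PointSpace) : ℝ := fderiv ℝ F p (0, 0, 1)

/-- The second total derivative `D_x² F` of a function `F(t, x, u)` without its term `u_xx F_u`, as
a function of the point and of `u_x`. -/
noncomputable def truncTotalDxx (F : PointSpace → ℝ) (p : PointSpace) (ux : ℝ) : ℝ :=
  pdx (pdx F) p + ux * (pdx (pdu F) p + pdu (pdx F) p) + ux ^ 2 * pdu (pdu F) p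

theorem fderiv_eq_partials (F : PointSpace → ℝ) (p : PointSpace) (a b c : ℝ) :
    fderiv ℝ F p (a, b, c) = a * pdt F p + b * pdx F p + c * pdu F p := by
  have hv : ((a, b, c) : PointSpace) = a • (1, 0, 0) + b • (0, 1, 0) + c • (0, 0, 1) := by simp
  simp only [hv, map_add, map_smul, smul_eq_mul, pdt, pdx, pdu]

section Slices

variable {F : PointSpace → ℝ} {t x u : ℝ}

theorem hasDerivAt_slice_t (hF : DifferentiableAt ℝ F (t, x, u)) :
    HasDerivAt (fun s => F (s, x, u)) (pdt F (t, x, u)) t :=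
  hF.hasFDerivAt.comp_hasDerivAt (f := fun s : ℝ => ((s, x, u) : PointSpace)) t
    ((hasDerivAt_id' t).prodMk ((hasDerivAt_const t x).prodMk (hasDerivAt_const t u)))

theorem hasDerivAt_slice_x (hF : DifferentiableAt ℝ F (t, x, u)) :
    HasDerivAt (fun y => F (t, y, u)) (pdx F (t, x, u)) x :=
  hF.hasFDerivAt.comp_hasDerivAt (f := fun y : ℝ => ((t, y, u) : PointSpace)) x
    ((hasDerivAt_const x t).prodMk ((hasDerivAt_id' x).prodMk (hasDerivAt_const x u)))

theorem hasDerivAt_slice_u (hF : DifferentiableAt ℝ F (t, x, u)) :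
    HasDerivAt (fun v => F (t, x, v)) (pdu F (t, x, u)) u :=
  hF.hasFDerivAt.comp_hasDerivAt (f := fun v : ℝ => ((t, x, v) : PointSpace)) u
    ((hasDerivAt_const u t).prodMk ((hasDerivAt_const u x).prodMk (hasDerivAt_id' u)))

end Slices

theorem pdx_pdu_eq_zero_of_eqOn_zero {Ω : Set PointSpace} (hΩ : IsOpen Ω) {G : PointSpace → ℝ}
    (hG : ∀ p ∈ Ω, G p = 0) {p : PointSpace} (hp : p ∈ Ω) : pdx G p = 0 ∧ pdu G p = 0 := by
  have heq : G =ᶠ[nhds p] fun _ => 0 := Filter.eventually_of_mem (hΩ.mem_nhds hp) hG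
  have hfderiv : fderiv ℝ G p = 0 := by rw [heq.fderiv_eq, fderiv_const_apply]
  simp [pdx, pdu, hfderiv]

theorem differentiableAt_fderiv {E : Type*} [NormedAddCommGroup E] [NormedSpace ℝ E] {F : E → ℝ}
    {p : E} (hF : ContDiffAt ℝ ∞ F p) : DifferentiableAt ℝ (fderiv ℝ F) p :=
  (hF.fderiv_right (m := 1) (by norm_cast)).differentiableAt (by simp)

theorem fderiv_fderiv_apply {E : Type*} [NormedAddCommGroup E] [NormedSpace ℝ E] {F : E → ℝ}
    {p : E} (hF : ContDiffAt ℝ ∞ F p) (v w : E) :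
    fderiv ℝ (fderiv ℝ F) p v w = fderiv ℝ (fun q => fderiv ℝ F q w) p v := by
  rw [((differentiableAt_fderiv hF).hasFDerivAt.clm_apply (hasFDerivAt_const w p)).fderiv]
  simp

theorem pdu_pdx_eq_pdx_pdu {F : PointSpace → ℝ} {p : PointSpace} (hF : ContDiffAt ℝ ∞ F p) :
    pdu (pdx F) p = pdx (pdu F) p := by
  have hsymm : IsSymmSndFDerivAt ℝ F p := hF.isSymmSndFDerivAt (by simp; norm_cast)
  exact (fderiv_fderiv_apply hF _ _).symm.trans
    ((hsymm.eq _ _).trans (fderiv_fderiv_apply hF _ _))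

theorem fderiv_fderiv_eq_truncTotalDxx {F : PointSpace → ℝ} {p : PointSpace}
    (hF : ContDiffAt ℝ ∞ F p) (ux : ℝ) :
    fderiv ℝ (fderiv ℝ F) p (0, 1, ux) (0, 1, ux) = truncTotalDxx F p ux := by
  rw [fderiv_fderiv_apply hF]
  have hdir : (fun q => fderiv ℝ F q (0, 1, ux)) = fun q => pdx F q + ux * pdu F q := by
    ext q
    rw [fderiv_eq_partials]
    ring
  have hx : DifferentiableAt ℝ (pdx F) p :=
    (differentiableAt_fderiv hF).clm_apply (differentiableAt_const _)
  have hu : DifferentiableAt ℝ (pdu F) p :=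
    (differentiableAt_fderiv hF).clm_apply (differentiableAt_const _)
  have hsum : HasFDerivAt (fun q => pdx F q + ux * pdu F q) _ p :=
    hx.hasFDerivAt.add (hu.hasFDerivAt.const_mul ux)
  rw [hdir, hsum.fderiv]
  simp only [add_apply, smul_apply, fderiv_eq_partials, truncTotalDxx, smul_eq_mul]
  ring

theorem hasFDerivAt_totalDx {F : PointSpace → ℝ} {t x u ut ux : ℝ}
    (hF : ContDiffAt ℝ ∞ F (t, x, u)) :
    ∃ L : ℝ × ℝ × ℝ × ℝ × ℝ →L[ℝ] ℝ, HasFDerivAt (totalDx F) L (t, x, u, ut, ux) ∧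
      ∀ utx uxx, L (0, 1, ux, utx, uxx) =
        truncTotalDxx F (t, x, u) ux + uxx * pdu F (t, x, u) := by
  have hid := hasFDerivAt_id (𝕜 := ℝ) ((t, x, u, ut, ux) : ℝ × ℝ × ℝ × ℝ × ℝ)
  have hdir := (hasFDerivAt_const (𝕜 := ℝ) (0 : ℝ) (t, x, u, ut, ux)).prodMk
    ((hasFDerivAt_const (𝕜 := ℝ) (1 : ℝ) (t, x, u, ut, ux)).prodMk hid.snd.snd.snd.snd)
  have hbase := (differentiableAt_fderiv hF).hasFDerivAt.comp
    (f := fun j : ℝ × ℝ × ℝ × ℝ × ℝ => (j.1, j.2.1, j.2.2.1)) (t, x, u, ut, ux)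
    (hid.fst.prodMk (hid.snd.fst.prodMk hid.snd.snd.fst))
  refine ⟨_, hbase.clm_apply hdir, fun utx uxx => ?_⟩
  rw [← fderiv_fderiv_eq_truncTotalDxx hF]
  simp [fderiv_eq_partials, add_comm]

theorem etaXX_eq {Q : PointSpace → PointSpace} {t x u : ℝ} (hQ : ContDiffAt ℝ ∞ Q (t, x, u))
    (ut ux utx uxx : ℝ) :
    etaXX Q (t, x, u, ut, ux) utx uxx =
      (truncTotalDxx (eta Q) (t, x, u) ux + uxx * pdu (eta Q) (t, x, u))
        - ut * (truncTotalDxx (xiT Q) (t, x, u) ux + uxx * pdu (xiT Q) (t, x, u))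
        - ux * (truncTotalDxx (xiX Q) (t, x, u) ux + uxx * pdu (xiX Q) (t, x, u))
        - 2 * utx * (pdx (xiT Q) (t, x, u) + ux * pdu (xiT Q) (t, x, u))
        - 2 * uxx * (pdx (xiX Q) (t, x, u) + ux * pdu (xiX Q) (t, x, u)) := by
  obtain ⟨Lη, hη, hLη⟩ := hasFDerivAt_totalDx (F := eta Q) (ut := ut) (ux := ux) hQ.snd.snd
  obtain ⟨Lt, ht, hLt⟩ := hasFDerivAt_totalDx (F := xiT Q) (ut := ut) (ux := ux) hQ.fst
  obtain ⟨Lx, hx, hLx⟩ := hasFDerivAt_totalDx (F := xiX Q) (ut := ut) (ux := ux) hQ.snd.fst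
  have hid := hasFDerivAt_id (𝕜 := ℝ) ((t, x, u, ut, ux) : ℝ × ℝ × ℝ × ℝ × ℝ)
  have hetaX : HasFDerivAt (etaX Q) _ (t, x, u, ut, ux) :=
    (hη.sub (hid.snd.snd.snd.fst.mul ht)).sub (hid.snd.snd.snd.snd.mul hx)
  rw [etaXX, hetaX.fderiv]
  simp only [sub_apply, add_apply, smul_apply, hLη, hLt, hLx, ContinuousLinearMap.comp_apply,
    ContinuousLinearMap.coe_fst', ContinuousLinearMap.coe_snd', ContinuousLinearMap.coe_id', id_eq,
    smul_eq_mul, totalDx, fderiv_eq_partials]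
  ring

theorem fderiv_equationLHS {f D K : ℝ → ℝ} {x u : ℝ} (hf : DifferentiableAt ℝ f x)
    (hD : DifferentiableAt ℝ D u) (hD' : DifferentiableAt ℝ (deriv D) u)
    (hK : DifferentiableAt ℝ K u) (t ut ux uxx a b c d e g : ℝ) :
    fderiv ℝ (equationLHS f D K) (t, x, u, ut, ux, uxx) (a, b, c, d, e, g) =
      b * deriv f x * ut + f x * d - c * deriv D u * uxx - D u * g
        - c * deriv (deriv D) u * ux ^ 2 - 2 * deriv D u * ux * e
        - c * deriv K u * ux - K u * e := by
  have hid := hasFDerivAt_id (𝕜 := ℝ) ((t, x, u, ut, ux, uxx) : ℝ × ℝ × ℝ × ℝ × ℝ × ℝ)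
  have hx := hid.snd.fst
  have hu := hid.snd.snd.fst
  have hux := hid.snd.snd.snd.snd.fst
  have hLHS : HasFDerivAt (equationLHS f D K) _ (t, x, u, ut, ux, uxx) :=
    ((((HasDerivAt.comp_hasFDerivAt (h₂ := f) _ hf.hasDerivAt hx).mul hid.snd.snd.snd.fst).sub
      ((HasDerivAt.comp_hasFDerivAt (h₂ := D) _ hD.hasDerivAt hu).mul
        hid.snd.snd.snd.snd.snd)).sub
      ((HasDerivAt.comp_hasFDerivAt (h₂ := deriv D) _ hD'.hasDerivAt hu).mul (hux.pow 2))).sub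
      ((HasDerivAt.comp_hasFDerivAt (h₂ := K) _ hK.hasDerivAt hu).mul hux)
  rw [hLHS.fderiv]
  simp only [id_eq, Function.comp_apply, ContinuousLinearMap.comp_id, Nat.add_one_sub_one, pow_one,
    nsmul_eq_mul, Nat.cast_ofNat, sub_apply, add_apply, smul_apply,
    ContinuousLinearMap.comp_apply, ContinuousLinearMap.coe_snd', ContinuousLinearMap.coe_fst',
    smul_eq_mul]
  ring

/-! ### Determining equations -/

theorem contDiffOn_deriv_of_isOpen {S : Set ℝ} (hS : IsOpen S) {g : ℝ → ℝ}
    (hg : ContDiffOn ℝ ∞ g S) : ContDiffOn ℝ ∞ (deriv g) S :=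
  hg.deriv_of_isOpen hS (by simp)

theorem hasDerivAt_deriv_of_isOpen {S : Set ℝ} (hS : IsOpen S) {g : ℝ → ℝ}
    (hg : ContDiffOn ℝ ∞ g S) {x : ℝ} (hx : x ∈ S) : HasDerivAt g (deriv g x) x :=
  ((hg.contDiffAt (hS.mem_nhds hx)).differentiableAt (by simp)).hasDerivAt

namespace IsAdmissible

variable {I J : Set ℝ} {f D K : ℝ → ℝ} (hadm : IsAdmissible I J f D K)

include hadm

theorem hasDerivAt_f {x : ℝ} (hx : x ∈ I) : HasDerivAt f (deriv f x) x :=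
  hasDerivAt_deriv_of_isOpen hadm.interval_x.1 hadm.smooth_f hx

theorem hasDerivAt_D {u : ℝ} (hu : u ∈ J) : HasDerivAt D (deriv D u) u :=
  hasDerivAt_deriv_of_isOpen hadm.interval_u.1 hadm.smooth_D hu

theorem hasDerivAt_K {u : ℝ} (hu : u ∈ J) : HasDerivAt K (deriv K u) u :=
  hasDerivAt_deriv_of_isOpen hadm.interval_u.1 hadm.smooth_K hu

theorem hasDerivAt_deriv_D {u : ℝ} (hu : u ∈ J) : HasDerivAt (deriv D) (deriv (deriv D) u) u :=
  hasDerivAt_deriv_of_isOpen hadm.interval_u.1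
    (contDiffOn_deriv_of_isOpen hadm.interval_u.1 hadm.smooth_D) hu

end IsAdmissible

section DeterminingEquations

variable {T I J : Set ℝ} {f D K : ℝ → ℝ} {Q : PointSpace → PointSpace}

theorem symmetry_identity {Ω : Set PointSpace} (hadm : IsAdmissible I J f D K)
    (hs : IsInfinitesimalSymmetry f D K Ω Q) {t x u : ℝ} (hΩ : (t, x, u) ∈ Ω) (hx : x ∈ I)
    (hu : u ∈ J) {ut ux uxx : ℝ} (h : f x * ut = D u * uxx + deriv D u * ux ^ 2 + K u * ux)
    (utx : ℝ) :
    xiX Q (t, x, u) * deriv f x * ut + f x * etaT Q (t, x, u, ut, ux)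
      - eta Q (t, x, u) * (deriv D u * uxx + deriv (deriv D) u * ux ^ 2 + deriv K u * ux)
      - (2 * deriv D u * ux + K u) * etaX Q (t, x, u, ut, ux)
      - D u * etaXX Q (t, x, u, ut, ux) utx uxx = 0 := by
  have hinv := hs t x u ut ux utx uxx hΩ (by simp only [equationLHS]; linarith)
  rw [fderiv_equationLHS (hadm.hasDerivAt_f hx).differentiableAt
    (hadm.hasDerivAt_D hu).differentiableAt (hadm.hasDerivAt_deriv_D hu).differentiableAt
    (hadm.hasDerivAt_K hu).differentiableAt] at hinv
  linear_combination hinv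

-- `u_tx` enters the identity only through the term `2 D(u) u_tx D_x ξ^t`.
theorem pdx_pdu_xiT_eq_zero (hT : IsOpen T) (hadm : IsAdmissible I J f D K)
    (hQ : ContDiffOn ℝ ∞ Q (box T I J)) (hs : IsInfinitesimalSymmetry f D K (box T I J) Q)
    {p : PointSpace} (hp : p ∈ box T I J) : pdx (xiT Q) p = 0 ∧ pdu (xiT Q) p = 0 := by
  have hQp := hQ.contDiffAt ((isOpen_box hT hadm.interval_x.1 hadm.interval_u.1).mem_nhds hp)
  obtain ⟨t, x, u⟩ := p
  have htotal : ∀ ux : ℝ, pdx (xiT Q) (t, x, u) + ux * pdu (xiT Q) (t, x, u) = 0 := by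
    intro ux
    have hut := mul_div_cancel₀ (D u * 0 + deriv D u * ux ^ 2 + K u * ux)
      (hadm.f_ne_zero x hp.2.1)
    have h₀ := symmetry_identity hadm hs hp hp.2.1 hp.2.2 hut 0
    have h₁ := symmetry_identity hadm hs hp hp.2.1 hp.2.2 hut 1
    rw [etaXX_eq hQp] at h₀ h₁
    refine (mul_eq_zero.1 ?_).resolve_left (hadm.D_ne_zero u hp.2.2)
    linear_combination (h₁ - h₀) / 2
  have h₀ := htotal 0
  have h₁ := htotal 1
  constructor <;> linarith

theorem pdu_xiX_eq_zero (hT : IsOpen T) (hadm : IsAdmissible I J f D K)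
    (hQ : ContDiffOn ℝ ∞ Q (box T I J)) (hs : IsInfinitesimalSymmetry f D K (box T I J) Q)
    {p : PointSpace} (hp : p ∈ box T I J) : pdu (xiX Q) p = 0 := by
  have hΩ := isOpen_box hT hadm.interval_x.1 hadm.interval_u.1
  have hτ := fun q hq => pdx_pdu_xiT_eq_zero hT hadm hQ hs (p := q) hq
  obtain ⟨hτx, hτu⟩ := hτ p hp
  obtain ⟨hτxx, hτxu⟩ := pdx_pdu_eq_zero_of_eqOn_zero hΩ (fun q hq => (hτ q hq).1) hp
  obtain ⟨hτux, hτuu⟩ := pdx_pdu_eq_zero_of_eqOn_zero hΩ (fun q hq => (hτ q hq).2) hp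
  have hQp := hQ.contDiffAt (hΩ.mem_nhds hp)
  obtain ⟨t, x, u⟩ := p
  have hf := hadm.f_ne_zero x hp.2.1
  have key (ux uxx : ℝ) := symmetry_identity hadm hs hp hp.2.1 hp.2.2
    (mul_div_cancel₀ (D u * uxx + deriv D u * ux ^ 2 + K u * ux) hf) 0
  simp only [etaXX_eq hQp, etaT, etaX, totalDt, totalDx, fderiv_eq_partials, truncTotalDxx, hτx,
    hτu, hτxx, hτxu, hτux, hτuu] at key
  have k₀₀ := key 0 0
  have k₁₀ := key 1 0
  have k₀₁ := key 0 1
  have k₁₁ := key 1 1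
  field_simp at k₀₀ k₁₀ k₀₁ k₁₁
  -- the coefficient of `u_x u_xx`
  have hcoeff : D u * pdu (xiX Q) (t, x, u) * f x = 0 := by
    linear_combination (k₁₁ - k₁₀ - k₀₁ + k₀₀) / 2
  simpa [hadm.D_ne_zero u hp.2.2, hf] using hcoeff

theorem determining_equations (hT : IsOpen T) (hadm : IsAdmissible I J f D K)
    (hQ : ContDiffOn ℝ ∞ Q (box T I J)) (hs : IsInfinitesimalSymmetry f D K (box T I J) Q)
    {t x u : ℝ} (hp : (t, x, u) ∈ box T I J) :
    let p := (t, x, u)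
    D u * (xiX Q p * deriv f x - f x * pdt (xiT Q) p + 2 * f x * pdx (xiX Q) p)
        = f x * (eta Q p * deriv D u) ∧
      deriv D u * (xiX Q p * deriv f x - f x * pdt (xiT Q) p + 2 * f x * pdx (xiX Q) p)
        = f x * (eta Q p * deriv (deriv D) u + pdu (eta Q) p * deriv D u
          + D u * pdu (pdu (eta Q)) p) ∧
      K u * (xiX Q p * deriv f x - f x * pdt (xiT Q) p + f x * pdx (xiX Q) p)
        = f x * (f x * pdt (xiX Q) p + eta Q p * deriv K u + 2 * deriv D u * pdx (eta Q) p
          + D u * (2 * pdx (pdu (eta Q)) p - pdx (pdx (xiX Q)) p)) ∧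
      f x * pdt (eta Q) p = D u * pdx (pdx (eta Q)) p + K u * pdx (eta Q) p := by
  intro _
  have hΩ := isOpen_box hT hadm.interval_x.1 hadm.interval_u.1
  have hτ := fun q hq => pdx_pdu_xiT_eq_zero hT hadm hQ hs (p := q) hq
  have hξ := fun q hq => pdu_xiX_eq_zero hT hadm hQ hs (p := q) hq
  obtain ⟨hτx, hτu⟩ := hτ (t, x, u) hp
  obtain ⟨hτxx, hτxu⟩ := pdx_pdu_eq_zero_of_eqOn_zero hΩ (fun q hq => (hτ q hq).1) hp
  obtain ⟨hτux, hτuu⟩ := pdx_pdu_eq_zero_of_eqOn_zero hΩ (fun q hq => (hτ q hq).2) hp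
  obtain ⟨hξux, hξuu⟩ := pdx_pdu_eq_zero_of_eqOn_zero hΩ hξ hp
  have hQp := hQ.contDiffAt (hΩ.mem_nhds hp)
  have hηxu := pdu_pdx_eq_pdx_pdu (F := eta Q) hQp.snd.snd
  have hξxu := (pdu_pdx_eq_pdx_pdu (F := xiX Q) hQp.snd.fst).trans hξux
  have hf := hadm.f_ne_zero x hp.2.1
  have key (ux uxx : ℝ) := symmetry_identity hadm hs hp hp.2.1 hp.2.2
    (mul_div_cancel₀ (D u * uxx + deriv D u * ux ^ 2 + K u * ux) hf) 0
  simp only [etaXX_eq hQp, etaT, etaX, totalDt, totalDx, fderiv_eq_partials, truncTotalDxx, hτx,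
    hτu, hτxx, hτxu, hτux, hτuu, hξux, hξuu, hξxu, hηxu, hξ (t, x, u) hp] at key
  have k₀₀ := key 0 0
  have k₁₀ := key 1 0
  have k₂₀ := key (-1) 0
  have k₀₁ := key 0 1
  field_simp at k₀₀ k₁₀ k₂₀ k₀₁
  refine ⟨?_, ?_, ?_, mul_left_cancel₀ hf ?_⟩
  · linear_combination k₀₁ - k₀₀
  · linear_combination (k₁₀ + k₂₀) / 2 - k₀₀
  · linear_combination (k₁₀ - k₂₀) / 2
  · linear_combination k₀₀

end DeterminingEquations

/-! ### Coefficients of the symmetries -/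

section Slices₂

variable {U : Set (ℝ × ℝ)} {g : ℝ → ℝ → ℝ}

theorem contDiffOn_slice_fst (hg : ContDiffOn ℝ ∞ (fun z : ℝ × ℝ => g z.1 z.2) U) (x : ℝ) :
    ContDiffOn ℝ ∞ (fun t => g t x) {t | (t, x) ∈ U} :=
  ContDiffOn.comp (g := fun z : ℝ × ℝ => g z.1 z.2) (f := fun t => (t, x)) hg
    (contDiff_id.prodMk contDiff_const).contDiffOn fun _ h => h

theorem contDiffOn_slice_snd (hg : ContDiffOn ℝ ∞ (fun z : ℝ × ℝ => g z.1 z.2) U) (t : ℝ) :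
    ContDiffOn ℝ ∞ (g t) {x | (t, x) ∈ U} :=
  ContDiffOn.comp (g := fun z : ℝ × ℝ => g z.1 z.2) (f := fun x => (t, x)) hg
    (contDiff_const.prodMk contDiff_id).contDiffOn fun _ h => h

theorem isOpen_slice_snd (hU : IsOpen U) (t : ℝ) : IsOpen {x | (t, x) ∈ U} :=
  hU.preimage (by fun_prop : Continuous fun x : ℝ => (t, x))

variable (hU : IsOpen U) (hg : ContDiffOn ℝ ∞ (fun z : ℝ × ℝ => g z.1 z.2) U) {t x : ℝ}
  (h : (t, x) ∈ U)

include hU hg h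

theorem hasDerivAt_slice_fst : HasDerivAt (fun s => g s x) (deriv (fun s => g s x) t) t :=
  hasDerivAt_deriv_of_isOpen (hU.preimage (by fun_prop : Continuous fun s : ℝ => (s, x)))
    (contDiffOn_slice_fst hg x) h

theorem hasDerivAt_slice_snd : HasDerivAt (g t) (deriv (g t) x) x :=
  hasDerivAt_deriv_of_isOpen (isOpen_slice_snd hU t) (contDiffOn_slice_snd hg t) h

theorem hasDerivAt_deriv_slice_snd : HasDerivAt (deriv (g t)) (deriv (deriv (g t)) x) x :=
  hasDerivAt_deriv_of_isOpen (isOpen_slice_snd hU t)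
    (contDiffOn_deriv_of_isOpen (isOpen_slice_snd hU t) (contDiffOn_slice_snd hg t)) h

theorem fderiv_eq_deriv_slices (a b : ℝ) :
    fderiv ℝ (fun z : ℝ × ℝ => g z.1 z.2) (t, x) (a, b)
      = deriv (fun s => g s x) t * a + deriv (g t) x * b := by
  have hdiff := ((hg.contDiffAt (hU.mem_nhds h)).differentiableAt (by simp)).hasFDerivAt
  have hfst := hdiff.comp_hasDerivAt (f := fun s : ℝ => (s, x)) t
    ((hasDerivAt_id' t).prodMk (hasDerivAt_const t x))
  have hsnd := hdiff.comp_hasDerivAt (f := fun y : ℝ => (t, y)) x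
    ((hasDerivAt_const x t).prodMk (hasDerivAt_id' x))
  have hsplit : ((a, b) : ℝ × ℝ) = a • (1, 0) + b • (0, 1) := by simp
  rw [hsplit, map_add, map_smul, map_smul, ← hfst.deriv, ← hsnd.deriv, smul_eq_mul, smul_eq_mul,
    mul_comm a, mul_comm b]
  rfl

end Slices₂

/-- The function `g(t, x)` is smooth on `T × I`. -/
def SmoothOn₂ (T I : Set ℝ) (g : ℝ → ℝ → ℝ) : Prop :=
  ContDiffOn ℝ ∞ (fun z : ℝ × ℝ => g z.1 z.2) (T ×ˢ I)

namespace SmoothOn₂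

variable {T I : Set ℝ} {g : ℝ → ℝ → ℝ}

theorem slice_x (hg : SmoothOn₂ T I g) {t : ℝ} (ht : t ∈ T) : ContDiffOn ℝ ∞ (g t) I :=
  (contDiffOn_slice_snd hg t).mono fun _ hx => ⟨ht, hx⟩

theorem slice_t (hg : SmoothOn₂ T I g) {x : ℝ} (hx : x ∈ I) :
    ContDiffOn ℝ ∞ (fun t => g t x) T :=
  (contDiffOn_slice_fst hg x).mono fun _ ht => ⟨ht, hx⟩

theorem hasDerivAt_x (hg : SmoothOn₂ T I g) (hI : IsOpen I) {t x : ℝ} (ht : t ∈ T) (hx : x ∈ I) :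
    HasDerivAt (g t) (deriv (g t) x) x :=
  hasDerivAt_deriv_of_isOpen hI (hg.slice_x ht) hx

theorem hasDerivAt_t (hg : SmoothOn₂ T I g) (hT : IsOpen T) {t x : ℝ} (ht : t ∈ T) (hx : x ∈ I) :
    HasDerivAt (fun s => g s x) (deriv (fun s => g s x) t) t :=
  hasDerivAt_deriv_of_isOpen hT (hg.slice_t hx) ht

theorem deriv_x (hg : SmoothOn₂ T I g) (hT : IsOpen T) (hI : IsOpen I) :
    SmoothOn₂ T I fun t => deriv (g t) := by
  refine ((hg.fderiv_of_isOpen (hT.prod hI) (m := ∞) (by simp)).clm_apply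
    (contDiffOn_const (c := ((0 : ℝ), (1 : ℝ))))).congr fun z hz => ?_
  rw [fderiv_eq_deriv_slices (hT.prod hI) hg hz, mul_zero, mul_one, zero_add]

theorem hasDerivAt_deriv_x (hg : SmoothOn₂ T I g) (hI : IsOpen I) {t x : ℝ} (ht : t ∈ T)
    (hx : x ∈ I) : HasDerivAt (deriv (g t)) (deriv (deriv (g t)) x) x :=
  hasDerivAt_deriv_of_isOpen hI (contDiffOn_deriv_of_isOpen hI (hg.slice_x ht)) hx

theorem contDiffOn_box (hg : SmoothOn₂ T I g) (J : Set ℝ) :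
    ContDiffOn ℝ ∞ (fun p : PointSpace => g p.1 p.2.1) (box T I J) :=
  hg.comp (f := fun p : PointSpace => (p.1, p.2.1)) (by fun_prop) fun _ hp => ⟨hp.1, hp.2.1⟩

end SmoothOn₂

theorem SmoothOn₂.of_contDiffOn_box {T I J : Set ℝ} {F : PointSpace → ℝ}
    (hF : ContDiffOn ℝ ∞ F (box T I J)) {u : ℝ} (hu : u ∈ J) :
    SmoothOn₂ T I fun t x => F (t, x, u) :=
  hF.comp (f := fun z : ℝ × ℝ => (z.1, z.2, u)) (by fun_prop) fun _ hz => ⟨hz.1, hz.2, hu⟩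

theorem exists_smoothOn₂_of_pdu_eq_zero {T I J : Set ℝ} {F : PointSpace → ℝ} (hT : IsOpen T)
    (hI : IsOpen I) (hJ : IsOpenInterval J) (hF : ContDiffOn ℝ ∞ F (box T I J))
    (hFu : ∀ p ∈ box T I J, pdu F p = 0) :
    ∃ g, SmoothOn₂ T I g ∧ ∀ t ∈ T, ∀ x ∈ I, ∀ u ∈ J, F (t, x, u) = g t x := by
  obtain ⟨u₀, hu₀⟩ := hJ.2.2
  refine ⟨fun t x => F (t, x, u₀), .of_contDiffOn_box hF hu₀, fun t ht x hx u hu =>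
    hJ.eq_of_hasDerivAt_zero (g := fun v => F (t, x, v)) (fun v hv => ?_) hu hu₀⟩
  have hp : (t, x, v) ∈ box T I J := ⟨ht, hx, hv⟩
  have hdiff := (hF.contDiffAt ((isOpen_box hT hI hJ.1).mem_nhds hp)).differentiableAt (by simp)
  exact hFu _ hp ▸ hasDerivAt_slice_u hdiff

/-- On `T × I × J` the function `F(t, x, u)` is the affine function `a(t, x) u + b(t, x)` of `u`,
with smooth coefficients. -/
structure AffineInU (T I J : Set ℝ) (F : PointSpace → ℝ) (a b : ℝ → ℝ → ℝ) : Prop where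
  smooth_a : SmoothOn₂ T I a
  smooth_b : SmoothOn₂ T I b
  eq : ∀ t ∈ T, ∀ x ∈ I, ∀ u ∈ J, F (t, x, u) = a t x * u + b t x

section AffineInU

variable {T I J : Set ℝ} {F : PointSpace → ℝ} {a b : ℝ → ℝ → ℝ}

theorem exists_affineInU (hT : IsOpen T) (hI : IsOpen I) (hJ : IsOpenInterval J)
    (hF : ContDiffOn ℝ ∞ F (box T I J)) (hFuu : ∀ p ∈ box T I J, pdu (pdu F) p = 0) :
    ∃ a b, AffineInU T I J F a b := by
  have hΩ := isOpen_box hT hI hJ.1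
  have hFu : ContDiffOn ℝ ∞ (pdu F) (box T I J) :=
    (hF.fderiv_of_isOpen hΩ (m := ∞) (by simp)).clm_apply contDiffOn_const
  obtain ⟨a, ha, hFa⟩ := exists_smoothOn₂_of_pdu_eq_zero hT hI hJ hFu hFuu
  have hasm : ContDiffOn ℝ ∞ (fun p : PointSpace => a p.1 p.2.1 * p.2.2) (box T I J) :=
    (ha.comp (f := fun p : PointSpace => (p.1, p.2.1)) (by fun_prop)
      fun p hp => ⟨hp.1, hp.2.1⟩).mul (by fun_prop)
  obtain ⟨b, hb, hFb⟩ := exists_smoothOn₂_of_pdu_eq_zero hT hI hJ (hF.sub hasm) fun p hp => by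
    obtain ⟨t, x, u⟩ := p
    have hdiff {G : PointSpace → ℝ} (hG : ContDiffOn ℝ ∞ G (box T I J)) :
        DifferentiableAt ℝ G (t, x, u) :=
      (hG.contDiffAt (hΩ.mem_nhds hp)).differentiableAt (by simp)
    have hsub := (hasDerivAt_slice_u (hdiff hF)).sub ((hasDerivAt_id' u).const_mul (a t x))
    rw [mul_one, hFa t hp.1 x hp.2.1 u hp.2.2, sub_self] at hsub
    exact (hasDerivAt_slice_u (hdiff (hF.sub hasm))).unique hsub
  exact ⟨a, b, ha, hb, fun t ht x hx u hu => sub_eq_iff_eq_add'.1 (hFb t ht x hx u hu)⟩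

namespace AffineInU

variable (hF : AffineInU T I J F a b) (hT : IsOpen T) (hI : IsOpen I) (hJ : IsOpen J)

include hF hT hI hJ

theorem differentiableAt {p : PointSpace} (hp : p ∈ box T I J) : DifferentiableAt ℝ F p := by
  have hΩ := isOpen_box hT hI hJ
  have hsm : ContDiffOn ℝ ∞ F (box T I J) :=
    (((hF.smooth_a.contDiffOn_box J).mul (contDiff_snd.comp contDiff_snd).contDiffOn).add
      (hF.smooth_b.contDiffOn_box J)).congr fun q hq => hF.eq q.1 hq.1 q.2.1 hq.2.1 q.2.2 hq.2.2
  exact (hsm.contDiffAt (hΩ.mem_nhds hp)).differentiableAt (by simp)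

theorem pdt_eq {t x u : ℝ} (hp : (t, x, u) ∈ box T I J) :
    pdt F (t, x, u) = deriv (fun s => a s x) t * u + deriv (fun s => b s x) t :=
  (hasDerivAt_slice_t (hF.differentiableAt hT hI hJ hp)).unique <|
    (((hF.smooth_a.hasDerivAt_t hT hp.1 hp.2.1).mul_const u).add
      (hF.smooth_b.hasDerivAt_t hT hp.1 hp.2.1)).congr_of_eventuallyEq <|
    Filter.eventually_of_mem (hT.mem_nhds hp.1) fun s hs => hF.eq s hs x hp.2.1 u hp.2.2

theorem pdx : AffineInU T I J (pdx F) (fun t => deriv (a t)) (fun t => deriv (b t)) where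
  smooth_a := hF.smooth_a.deriv_x hT hI
  smooth_b := hF.smooth_b.deriv_x hT hI
  eq t ht x hx u hu :=
    (hasDerivAt_slice_x (hF.differentiableAt hT hI hJ (p := (t, x, u)) ⟨ht, hx, hu⟩)).unique <|
      (((hF.smooth_a.hasDerivAt_x hI ht hx).mul_const u).add
        (hF.smooth_b.hasDerivAt_x hI ht hx)).congr_of_eventuallyEq <|
      Filter.eventually_of_mem (hI.mem_nhds hx) fun y hy => hF.eq t ht y hy u hu

theorem pdu : AffineInU T I J (pdu F) (fun _ _ => 0) a where
  smooth_a := contDiffOn_const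
  smooth_b := hF.smooth_a
  eq t ht x hx u hu := by
    rw [zero_mul, zero_add]
    refine (hasDerivAt_slice_u
      (hF.differentiableAt hT hI hJ (p := (t, x, u)) ⟨ht, hx, hu⟩)).unique ?_
    have haffine := ((hasDerivAt_id' u).const_mul (a t x)).add_const (b t x)
    rw [mul_one] at haffine
    exact haffine.congr_of_eventuallyEq <|
      Filter.eventually_of_mem (hJ.mem_nhds hu) fun v hv => hF.eq t ht x hx v hv

end AffineInU

end AffineInU

/-- The vector field `τ(t) ∂_t + ξ(t, x) ∂_x + (a(t, x) u + b(t, x)) ∂_u` is given by smooth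
coefficients satisfying the determining equations for the symmetries of
`f(x) u_t = (D(u) u_x)_x + K(u) u_x`, obtained by splitting the invariance criterion with respect
to `u_xx`, `u_x` and `1`. -/
structure SymmetryCoefficients (T I J : Set ℝ) (f D K : ℝ → ℝ) (Q : PointSpace → PointSpace)
    (τ : ℝ → ℝ) (ξ a b : ℝ → ℝ → ℝ) : Prop where
  eq : ∀ t ∈ T, ∀ x ∈ I, ∀ u ∈ J, Q (t, x, u) = (τ t, ξ t x, a t x * u + b t x)
  smooth_τ : ContDiffOn ℝ ∞ τ T
  smooth_ξ : SmoothOn₂ T I ξ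
  smooth_a : SmoothOn₂ T I a
  smooth_b : SmoothOn₂ T I b
  eq_uxx : ∀ t ∈ T, ∀ x ∈ I, ∀ u ∈ J,
    D u * (ξ t x * deriv f x - f x * deriv τ t + 2 * f x * deriv (ξ t) x)
      = f x * ((a t x * u + b t x) * deriv D u)
  eq_ux : ∀ t ∈ T, ∀ x ∈ I, ∀ u ∈ J,
    K u * (ξ t x * deriv f x - f x * deriv τ t + f x * deriv (ξ t) x)
      = f x * (f x * deriv (fun s => ξ s x) t + (a t x * u + b t x) * deriv K u
        + 2 * deriv D u * (deriv (a t) x * u + deriv (b t) x)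
        + D u * (2 * deriv (a t) x - deriv (deriv (ξ t)) x))
  eq_one : ∀ t ∈ T, ∀ x ∈ I, ∀ u ∈ J,
    f x * (deriv (fun s => a s x) t * u + deriv (fun s => b s x) t)
      = D u * (deriv (deriv (a t)) x * u + deriv (deriv (b t)) x)
        + K u * (deriv (a t) x * u + deriv (b t) x)

section SymmetryCoefficients

variable {T I J : Set ℝ} {f D K : ℝ → ℝ} {Q : PointSpace → PointSpace} {τ : ℝ → ℝ}
  {ξ a b : ℝ → ℝ → ℝ}

theorem exists_affineInU_xiX (hT : IsOpen T) (hadm : IsAdmissible I J f D K)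
    (hQ : ContDiffOn ℝ ∞ Q (box T I J)) (hs : IsInfinitesimalSymmetry f D K (box T I J) Q) :
    ∃ ξ, AffineInU T I J (xiX Q) (fun _ _ => 0) ξ := by
  obtain ⟨ξ, hξ, hQξ⟩ := exists_smoothOn₂_of_pdu_eq_zero hT hadm.interval_x.1 hadm.interval_u
    hQ.snd.fst fun p hp => pdu_xiX_eq_zero hT hadm hQ hs hp
  exact ⟨ξ, contDiffOn_const, hξ, fun t ht x hx u hu => by
    rw [zero_mul, zero_add]; exact hQξ t ht x hx u hu⟩

theorem exists_affineInU_xiT (hT : IsOpen T) (hadm : IsAdmissible I J f D K)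
    (hQ : ContDiffOn ℝ ∞ Q (box T I J)) (hs : IsInfinitesimalSymmetry f D K (box T I J) Q) :
    ∃ τ, ContDiffOn ℝ ∞ τ T ∧ AffineInU T I J (xiT Q) (fun _ _ => 0) fun t _ => τ t := by
  have hI := hadm.interval_x
  have hJ := hadm.interval_u
  obtain ⟨g, hg, hQg⟩ := exists_smoothOn₂_of_pdu_eq_zero hT hI.1 hJ hQ.fst
    fun p hp => (pdx_pdu_xiT_eq_zero hT hadm hQ hs hp).2
  have hgaff : AffineInU T I J (xiT Q) (fun _ _ => 0) g := ⟨contDiffOn_const, hg,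
    fun t ht x hx u hu => by rw [zero_mul, zero_add]; exact hQg t ht x hx u hu⟩
  obtain ⟨x₀, hx₀⟩ := hI.2.2
  obtain ⟨u₀, hu₀⟩ := hJ.2.2
  have hgx {t x : ℝ} (ht : t ∈ T) (hx : x ∈ I) : deriv (g t) x = 0 := by
    have hpdx := (hgaff.pdx hT hI.1 hJ.1).eq t ht x hx u₀ hu₀
    rw [(pdx_pdu_xiT_eq_zero hT hadm hQ hs (p := (t, x, u₀)) ⟨ht, hx, hu₀⟩).1] at hpdx
    simpa using hpdx.symm
  have hgconst {t x : ℝ} (ht : t ∈ T) (hx : x ∈ I) : g t x = g t x₀ :=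
    hI.eq_of_hasDerivAt_zero (fun y hy => hgx ht hy ▸ hg.hasDerivAt_x hI.1 ht hy) hx hx₀
  exact ⟨fun t => g t x₀, hg.slice_t hx₀, contDiffOn_const,
    hg.congr fun z hz => (hgconst hz.1 hz.2).symm,
    fun t ht x hx u hu => (hgaff.eq t ht x hx u hu).trans (by rw [hgconst ht hx])⟩

-- Differentiating the first determining equation with respect to `u` gives the second one
-- without its term `D η_uu`.
theorem pdu_pdu_eta_eq_zero (hT : IsOpen T) (hadm : IsAdmissible I J f D K)
    (hQ : ContDiffOn ℝ ∞ Q (box T I J)) (hs : IsInfinitesimalSymmetry f D K (box T I J) Q)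
    {p : PointSpace} (hp : p ∈ box T I J) : pdu (pdu (eta Q)) p = 0 := by
  have hI := hadm.interval_x.1
  have hJ := hadm.interval_u.1
  obtain ⟨ξ, hξ⟩ := exists_affineInU_xiX hT hadm hQ hs
  obtain ⟨τ, -, hτ⟩ := exists_affineInU_xiT hT hadm hQ hs
  obtain ⟨t, x, u⟩ := p
  obtain ⟨ht, hx, hu⟩ : t ∈ T ∧ x ∈ I ∧ u ∈ J := hp
  have hdet {v : ℝ} (hv : v ∈ J) := determining_equations hT hadm hQ hs (t := t) (x := x) (u := v)
    ⟨ht, hx, hv⟩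
  have hcoeff {v : ℝ} (hv : v ∈ J) : xiX Q (t, x, v) * deriv f x - f x * pdt (xiT Q) (t, x, v)
      + 2 * f x * pdx (xiX Q) (t, x, v)
        = ξ t x * deriv f x - f x * deriv τ t + 2 * f x * deriv (ξ t) x := by
    rw [hξ.eq t ht x hx v hv, hτ.pdt_eq hT hI hJ ⟨ht, hx, hv⟩,
      (hξ.pdx hT hI hJ).eq t ht x hx v hv]
    simp
  have hleft := (hadm.hasDerivAt_D hu).mul_const
    (ξ t x * deriv f x - f x * deriv τ t + 2 * f x * deriv (ξ t) x)
  have hη : DifferentiableAt ℝ (eta Q) (t, x, u) :=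
    (hQ.snd.snd.contDiffAt ((isOpen_box hT hI hJ).mem_nhds ⟨ht, hx, hu⟩)).differentiableAt
      (by simp)
  have hright := ((hasDerivAt_slice_u hη).mul (hadm.hasDerivAt_deriv_D hu)).const_mul (f x)
  have hderiv := hleft.unique <| hright.congr_of_eventuallyEq <|
    Filter.eventually_of_mem (hJ.mem_nhds hu) fun v hv => hcoeff hv ▸ (hdet hv).1
  have hzero : f x * D u * pdu (pdu (eta Q)) (t, x, u) = 0 := by
    have heq := (hdet hu).2.1
    rw [hcoeff hu] at heq
    linear_combination hderiv - heq
  simpa [hadm.f_ne_zero x hx, hadm.D_ne_zero u hu] using hzero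

theorem exists_symmetryCoefficients (hT : IsOpen T) (hadm : IsAdmissible I J f D K)
    (hQ : ContDiffOn ℝ ∞ Q (box T I J)) (hs : IsInfinitesimalSymmetry f D K (box T I J) Q) :
    ∃ τ ξ a b, SymmetryCoefficients T I J f D K Q τ ξ a b := by
  have hI := hadm.interval_x.1
  have hJ := hadm.interval_u.1
  obtain ⟨τ, hτsm, hτ⟩ := exists_affineInU_xiT hT hadm hQ hs
  obtain ⟨ξ, hξ⟩ := exists_affineInU_xiX hT hadm hQ hs
  obtain ⟨a, b, hη⟩ := exists_affineInU (F := eta Q) hT hI hadm.interval_u hQ.snd.snd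
    fun p hp => pdu_pdu_eta_eq_zero hT hadm hQ hs hp
  have hdet {t x u : ℝ} (ht : t ∈ T) (hx : x ∈ I) (hu : u ∈ J) := by
    have hp : (t, x, u) ∈ box T I J := ⟨ht, hx, hu⟩
    have h := determining_equations hT hadm hQ hs hp
    have hηx := hη.pdx hT hI hJ
    have hξx := hξ.pdx hT hI hJ
    simp only [hξ.eq t ht x hx u hu, hτ.pdt_eq hT hI hJ hp, hξ.pdt_eq hT hI hJ hp,
      hξx.eq t ht x hx u hu, (hξx.pdx hT hI hJ).eq t ht x hx u hu, hη.pdt_eq hT hI hJ hp,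
      hη.eq t ht x hx u hu, hηx.eq t ht x hx u hu,
      (hηx.pdx hT hI hJ).eq t ht x hx u hu, ((hη.pdu hT hI hJ).pdx hT hI hJ).eq t ht x hx u hu,
      deriv_const', zero_mul, zero_add] at h
    exact h
  refine ⟨τ, ξ, a, b, ⟨fun t ht x hx u hu => ?_, hτsm, hξ.smooth_b, hη.smooth_a, hη.smooth_b,
    fun t ht x hx u hu => (hdet ht hx hu).1, fun t ht x hx u hu => (hdet ht hx hu).2.2.1.trans ?_,
    fun t ht x hx u hu => (hdet ht hx hu).2.2.2⟩⟩
  · have hτeq := hτ.eq t ht x hx u hu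
    have hξeq := hξ.eq t ht x hx u hu
    rw [zero_mul, zero_add] at hτeq hξeq
    exact Prod.ext hτeq (Prod.ext hξeq (hη.eq t ht x hx u hu))
  · ring

end SymmetryCoefficients

/-! ### Affine flows and diffusivities homogeneous under them -/

/-- The flow at time `s` of the vector field `(μ u + ν) ∂_u` on the line. -/
noncomputable def affineFlow (μ ν s u : ℝ) : ℝ := u + expInt μ s * (μ * u + ν)

/-- The half-line (or the whole line, if `μ = 0`) bounded by the zero of `μ u + ν` and containing
`u₀`. -/
def affineHalfLine (μ ν u₀ : ℝ) : Set ℝ := {u | 0 < (μ * u + ν) * (μ * u₀ + ν)}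

section AffineFlow

variable {μ ν u₀ : ℝ}

theorem affineFlow_zero (u : ℝ) : affineFlow μ ν 0 u = u := by
  rw [affineFlow, expInt_zero, zero_mul, add_zero]

theorem mul_affineFlow_add (s u : ℝ) :
    μ * affineFlow μ ν s u + ν = Real.exp (μ * s) * (μ * u + ν) := by
  rw [affineFlow, ← one_add_mul_expInt]
  ring

theorem isOpenInterval_affineHalfLine (h₀ : μ * u₀ + ν ≠ 0) :
    IsOpenInterval (affineHalfLine μ ν u₀) := by
  refine ⟨isOpen_lt continuous_const (by fun_prop), ⟨fun x hx y hy z hz => ?_⟩, u₀,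
    mul_self_pos.2 h₀⟩
  simp only [affineHalfLine, Set.mem_ofPred_eq] at hx hy ⊢
  rcases le_total 0 (μ * (μ * u₀ + ν)) with h | h
  · nlinarith [mul_le_mul_of_nonneg_right hz.1 h]
  · nlinarith [mul_le_mul_of_nonpos_right hz.2 h]

theorem affine_ne_zero_of_mem_affineHalfLine {u : ℝ} (hu : u ∈ affineHalfLine μ ν u₀) :
    μ * u + ν ≠ 0 :=
  left_ne_zero_of_mul (ne_of_gt hu)

theorem subset_affineHalfLine {J : Set ℝ} (hJ : IsPreconnected J) (hu₀ : u₀ ∈ J)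
    (hne : ∀ u ∈ J, μ * u + ν ≠ 0) : J ⊆ affineHalfLine μ ν u₀ :=
  fun _ hu => mul_pos_of_continuousOn_of_ne_zero hJ (by fun_prop) hne hu hu₀

theorem affineFlow_mem_affineHalfLine {u : ℝ} (hu : u ∈ affineHalfLine μ ν u₀) (s : ℝ) :
    affineFlow μ ν s u ∈ affineHalfLine μ ν u₀ := by
  simp only [affineHalfLine, Set.mem_ofPred_eq] at hu ⊢
  rw [mul_affineFlow_add, mul_assoc]
  exact mul_pos (Real.exp_pos _) hu

theorem exists_hasDerivAt_div_affine (h₀ : μ * u₀ + ν ≠ 0) {c : ℝ} (hc : c ≠ 0) :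
    ∃ D : ℝ → ℝ, ContDiffOn ℝ ∞ D (affineHalfLine μ ν u₀) ∧ D u₀ = c ∧
      ∀ u ∈ affineHalfLine μ ν u₀, D u ≠ 0 ∧ HasDerivAt D (D u / (μ * u + ν)) u := by
  rcases eq_or_ne μ 0 with rfl | hμ
  · refine ⟨fun u => c * Real.exp ((u - u₀) / ν), by fun_prop, by simp,
      fun u _ => ⟨mul_ne_zero hc (Real.exp_ne_zero _), ?_⟩⟩
    refine (((((hasDerivAt_id' u).sub_const u₀).div_const ν).exp).const_mul c).congr_deriv ?_
    ring
  · have hne {u : ℝ} (hu : u ∈ affineHalfLine μ ν u₀) : (μ * u + ν) / (μ * u₀ + ν) ≠ 0 :=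
      div_ne_zero (affine_ne_zero_of_mem_affineHalfLine hu) h₀
    refine ⟨fun u => c * Real.exp (Real.log ((μ * u + ν) / (μ * u₀ + ν)) / μ), ?_,
      by simp [div_self h₀], fun u hu => ⟨mul_ne_zero hc (Real.exp_ne_zero _), ?_⟩⟩
    · exact contDiffOn_const.mul
        ((ContDiffOn.log (by fun_prop) fun u hu => hne hu).div_const _).exp
    · have haffine := ((((hasDerivAt_id' u).const_mul μ).add_const ν).div_const (μ * u₀ + ν))
      have hu' := affine_ne_zero_of_mem_affineHalfLine hu
      refine (((haffine.log (hne hu)).div_const μ).exp.const_mul c).congr_deriv ?_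
      field_simp

theorem apply_affineFlow_eq {D : ℝ → ℝ}
    (hD : ∀ u ∈ affineHalfLine μ ν u₀, HasDerivAt D (D u / (μ * u + ν)) u) {u : ℝ}
    (hu : u ∈ affineHalfLine μ ν u₀) (s : ℝ) :
    D (affineFlow μ ν s u) = Real.exp s * D u := by
  have huniv : IsOpenInterval Set.univ := ⟨isOpen_univ, Set.ordConnected_univ, Set.univ_nonempty⟩
  have hderiv (r : ℝ) : HasDerivAt (fun s => D (affineFlow μ ν s u))
      (1 * D (affineFlow μ ν r u)) r := by
    have hflow := ((hasDerivAt_expInt μ r).mul_const (μ * u + ν)).const_add u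
    refine ((hD _ (affineFlow_mem_affineHalfLine hu r)).comp r hflow).congr_deriv ?_
    rw [mul_affineFlow_add, one_mul, div_mul_cancel₀ _
      (mul_ne_zero (Real.exp_ne_zero _) (affine_ne_zero_of_mem_affineHalfLine hu))]
  have h := huniv.eq_mul_exp (fun r _ => hderiv r) (Set.mem_univ 0) (Set.mem_univ s)
  simp only [affineFlow_zero, sub_zero, one_mul] at h
  rw [h, mul_comm]

end AffineFlow

theorem IsOpenInterval.eq_of_hasDerivAt_mul {S : Set ℝ} (hS : IsOpenInterval S) {g h r : ℝ → ℝ}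
    (hg : ∀ x ∈ S, HasDerivAt g (r x * g x) x) (hh : ∀ x ∈ S, HasDerivAt h (r x * h x) x)
    (hne : ∀ x ∈ S, h x ≠ 0) {c x : ℝ} (hc : c ∈ S) (hx : x ∈ S) (hgh : g c = h c) :
    g x = h x := by
  have hquot : g x / h x = g c / h c :=
    hS.eq_of_hasDerivAt_zero (g := fun x => g x / h x)
      (fun z hz => ((hg z hz).div (hh z hz) (hne z hz)).congr_deriv (by ring)) hx hc
  rw [hgh, div_self (hne c hc)] at hquot
  exact (div_eq_one_iff_eq (hne x hx)).1 hquot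

theorem exists_extension_of_affine_mul_deriv_eq {J : Set ℝ} (hJ : IsOpenInterval J) {D : ℝ → ℝ}
    {μ ν : ℝ} (hDs : ContDiffOn ℝ ∞ D J) (hD₀ : ∀ u ∈ J, D u ≠ 0)
    (hD : ∀ u ∈ J, (μ * u + ν) * deriv D u = D u) :
    ∃ (J₁ : Set ℝ) (D₁ : ℝ → ℝ), IsAdmissible Set.univ J₁ (fun _ => 1) D₁ (fun _ => 0) ∧
      ∀ u ∈ J, ∀ s, affineFlow μ ν s u ∈ J₁ ∧ D₁ (affineFlow μ ν s u) = Real.exp s * D u := by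
  have hne (u : ℝ) (hu : u ∈ J) : μ * u + ν ≠ 0 :=
    left_ne_zero_of_mul ((hD u hu).symm ▸ hD₀ u hu)
  obtain ⟨u₀, hu₀⟩ := hJ.2.2
  have hsub := subset_affineHalfLine hJ.isPreconnected hu₀ hne
  obtain ⟨D₁, hD₁s, hD₁u₀, hD₁⟩ := exists_hasDerivAt_div_affine (hne u₀ hu₀) (hD₀ u₀ hu₀)
  have hext (u : ℝ) (hu : u ∈ J) : D₁ u = D u := by
    refine hJ.eq_of_hasDerivAt_mul (r := fun u => (μ * u + ν)⁻¹) (fun z hz => ?_) (fun z hz => ?_)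
      hD₀ hu₀ hu hD₁u₀
    · exact (hD₁ z (hsub hz)).2.congr_deriv (div_eq_inv_mul _ _)
    · exact (hasDerivAt_deriv_of_isOpen hJ.1 hDs hz).congr_deriv
        ((eq_inv_mul_iff_mul_eq₀ (hne z hz)).2 (hD z hz))
  have hadm : IsAdmissible Set.univ (affineHalfLine μ ν u₀) (fun _ => 1) D₁ fun _ => 0 :=
    { interval_x := ⟨isOpen_univ, Set.ordConnected_univ, Set.univ_nonempty⟩
      interval_u := isOpenInterval_affineHalfLine (hne u₀ hu₀)
      smooth_f := contDiffOn_const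
      smooth_D := hD₁s
      smooth_K := contDiffOn_const
      f_ne_zero := fun _ _ => one_ne_zero
      D_ne_zero := fun u hu => (hD₁ u hu).1
      nonlinear := ⟨u₀, hsub hu₀, .inl <| by
        rw [(hD₁ u₀ (hsub hu₀)).2.deriv, hD₁u₀]
        exact div_ne_zero (hD₀ u₀ hu₀) (hne u₀ hu₀)⟩ }
  exact ⟨affineHalfLine μ ν u₀, D₁, hadm, fun u hu s =>
    ⟨affineFlow_mem_affineHalfLine (hsub hu) s, by
      rw [apply_affineFlow_eq (fun v hv => (hD₁ v hv).2) (hsub hu), hext u hu]⟩⟩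

/-! ### Point transformations removing `f` and an affine convection term -/

theorem injOn_of_hasDerivAt_ne_zero {S : Set ℝ} (hS : S.OrdConnected) {g g' : ℝ → ℝ}
    (hg : ∀ x ∈ S, HasDerivAt g (g' x) x) (hne : ∀ x ∈ S, g' x ≠ 0) : Set.InjOn g S := by
  have hlt {x y : ℝ} (hx : x ∈ S) (hy : y ∈ S) (hxy : x < y) : g x ≠ g y := fun heq => by
    have hIcc := hS.out hx hy
    obtain ⟨c, hc, hc0⟩ := exists_hasDerivAt_eq_zero hxy
      (fun z hz => (hg z (hIcc hz)).continuousAt.continuousWithinAt) heq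
      fun z hz => hg z (hIcc (Set.Ioo_subset_Icc_self hz))
    exact hne c (hIcc (Set.Ioo_subset_Icc_self hc)) hc0
  intro x hx y hy heq
  rcases lt_trichotomy x y with h | h | h
  · exact (hlt hx hy h heq).elim
  · exact h
  · exact (hlt hy hx h heq.symm).elim

theorem hasDerivAt_affineFlow {μ ν : ℝ} {s g : ℝ → ℝ} {s' g' x : ℝ} (hs : HasDerivAt s s' x)
    (hg : HasDerivAt g g' x) :
    HasDerivAt (fun y => affineFlow μ ν (s y) (g y))
      (Real.exp (μ * s x) * (g' + s' * (μ * g x + ν))) x := by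
  refine (hg.add (((hasDerivAt_expInt μ (s x)).comp x hs).mul
    ((hg.const_mul μ).add_const ν))).congr_deriv ?_
  rw [← one_add_mul_expInt, Function.comp_apply]
  ring

/-- The conditions under which the point transformation
`(t, x, u) ↦ (θ(t), Y(t, x), affineFlow μ ν (s(t, x)) u)` removes `f` and the convection term
`(k₁ D(u) + k₀) u_x`, for diffusivities satisfying `(μ u + ν) D' = D`. The function `E` is the
factor by which the flux `D(u) u_x` is multiplied. -/
structure ReductionData (T I : Set ℝ) (f : ℝ → ℝ) (μ k₀ k₁ : ℝ) (θ : ℝ → ℝ)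
    (Y s E : ℝ → ℝ → ℝ) : Prop where
  smooth_θ : ContDiffOn ℝ ∞ θ T
  smooth_Y : SmoothOn₂ T I Y
  smooth_s : SmoothOn₂ T I s
  E_mul : ∀ t ∈ T, ∀ x ∈ I, E t x * deriv (Y t) x = Real.exp ((μ + 1) * s t x)
  deriv_E : ∀ t ∈ T, ∀ x ∈ I,
    HasDerivAt (E t) (k₁ * E t x - (μ + 1) * deriv (s t) x * E t x) x
  E_mul_deriv_s : ∀ t ∈ T, ∃ c, ∀ x ∈ I, E t x * deriv (s t) x = c
  eq_f : ∀ t ∈ T, ∀ x ∈ I,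
    f x * E t x * deriv θ t = deriv (Y t) x * Real.exp (μ * s t x)
  eq_Y : ∀ t ∈ T, ∀ x ∈ I, f x * deriv (fun r => Y r x) t = k₀ * deriv (Y t) x
  eq_s : ∀ t ∈ T, ∀ x ∈ I, f x * deriv (fun r => s r x) t = k₀ * deriv (s t) x

/-- The function `w`, over the open set `W`, is the image of the function `v`, over the open
set `U`, under `(t, x, u) ↦ (θ(t), Y(t, x), affineFlow μ ν (s(t, x)) u)`. -/
structure IsImageUnder (T I J : Set ℝ) (μ ν : ℝ) (θ : ℝ → ℝ) (Y s : ℝ → ℝ → ℝ)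
    (U : Set (ℝ × ℝ)) (v : ℝ → ℝ → ℝ) (W : Set (ℝ × ℝ)) (w : ℝ → ℝ → ℝ) : Prop where
  isOpen_U : IsOpen U
  isOpen_W : IsOpen W
  smooth_v : ContDiffOn ℝ ∞ (fun z : ℝ × ℝ => v z.1 z.2) U
  smooth_w : ContDiffOn ℝ ∞ (fun z : ℝ × ℝ => w z.1 z.2) W
  mem_box : ∀ t x, (t, x) ∈ U → t ∈ T ∧ x ∈ I ∧ v t x ∈ J
  mem_W : ∀ t x, (t, x) ∈ U → (θ t, Y t x) ∈ W
  apply_eq : ∀ t x, (t, x) ∈ U → w (θ t) (Y t x) = affineFlow μ ν (s t x) (v t x)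

section Reduction

variable {T I J : Set ℝ} {f D K : ℝ → ℝ} {μ ν k₀ k₁ : ℝ} {θ : ℝ → ℝ} {Y s E : ℝ → ℝ → ℝ}

namespace ReductionData

variable (hred : ReductionData T I f μ k₀ k₁ θ Y s E)

include hred

theorem deriv_Y_ne_zero {t x : ℝ} (ht : t ∈ T) (hx : x ∈ I) : deriv (Y t) x ≠ 0 :=
  right_ne_zero_of_mul ((hred.E_mul t ht x hx).symm ▸ Real.exp_ne_zero _)

theorem deriv_θ_ne_zero (hI : I.Nonempty) {t : ℝ} (ht : t ∈ T) : deriv θ t ≠ 0 := by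
  obtain ⟨x, hx⟩ := hI
  exact right_ne_zero_of_mul ((hred.eq_f t ht x hx).symm ▸
    mul_ne_zero (hred.deriv_Y_ne_zero ht hx) (Real.exp_ne_zero _))

end ReductionData

namespace IsImageUnder

variable {U W : Set (ℝ × ℝ)} {v w : ℝ → ℝ → ℝ} {t x : ℝ}
  (him : IsImageUnder T I J μ ν θ Y s U v W w) (hred : ReductionData T I f μ k₀ k₁ θ Y s E)

include him hred

theorem deriv_x (hI : IsOpen I) (h : (t, x) ∈ U) :
    deriv (w (θ t)) (Y t x) * deriv (Y t) x
      = Real.exp (μ * s t x) * (deriv (v t) x + deriv (s t) x * (μ * v t x + ν)) := by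
  obtain ⟨ht, hx, -⟩ := him.mem_box t x h
  have hleft : HasDerivAt (fun y => w (θ t) (Y t y))
      (deriv (w (θ t)) (Y t x) * deriv (Y t) x) x :=
    HasDerivAt.comp x (hasDerivAt_slice_snd him.isOpen_W him.smooth_w (him.mem_W t x h))
      (hred.smooth_Y.hasDerivAt_x hI ht hx)
  have hright := hasDerivAt_affineFlow (μ := μ) (ν := ν) (hred.smooth_s.hasDerivAt_x hI ht hx)
    (hasDerivAt_slice_snd him.isOpen_U him.smooth_v h)
  exact hleft.unique <| hright.congr_of_eventuallyEq <| Filter.eventually_of_mem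
    ((isOpen_slice_snd him.isOpen_U t).mem_nhds h) fun y hy => him.apply_eq t y hy

theorem deriv_t (hT : IsOpen T) (h : (t, x) ∈ U) :
    deriv (fun r => w r (Y t x)) (θ t) * deriv θ t
        + deriv (w (θ t)) (Y t x) * deriv (fun r => Y r x) t
      = Real.exp (μ * s t x) * (deriv (fun r => v r x) t
        + deriv (fun r => s r x) t * (μ * v t x + ν)) := by
  obtain ⟨ht, hx, -⟩ := him.mem_box t x h
  have hw := ((him.smooth_w.contDiffAt
    (him.isOpen_W.mem_nhds (him.mem_W t x h))).differentiableAt (by simp)).hasFDerivAt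
  have hleft := hw.comp_hasDerivAt (f := fun r => (θ r, Y r x)) t
    ((hasDerivAt_deriv_of_isOpen hT hred.smooth_θ ht).prodMk
      (hred.smooth_Y.hasDerivAt_t hT ht hx))
  rw [fderiv_eq_deriv_slices him.isOpen_W him.smooth_w (him.mem_W t x h)] at hleft
  have hright := hasDerivAt_affineFlow (μ := μ) (ν := ν) (hred.smooth_s.hasDerivAt_t hT ht hx)
    (hasDerivAt_slice_fst him.isOpen_U him.smooth_v h)
  have hU : {r | (r, x) ∈ U} ∈ nhds t :=
    (him.isOpen_U.preimage (by fun_prop : Continuous fun r : ℝ => (r, x))).mem_nhds h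
  exact hleft.unique <| hright.congr_of_eventuallyEq <|
    Filter.eventually_of_mem hU fun r hr => him.apply_eq r x hr

theorem flux_eq (hI : IsOpen I) {D₁ : ℝ → ℝ}
    (hscale : ∀ u ∈ J, ∀ s, D₁ (affineFlow μ ν s u) = Real.exp s * D u) (h : (t, x) ∈ U) :
    D₁ (w (θ t) (Y t x)) * deriv (w (θ t)) (Y t x)
      = E t x * (D (v t x) * deriv (v t) x)
        + E t x * deriv (s t) x * ((μ * v t x + ν) * D (v t x)) := by
  obtain ⟨ht, hx, hu⟩ := him.mem_box t x h
  refine mul_right_cancel₀ (hred.deriv_Y_ne_zero ht hx) ?_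
  have hE := hred.E_mul t ht x hx
  rw [add_mul, one_mul, Real.exp_add, mul_comm] at hE
  rw [mul_assoc, him.deriv_x hred hI h, him.apply_eq t x h, hscale _ hu]
  linear_combination (-(D (v t x)) * deriv (v t) x
    - deriv (s t) x * (μ * v t x + ν) * D (v t x)) * hE

theorem deriv_flux_eq (hadm : IsAdmissible I J f D K)
    (hD : ∀ u ∈ J, (μ * u + ν) * deriv D u = D u) {J₁ : Set ℝ} (hJ₁ : IsOpen J₁) {D₁ : ℝ → ℝ}
    (hD₁ : ContDiffOn ℝ ∞ D₁ J₁) (hscale : ∀ u ∈ J, ∀ s, affineFlow μ ν s u ∈ J₁ ∧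
      D₁ (affineFlow μ ν s u) = Real.exp s * D u) (h : (t, x) ∈ U) :
    deriv (fun z => D₁ (w (θ t) z) * deriv (w (θ t)) z) (Y t x) * deriv (Y t) x
      = E t x * (deriv (fun y => D (v t y) * deriv (v t) y) x
        + k₁ * (D (v t x) * deriv (v t) x)) := by
  have hI := hadm.interval_x.1
  obtain ⟨ht, hx, hu⟩ := him.mem_box t x h
  obtain ⟨c, hc⟩ := hred.E_mul_deriv_s t ht
  have hv := hasDerivAt_slice_snd him.isOpen_U him.smooth_v h
  have hDv : HasDerivAt (fun y => D (v t y)) (deriv D (v t x) * deriv (v t) x) x :=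
    HasDerivAt.comp (h₂ := D) x (hadm.hasDerivAt_D hu) hv
  have hflux := (hDv.mul
    (hasDerivAt_deriv_slice_snd him.isOpen_U him.smooth_v h)).differentiableAt.hasDerivAt
  have hWmem := him.mem_W t x h
  have hJ₁mem : w (θ t) (Y t x) ∈ J₁ := him.apply_eq t x h ▸ (hscale _ hu _).1
  have hflux₁ := ((HasDerivAt.comp (h₂ := D₁) (Y t x) (hasDerivAt_deriv_of_isOpen hJ₁ hD₁ hJ₁mem)
    (hasDerivAt_slice_snd him.isOpen_W him.smooth_w hWmem)).mul
    (hasDerivAt_deriv_slice_snd him.isOpen_W him.smooth_w hWmem)).differentiableAt.hasDerivAt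
  have hleft := hflux₁.comp x (hred.smooth_Y.hasDerivAt_x hI ht hx)
  have hright := ((hred.deriv_E t ht x hx).mul hflux).add
    ((((hv.const_mul μ).add_const ν).mul hDv).const_mul c)
  have heq := hleft.unique <| hright.congr_of_eventuallyEq <| Filter.eventually_of_mem
    ((isOpen_slice_snd him.isOpen_U t).mem_nhds h) fun y hy => by
      rw [← hc y (him.mem_box t y hy).2.1]
      exact him.flux_eq hred hI (fun u hu s => (hscale u hu s).2) hy
  refine heq.trans ?_
  simp only [Pi.mul_apply]
  linear_combination (c * deriv (v t) x) * hD _ hu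
    - (μ + 1) * D (v t x) * deriv (v t) x * hc x hx

theorem satisfiesAt_iff (hT : IsOpen T) (hadm : IsAdmissible I J f D K)
    (hD : ∀ u ∈ J, (μ * u + ν) * deriv D u = D u) (hK : ∀ u ∈ J, K u = k₁ * D u + k₀)
    {J₁ : Set ℝ} (hJ₁ : IsOpen J₁) {D₁ : ℝ → ℝ} (hD₁ : ContDiffOn ℝ ∞ D₁ J₁)
    (hscale : ∀ u ∈ J, ∀ s, affineFlow μ ν s u ∈ J₁ ∧
      D₁ (affineFlow μ ν s u) = Real.exp s * D u) (h : (t, x) ∈ U) :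
    SatisfiesAt f D K v t x ↔
      SatisfiesAt (fun _ => 1) D₁ (fun _ => 0) w (θ t) (Y t x) := by
  obtain ⟨ht, hx, hu⟩ := him.mem_box t x h
  rw [SatisfiesAt, SatisfiesAt, hK _ hu, zero_mul, add_zero, one_mul, ← sub_eq_zero,
    ← sub_eq_zero (a := deriv _ (θ t))]
  have hresidual : f x * deriv θ t * (deriv (fun r => w r (Y t x)) (θ t)
      - deriv (fun z => D₁ (w (θ t) z) * deriv (w (θ t)) z) (Y t x))
      = Real.exp (μ * s t x) * (f x * deriv (fun r => v r x) t
        - (deriv (fun y => D (v t y) * deriv (v t) y) x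
          + (k₁ * D (v t x) + k₀) * deriv (v t) x)) := by
    refine mul_right_cancel₀ (hred.deriv_Y_ne_zero ht hx) ?_
    linear_combination deriv (Y t) x * f x * him.deriv_t hred hT h
      - f x * deriv θ t * him.deriv_flux_eq hred hadm hD hJ₁ hD₁ hscale h
      - (deriv (fun y => D (v t y) * deriv (v t) y) x
        + k₁ * (D (v t x) * deriv (v t) x)) * hred.eq_f t ht x hx
      - deriv (Y t) x * deriv (w (θ t)) (Y t x) * hred.eq_Y t ht x hx
      + deriv (Y t) x * Real.exp (μ * s t x) * (μ * v t x + ν) * hred.eq_s t ht x hx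
      - k₀ * deriv (Y t) x * him.deriv_x hred hadm.interval_x.1 h
  have hne := mul_ne_zero (hadm.f_ne_zero x hx) (hred.deriv_θ_ne_zero hadm.interval_x.2.2 ht)
  rw [← mul_eq_zero_iff_left (Real.exp_ne_zero (μ * s t x)), ← hresidual,
    mul_eq_zero_iff_left hne]

end IsImageUnder

theorem ReductionData.mapsEquation (hred : ReductionData T I f μ k₀ k₁ θ Y s E) (hT : IsOpen T)
    (hadm : IsAdmissible I J f D K) (hD : ∀ u ∈ J, (μ * u + ν) * deriv D u = D u)
    (hK : ∀ u ∈ J, K u = k₁ * D u + k₀) {J₁ : Set ℝ} (hJ₁ : IsOpen J₁) {D₁ : ℝ → ℝ}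
    (hD₁ : ContDiffOn ℝ ∞ D₁ J₁) (hscale : ∀ u ∈ J, ∀ s, affineFlow μ ν s u ∈ J₁ ∧
      D₁ (affineFlow μ ν s u) = Real.exp s * D u) :
    MapsEquation (box T I J) (fun p => (θ p.1, Y p.1 p.2.1, affineFlow μ ν (s p.1 p.2.1) p.2.2))
      f D K (fun _ => 1) D₁ (fun _ => 0) := by
  intro U W v w hU hW hv hw hdom hmap t x h
  have him : IsImageUnder T I J μ ν θ Y s U v W w := ⟨hU, hW, hv, hw, hdom,
    fun t x h => (hmap t x h).1, fun t x h => (hmap t x h).2.symm⟩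
  exact him.satisfiesAt_iff hred hT hadm hD hK hJ₁ hD₁ hscale h

end Reduction

theorem injOn_triangular {T I J : Set ℝ} {θ : ℝ → ℝ} {Y : ℝ → ℝ → ℝ} {G : PointSpace → ℝ}
    (hθ : Set.InjOn θ T) (hY : ∀ t ∈ T, Set.InjOn (Y t) I)
    (hG : ∀ t ∈ T, ∀ x ∈ I, Set.InjOn (fun u => G (t, x, u)) J) :
    Set.InjOn (fun p : PointSpace => ((θ p.1, Y p.1 p.2.1, G p) : PointSpace)) (box T I J) := by
  rintro ⟨t, x, u⟩ ⟨ht, hx, hu⟩ ⟨t', x', u'⟩ ⟨ht', hx', hu'⟩ heq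
  simp only [Prod.mk.injEq] at heq
  obtain ⟨hθeq, hYeq, hGeq⟩ := heq
  obtain rfl := hθ ht ht' hθeq
  obtain rfl := hY t ht hx hx' hYeq
  obtain rfl := hG t ht x hx hu hu' hGeq
  rfl

theorem eq_zero_of_fderiv_triangular_eq_zero {F₁ F₂ F₃ : PointSpace → ℝ} {p v : PointSpace}
    (h₁ : DifferentiableAt ℝ F₁ p) (h₂ : DifferentiableAt ℝ F₂ p) (h₃ : DifferentiableAt ℝ F₃ p)
    (h₁x : pdx F₁ p = 0) (h₁u : pdu F₁ p = 0) (h₂u : pdu F₂ p = 0) (h₁t : pdt F₁ p ≠ 0)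
    (h₂x : pdx F₂ p ≠ 0) (h₃u : pdu F₃ p ≠ 0)
    (hv : fderiv ℝ (fun q => (F₁ q, F₂ q, F₃ q)) p v = 0) : v = 0 := by
  obtain ⟨a, b, c⟩ := v
  rw [(h₁.hasFDerivAt.prodMk (h₂.hasFDerivAt.prodMk h₃.hasFDerivAt)).fderiv] at hv
  simp only [ContinuousLinearMap.prod_apply, Prod.mk_eq_zero, fderiv_eq_partials, h₁x, h₁u, h₂u,
    mul_zero, add_zero] at hv
  obtain ⟨hv₁, hv₂, hv₃⟩ := hv
  obtain rfl := (mul_eq_zero_iff_right h₁t).1 hv₁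
  rw [zero_mul, zero_add] at hv₂ hv₃
  obtain rfl := (mul_eq_zero_iff_right h₂x).1 hv₂
  rw [zero_mul, zero_add] at hv₃
  obtain rfl := (mul_eq_zero_iff_right h₃u).1 hv₃
  rfl

theorem exists_triangular_isPointTransformation {T I J : Set ℝ} (hT : IsOpenInterval T)
    (hI : IsOpenInterval I) (hJ : IsOpenInterval J) {θ : ℝ → ℝ} {Y : ℝ → ℝ → ℝ}
    {G : PointSpace → ℝ} (hθ : ContDiffOn ℝ ∞ θ T) (hY : SmoothOn₂ T I Y)
    (hG : ContDiffOn ℝ ∞ G (box T I J)) (hθ' : ∀ t ∈ T, deriv θ t ≠ 0)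
    (hY' : ∀ t ∈ T, ∀ x ∈ I, deriv (Y t) x ≠ 0) (hG' : ∀ p ∈ box T I J, pdu G p ≠ 0) :
    ∃ e : OpenPartialHomeomorph PointSpace PointSpace, IsPointTransformation (box T I J) e ∧
      (e : PointSpace → PointSpace) = fun p => (θ p.1, Y p.1 p.2.1, G p) := by
  have hΩ := isOpen_box hT.1 hI.1 hJ.1
  have hθ₃ : ContDiffOn ℝ ∞ (fun p : PointSpace => θ p.1) (box T I J) :=
    hθ.comp (f := fun p : PointSpace => p.1) (by fun_prop) fun p hp => hp.1
  have hY₃ := hY.contDiffOn_box J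
  have hdiff {F : PointSpace → ℝ} (hF : ContDiffOn ℝ ∞ F (box T I J)) {p : PointSpace}
      (hp : p ∈ box T I J) : DifferentiableAt ℝ F p :=
    (hF.contDiffAt (hΩ.mem_nhds hp)).differentiableAt (by simp)
  refine exists_isPointTransformation hΩ (hθ₃.prodMk (hY₃.prodMk hG)) (injOn_triangular ?_ ?_ ?_) ?_
  · exact injOn_of_hasDerivAt_ne_zero hT.isPreconnected.ordConnected
      (fun t ht => hasDerivAt_deriv_of_isOpen hT.1 hθ ht) hθ'
  · exact fun t ht => injOn_of_hasDerivAt_ne_zero hI.isPreconnected.ordConnected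
      (fun x hx => hY.hasDerivAt_x hI.1 ht hx) (hY' t ht)
  · exact fun t ht x hx => injOn_of_hasDerivAt_ne_zero hJ.isPreconnected.ordConnected
      (fun u hu => hasDerivAt_slice_u (hdiff hG ⟨ht, hx, hu⟩)) fun u hu => hG' _ ⟨ht, hx, hu⟩
  · rintro ⟨t, x, u⟩ hp v
    have hθp := hdiff hθ₃ hp
    have hYp := hdiff hY₃ hp
    exact eq_zero_of_fderiv_triangular_eq_zero hθp hYp (hdiff hG hp)
      ((hasDerivAt_slice_x hθp).unique (hasDerivAt_const x (θ t)))
      ((hasDerivAt_slice_u hθp).unique (hasDerivAt_const u (θ t)))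
      ((hasDerivAt_slice_u hYp).unique (hasDerivAt_const u (Y t x)))
      ((hasDerivAt_slice_t hθp).deriv.symm.trans_ne (hθ' t hp.1))
      ((hasDerivAt_slice_x hYp).deriv.symm.trans_ne (hY' t hp.1 x hp.2.1)) (hG' _ hp)

/-- The equation `f(x) u_t = (D(u) u_x)_x + K(u) u_x` over `T × I × J` can be reduced by a point
transformation to an equation of the same class with `f = 1`. -/
def IsReducible (T I J : Set ℝ) (f D K : ℝ → ℝ) : Prop :=
  ∃ (I₁ J₁ : Set ℝ) (D₁ K₁ : ℝ → ℝ) (Φ : OpenPartialHomeomorph PointSpace PointSpace),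
    IsAdmissible I₁ J₁ (fun _ => 1) D₁ K₁ ∧
    IsPointTransformation (box T I J) Φ ∧
    (∀ p ∈ box T I J, (Φ p).2.1 ∈ I₁ ∧ (Φ p).2.2 ∈ J₁) ∧
    MapsEquation (box T I J) Φ f D K (fun _ => 1) D₁ K₁

theorem ReductionData.isReducible {T I J : Set ℝ} {f D K : ℝ → ℝ} {μ ν k₀ k₁ : ℝ} {θ : ℝ → ℝ}
    {Y s E : ℝ → ℝ → ℝ} (hred : ReductionData T I f μ k₀ k₁ θ Y s E) (hT : IsOpenInterval T)
    (hadm : IsAdmissible I J f D K) (hD : ∀ u ∈ J, (μ * u + ν) * deriv D u = D u)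
    (hK : ∀ u ∈ J, K u = k₁ * D u + k₀) : IsReducible T I J f D K := by
  have hI := hadm.interval_x
  have hJ := hadm.interval_u
  obtain ⟨J₁, D₁, hadm₁, hscale⟩ :=
    exists_extension_of_affine_mul_deriv_eq hJ hadm.smooth_D hadm.D_ne_zero hD
  have hG : ContDiffOn ℝ ∞ (fun p : PointSpace => affineFlow μ ν (s p.1 p.2.1) p.2.2)
      (box T I J) :=
    ContDiffOn.add (by fun_prop)
      (((contDiff_expInt μ).comp_contDiffOn (hred.smooth_s.contDiffOn_box J)).mul (by fun_prop))
  have hGu : ∀ p ∈ box T I J,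
      pdu (fun p : PointSpace => affineFlow μ ν (s p.1 p.2.1) p.2.2) p ≠ 0 := by
    rintro ⟨t, x, u⟩ hp
    have hdiff := (hG.contDiffAt
      ((isOpen_box hT.1 hI.1 hJ.1).mem_nhds hp)).differentiableAt (by simp)
    rw [(hasDerivAt_slice_u hdiff).unique
      (hasDerivAt_affineFlow (hasDerivAt_const u (s t x)) (hasDerivAt_id' u)), zero_mul, add_zero,
      mul_one]
    exact Real.exp_ne_zero _
  obtain ⟨Φ, hΦ, hΦeq⟩ := exists_triangular_isPointTransformation hT hI hJ hred.smooth_θ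
    hred.smooth_Y hG (fun t ht => hred.deriv_θ_ne_zero hI.2.2 ht)
    (fun t ht x hx => hred.deriv_Y_ne_zero ht hx) hGu
  refine ⟨Set.univ, J₁, D₁, fun _ => 0, Φ, hadm₁, hΦ, fun p hp => ?_, ?_⟩
  · rw [hΦeq]
    exact ⟨Set.mem_univ _, (hscale _ hp.2.2 _).1⟩
  · rw [hΦeq]
    exact hred.mapsEquation hT.1 hadm hD hK hadm₁.interval_u.1 hadm₁.smooth_D hscale

theorem mapsEquation_div_const {T I J : Set ℝ} {f D K : ℝ → ℝ} {c : ℝ} (hc : c ≠ 0)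
    (hf : ∀ x ∈ I, f x = c) :
    MapsEquation (box T I J) (fun p => (p.1 / c, p.2.1, p.2.2)) f D K (fun _ => 1) D K := by
  intro U W v w hU hW _ hw hdom hmap t x h
  have hwv {r y : ℝ} (h : (r, y) ∈ U) : w (r / c) y = v r y := (hmap r y h).2.symm
  have hslice : w (t / c) =ᶠ[nhds x] v t :=
    Filter.eventually_of_mem ((isOpen_slice_snd hU t).mem_nhds h) fun y hy => hwv hy
  have hflux : deriv (fun y => D (w (t / c) y) * deriv (w (t / c)) y) x
      = deriv (fun y => D (v t y) * deriv (v t) y) x := by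
    refine Filter.EventuallyEq.deriv_eq ?_
    filter_upwards [hslice, hslice.deriv] with y hy hy'
    rw [hy, hy']
  have htime : deriv (fun r => v r x) t = deriv (fun r => w r x) (t / c) * (1 / c) := by
    have hUt : {r | (r, x) ∈ U} ∈ nhds t :=
      (hU.preimage (by fun_prop : Continuous fun r : ℝ => (r, x))).mem_nhds h
    have hw' : HasDerivAt (fun r => w (r / c) x) (deriv (fun r => w r x) (t / c) * (1 / c)) t :=
      HasDerivAt.comp (h₂ := fun r => w r x) t (hasDerivAt_slice_fst hW hw (hmap t x h).1)
        ((hasDerivAt_id' t).div_const c)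
    exact (hw'.congr_of_eventuallyEq (Filter.eventually_of_mem hUt fun r hr => (hwv hr).symm)).deriv
  have hscale : c * (deriv (fun r => w r x) (t / c) * (1 / c))
      = 1 * deriv (fun r => w r x) (t / c) := by
    field_simp
  rw [SatisfiesAt, SatisfiesAt, htime, hf x (hdom t x h).2.1, hscale, hflux, hwv h,
    hslice.deriv_eq]

theorem isReducible_of_deriv_f_eq_zero {T I J : Set ℝ} {f D K : ℝ → ℝ} (hT : IsOpenInterval T)
    (hadm : IsAdmissible I J f D K) (hf : ∀ x ∈ I, deriv f x = 0) : IsReducible T I J f D K := by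
  have hI := hadm.interval_x
  have hJ := hadm.interval_u
  obtain ⟨x₀, hx₀⟩ := hI.2.2
  have hfx₀ := hadm.f_ne_zero x₀ hx₀
  have hconst : ∀ x ∈ I, f x = f x₀ := fun x hx => hI.eq_of_hasDerivAt_zero
    (fun y hy => hf y hy ▸ hadm.hasDerivAt_f hy) hx hx₀
  obtain ⟨Φ, hΦ, hΦeq⟩ := exists_triangular_isPointTransformation hT hI hJ
    (θ := fun t => t / f x₀) (Y := fun _ x => x) (G := fun p => p.2.2) (by fun_prop)
    (by unfold SmoothOn₂; fun_prop) (by fun_prop)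
    (fun t _ => by simpa using hfx₀) (fun t _ x _ => by simp) (fun p _ => by
      rw [(hasDerivAt_slice_u (F := fun p : PointSpace => p.2.2) (by fun_prop)).unique
        (hasDerivAt_id' p.2.2)]
      exact one_ne_zero)
  refine ⟨I, J, D, K, Φ, ⟨hI, hJ, contDiffOn_const, hadm.smooth_D, hadm.smooth_K,
    fun _ _ => one_ne_zero, hadm.D_ne_zero, hadm.nonlinear⟩, hΦ, fun p hp => ?_, ?_⟩
  · rw [hΦeq]
    exact hp.2
  · rw [hΦeq]
    exact mapsEquation_div_const hfx₀ hconst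

/-! ### Two families of reductions -/

theorem smoothOn₂_of_x {T I : Set ℝ} {g : ℝ → ℝ} (hg : ContDiffOn ℝ ∞ g I) :
    SmoothOn₂ T I fun _ => g :=
  hg.comp (f := fun z : ℝ × ℝ => z.2) (by fun_prop) fun _ hz => hz.2

theorem hasDerivAt_exp_linear {s : ℝ → ℝ} {s' x : ℝ} (hs : HasDerivAt s s' x) (p q x₀ : ℝ) :
    HasDerivAt (fun x => Real.exp (p * s x + q * (x - x₀)))
      ((p * s' + q) * Real.exp (p * s x + q * (x - x₀))) x :=
  ((hs.const_mul p).add (((hasDerivAt_id' x).sub_const x₀).const_mul q)).exp.congr_deriv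
    (by simp only [Pi.add_apply]; ring)

theorem reductionData_of_stationary {T I : Set ℝ} {f s Y : ℝ → ℝ} {μ k₁ a x₀ C : ℝ} (hC : C ≠ 0)
    (hss : ContDiffOn ℝ ∞ s I) (hYs : ContDiffOn ℝ ∞ Y I)
    (hs : ∀ x ∈ I, HasDerivAt s (-a * Real.exp ((μ + 1) * s x + -k₁ * (x - x₀))) x)
    (hY : ∀ x ∈ I, HasDerivAt Y (Real.exp (2 * (μ + 1) * s x + -k₁ * (x - x₀))) x)
    (hf : ∀ x ∈ I, f x = C * Real.exp ((4 * μ + 3) * s x + -(2 * k₁) * (x - x₀))) :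
    ReductionData T I f μ 0 k₁ (fun t => t / C) (fun _ => Y) (fun _ => s)
      (fun _ x => Real.exp (-(μ + 1) * s x + k₁ * (x - x₀))) where
  smooth_θ := by fun_prop
  smooth_Y := smoothOn₂_of_x hYs
  smooth_s := smoothOn₂_of_x hss
  E_mul t _ x hx := by
    rw [(hY x hx).deriv, ← Real.exp_add]
    ring_nf
  deriv_E t _ x hx := by
    rw [(hs x hx).deriv]
    exact (hasDerivAt_exp_linear (hs x hx) _ _ _).congr_deriv (by ring)
  E_mul_deriv_s t _ := by
    refine ⟨-a, fun x hx => ?_⟩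
    rw [(hs x hx).deriv, mul_left_comm, ← Real.exp_add]
    ring_nf
    rw [Real.exp_zero, mul_one]
  eq_f t _ x hx := by
    rw [(hY x hx).deriv, hf x hx, ((hasDerivAt_id' t).div_const C).deriv, mul_assoc C,
      ← Real.exp_add, mul_right_comm, mul_one_div_cancel hC, one_mul, ← Real.exp_add]
    ring_nf
  eq_Y t _ x _ := by simp
  eq_s t _ x _ := by simp

theorem exists_hasDerivAt_exp_mul {I : Set ℝ} {m x₀ : ℝ} {g G : ℝ → ℝ} (hGs : ContDiff ℝ ∞ G)
    (hG : ∀ x ∈ I, HasDerivAt G (g x) x) (hG₀ : G x₀ = 0) (hpos : ∀ x ∈ I, 0 < 1 + m * G x) :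
    ∃ s : ℝ → ℝ, ContDiffOn ℝ ∞ s I ∧ s x₀ = 0 ∧ ∀ x ∈ I,
      Real.exp (m * s x) * (1 + m * G x) = 1 ∧
      HasDerivAt s (-g x * Real.exp (m * s x)) x := by
  rcases eq_or_ne m 0 with rfl | hm
  · refine ⟨fun x => -G x, hGs.neg.contDiffOn, by simp [hG₀], fun x hx => ⟨by simp, ?_⟩⟩
    exact (hG x hx).neg.congr_deriv (by simp)
  · have hexp {x : ℝ} (hx : x ∈ I) :
        Real.exp (m * -(Real.log (1 + m * G x) / m)) = (1 + m * G x)⁻¹ := by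
      rw [mul_neg, mul_div_cancel₀ _ hm, Real.exp_neg, Real.exp_log (hpos x hx)]
    refine ⟨fun x => -(Real.log (1 + m * G x) / m), ?_, by simp [hG₀], fun x hx => ⟨?_, ?_⟩⟩
    · exact (((contDiff_const.add (contDiff_const.mul hGs)).contDiffOn.log
        fun x hx => (hpos x hx).ne').div_const m).neg
    · rw [hexp hx, inv_mul_cancel₀ (hpos x hx).ne']
    · refine (((((hG x hx).const_mul m).const_add 1).log (hpos x hx).ne').div_const m).neg
        |>.congr_deriv ?_
      have hne := (hpos x hx).ne'
      rw [hexp hx]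
      field_simp

theorem isReducible_of_linear {T I J : Set ℝ} {f D K : ℝ → ℝ} {μ ν k₁ a x₀ : ℝ}
    (hT : IsOpenInterval T) (hadm : IsAdmissible I J f D K)
    (hD : ∀ u ∈ J, (μ * u + ν) * deriv D u = D u) (hK : ∀ u ∈ J, K u = k₁ * D u) (hx₀ : x₀ ∈ I)
    (hpos : ∀ x ∈ I, 0 < 1 + (μ + 1) * a * expInt (-k₁) (x - x₀))
    (hf : ∀ x ∈ I, (1 + (μ + 1) * a * expInt (-k₁) (x - x₀)) * (deriv f x + 2 * k₁ * f x)
      = -(4 * μ + 3) * a * Real.exp (-k₁ * (x - x₀)) * f x) :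
    IsReducible T I J f D K := by
  have hXs : ContDiff ℝ ∞ fun x => expInt (-k₁) (x - x₀) :=
    (contDiff_expInt _).comp (contDiff_id.sub contDiff_const)
  simp only [mul_assoc (μ + 1)] at hpos hf
  obtain ⟨s, hss, hs₀, hs⟩ := exists_hasDerivAt_exp_mul (x₀ := x₀)
    (contDiff_const.mul hXs) (fun x _ => (hasDerivAt_expInt_sub (-k₁) x₀ x).const_mul a) (by simp)
    hpos
  have hs' : ∀ x ∈ I, HasDerivAt s (-a * Real.exp ((μ + 1) * s x + -k₁ * (x - x₀))) x :=
    fun x hx => (hs x hx).2.congr_deriv (by rw [Real.exp_add]; ring)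
  have hY : ∀ x ∈ I,
      HasDerivAt (fun x => expInt (-k₁) (x - x₀) * Real.exp ((μ + 1) * s x))
        (Real.exp (2 * (μ + 1) * s x + -k₁ * (x - x₀))) x := fun x hx => by
    refine ((hasDerivAt_expInt_sub (-k₁) x₀ x).mul
      ((hs' x hx).const_mul (μ + 1)).exp).congr_deriv ?_
    rw [mul_assoc, two_mul, Real.exp_add, Real.exp_add, Real.exp_add]
    linear_combination -(Real.exp (-k₁ * (x - x₀)) * Real.exp ((μ + 1) * s x)) * (hs x hx).1
  have hfs : ∀ x ∈ I,
      f x = f x₀ * Real.exp ((4 * μ + 3) * s x + -(2 * k₁) * (x - x₀)) := fun x hx => by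
    refine hadm.interval_x.eq_of_hasDerivAt_mul
      (r := fun x => (4 * μ + 3) * (-a * Real.exp ((μ + 1) * s x + -k₁ * (x - x₀))) + -(2 * k₁))
      (fun z hz => (hadm.hasDerivAt_f hz).congr_deriv ?_)
      (fun z hz => ((hasDerivAt_exp_linear (hs' z hz) _ _ _).const_mul _).congr_deriv (by ring))
      (fun z _ => mul_ne_zero (hadm.f_ne_zero x₀ hx₀) (Real.exp_ne_zero _)) hx₀ hx (by simp [hs₀])
    rw [Real.exp_add]
    linear_combination Real.exp ((μ + 1) * s z) * hf z hz
      - (deriv f z + 2 * k₁ * f z) * (hs z hz).1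
  exact (reductionData_of_stationary (hadm.f_ne_zero x₀ hx₀) hss
    (hXs.contDiffOn.mul (contDiffOn_const.mul hss).exp) hs' hY hfs).isReducible hT hadm hD
    fun u hu => by rw [hK u hu, add_zero]

theorem reductionData_of_pos {T I : Set ℝ} {f θ : ℝ → ℝ} {g : ℝ → ℝ → ℝ} {d k₀ : ℝ} (hd : d ≠ 0)
    (hf₀ : ∀ x ∈ I, f x ≠ 0) (hf : ∀ x ∈ I, HasDerivAt f (-d * f x ^ 2) x)
    (hgs : SmoothOn₂ T I g) (hgpos : ∀ t ∈ T, ∀ x ∈ I, 0 < g t x)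
    (hgx : ∀ t ∈ T, ∀ x ∈ I, HasDerivAt (g t) (-d * f x * g t x) x)
    (hgt : ∀ t ∈ T, ∀ x ∈ I, HasDerivAt (fun r => g r x) (-(k₀ * d) * g t x) t)
    (hθs : ContDiffOn ℝ ∞ θ T) (hθ : ∀ t ∈ T, ∀ x ∈ I, deriv θ t = d ^ 2 * f x / g t x) :
    ReductionData T I f (-2 / 3) k₀ 0 θ (fun t x => -g t x) (fun t x => 3 * Real.log (g t x))
      (fun _ x => (d * f x)⁻¹) := by
  have hsx (t x : ℝ) (ht : t ∈ T) (hx : x ∈ I) :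
      deriv (fun y => 3 * Real.log (g t y)) x = -3 * d * f x := by
    have := (hgpos t ht x hx).ne'
    rw [(((hgx t ht x hx).log this).const_mul 3).deriv]
    field_simp
  have hst (t x : ℝ) (ht : t ∈ T) (hx : x ∈ I) :
      deriv (fun r => 3 * Real.log (g r x)) t = -3 * (k₀ * d) := by
    have := (hgpos t ht x hx).ne'
    rw [(((hgt t ht x hx).log this).const_mul 3).deriv]
    field_simp
  have hYx (t x : ℝ) (ht : t ∈ T) (hx : x ∈ I) : deriv (fun y => -g t y) x = d * f x * g t x := by
    rw [(hgx t ht x hx).fun_neg.deriv]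
    ring
  refine ⟨hθs, hgs.neg, contDiffOn_const.mul (hgs.log fun z hz => (hgpos _ hz.1 _ hz.2).ne'), ?_,
    fun t ht x hx => ?_, fun t ht => ⟨-3, fun x hx => ?_⟩, ?_, ?_, ?_⟩
  · intro t ht x hx
    rw [hYx t x ht hx, ← mul_assoc, inv_mul_cancel₀ (mul_ne_zero hd (hf₀ x hx)), one_mul,
      show (-2 / 3 + 1) * (3 * Real.log (g t x)) = Real.log (g t x) by ring,
      Real.exp_log (hgpos t ht x hx)]
  · rw [hsx t x ht hx]
    have := hf₀ x hx
    refine (((hf x hx).const_mul d).inv (mul_ne_zero hd this)).congr_deriv ?_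
    field_simp
    ring
  · rw [hsx t x ht hx]
    have := hf₀ x hx
    field_simp
  all_goals
    intro t ht x hx
    have := hf₀ x hx
    have := (hgpos t ht x hx).ne'
  · rw [hYx t x ht hx, hθ t ht x hx,
      show (-2 / 3) * (3 * Real.log (g t x)) = -((2 : ℕ) * Real.log (g t x)) by push_cast; ring,
      Real.exp_neg, Real.exp_nat_mul, Real.exp_log (hgpos t ht x hx)]
    field_simp
  · rw [hYx t x ht hx, (hgt t ht x hx).fun_neg.deriv]
    ring
  · rw [hsx t x ht hx, hst t x ht hx]
    ring

theorem isReducible_of_inverse_linear {T I J : Set ℝ} {f D K : ℝ → ℝ} {ν k₀ d : ℝ}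
    (hT : IsOpenInterval T) (hadm : IsAdmissible I J f D K)
    (hD : ∀ u ∈ J, (-2 / 3 * u + ν) * deriv D u = D u) (hK : ∀ u ∈ J, K u = k₀) (hk₀ : k₀ ≠ 0)
    (hd : d ≠ 0) (hf : ∀ x ∈ I, deriv f x = -d * f x ^ 2) : IsReducible T I J f D K := by
  obtain ⟨x₀, hx₀⟩ := hadm.interval_x.2.2
  have hpos (x : ℝ) (hx : x ∈ I) : 0 < f x * f x₀ :=
    mul_pos_of_continuousOn_of_ne_zero hadm.interval_x.isPreconnected hadm.smooth_f.continuousOn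
      hadm.f_ne_zero hx hx₀
  have hf' (x : ℝ) (hx : x ∈ I) : HasDerivAt f (-d * f x ^ 2) x := hf x hx ▸ hadm.hasDerivAt_f hx
  have hred : ReductionData T I f (-2 / 3) k₀ 0
      (fun t => d / (k₀ * f x₀) * Real.exp (k₀ * d * t)) _ _ _ :=
    reductionData_of_pos (g := fun t x => f x * f x₀ * Real.exp (-(k₀ * d) * t)) hd
      hadm.f_ne_zero hf'
      (((smoothOn₂_of_x hadm.smooth_f).mul contDiffOn_const).mul (by fun_prop))
      (fun t _ x hx => mul_pos (hpos x hx) (Real.exp_pos _))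
      (fun t _ x hx => (((hf' x hx).mul_const _).mul_const _).congr_deriv (by ring))
      (fun t _ x _ => ((hasDerivAt_exp_const_mul _ t).const_mul _).congr_deriv (by ring))
      (by fun_prop)
      fun t _ x hx => by
        have := hadm.f_ne_zero x hx
        have := hadm.f_ne_zero x₀ hx₀
        rw [((hasDerivAt_exp_const_mul _ t).const_mul _).deriv, neg_mul, Real.exp_neg]
        field_simp
  exact hred.isReducible hT hadm hD fun u hu => by rw [hK u hu, zero_mul, zero_add]

/-! ### Spaces of symmetries -/

theorem exists_mem_ne_zero_eq_zero_of_lt_rank {𝕜 V : Type*} [Field 𝕜] [AddCommGroup V] [Module 𝕜 V]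
    {S : Submodule 𝕜 V} {n : ℕ} (hS : n < Module.rank 𝕜 S) (l : Fin n → V →ₗ[𝕜] 𝕜) :
    ∃ v ∈ S, v ≠ 0 ∧ ∀ i, l i v = 0 := by
  by_contra! hcon
  have hinj : Function.Injective (LinearMap.pi l ∘ₗ S.subtype) :=
    (injective_iff_map_eq_zero _).2 fun v hv => by
      by_contra hv₀
      obtain ⟨i, hi⟩ := hcon v v.2 fun h => hv₀ (Subtype.ext h)
      exact hi (congrFun hv i)
  have hrank := LinearMap.lift_rank_le_of_injective _ hinj
  rw [rank_fin_fun, Cardinal.lift_natCast, Cardinal.lift_le_nat_iff] at hrank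
  exact hrank.not_gt hS

/-- The coefficient of `∂_t` at the point `p`, as a linear functional of the vector field. -/
def evalT (p : PointSpace) : (PointSpace → PointSpace) →ₗ[ℝ] ℝ :=
  LinearMap.fst ℝ ℝ (ℝ × ℝ) ∘ₗ LinearMap.proj p

/-- The coefficient of `∂_x` at the point `p`, as a linear functional of the vector field. -/
def evalX (p : PointSpace) : (PointSpace → PointSpace) →ₗ[ℝ] ℝ :=
  LinearMap.fst ℝ ℝ ℝ ∘ₗ LinearMap.snd ℝ ℝ (ℝ × ℝ) ∘ₗ LinearMap.proj p

/-- The coefficient of `∂_u` at the point `p`, as a linear functional of the vector field. -/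
def evalU (p : PointSpace) : (PointSpace → PointSpace) →ₗ[ℝ] ℝ :=
  LinearMap.snd ℝ ℝ ℝ ∘ₗ LinearMap.snd ℝ ℝ (ℝ × ℝ) ∘ₗ LinearMap.proj p

theorem exists_mem_ne_zero_apply_eq_zero {𝔤 : Submodule ℝ (PointSpace → PointSpace)}
    (hdim : 3 < Module.rank ℝ 𝔤) (p : PointSpace) : ∃ Q ∈ 𝔤, Q ≠ 0 ∧ Q p = 0 := by
  obtain ⟨Q, hQ, hQ₀, hvanish⟩ := exists_mem_ne_zero_eq_zero_of_lt_rank (n := 3)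
    (by exact_mod_cast hdim) ![evalT p, evalX p, evalU p]
  exact ⟨Q, hQ, hQ₀, Prod.ext (hvanish 0) (Prod.ext (hvanish 1) (hvanish 2))⟩

/-- `𝔤` is a linear space of smooth vector fields on `Ω`, extended by zero, all of which are
infinitesimal symmetries of the equation; it need not be closed under Lie brackets. -/
structure IsSymmetrySpace (f D K : ℝ → ℝ) (Ω : Set PointSpace)
    (𝔤 : Submodule ℝ (PointSpace → PointSpace)) : Prop where
  smooth : ∀ Q ∈ 𝔤, ContDiffOn ℝ ∞ Q Ω
  zero_outside : ∀ Q ∈ 𝔤, ∀ p, p ∉ Ω → Q p = 0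
  symmetry : ∀ Q ∈ 𝔤, IsInfinitesimalSymmetry f D K Ω Q

theorem IsInvarianceAlgebra.isSymmetrySpace {f D K : ℝ → ℝ} {Ω : Set PointSpace}
    {𝔤 : Submodule ℝ (PointSpace → PointSpace)} (h𝔤 : IsInvarianceAlgebra f D K Ω 𝔤) :
    IsSymmetrySpace f D K Ω 𝔤 :=
  ⟨h𝔤.smooth, h𝔤.zero_outside, h𝔤.symmetry⟩

namespace IsSymmetrySpace

variable {T I J : Set ℝ} {f D K : ℝ → ℝ} {𝔤 : Submodule ℝ (PointSpace → PointSpace)}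
  {Q : PointSpace → PointSpace}

theorem exists_symmetryCoefficients (h𝔤 : IsSymmetrySpace f D K (box T I J) 𝔤) (hT : IsOpen T)
    (hadm : IsAdmissible I J f D K) (hQ : Q ∈ 𝔤) :
    ∃ τ ξ a b, SymmetryCoefficients T I J f D K Q τ ξ a b :=
  _root_.exists_symmetryCoefficients hT hadm (h𝔤.smooth Q hQ) (h𝔤.symmetry Q hQ)

theorem eq_zero_of_eqOn_zero {Ω : Set PointSpace} (h𝔤 : IsSymmetrySpace f D K Ω 𝔤) (hQ : Q ∈ 𝔤)
    (h₀ : ∀ p ∈ Ω, Q p = 0) : Q = 0 := by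
  funext p
  by_cases hp : p ∈ Ω
  · exact h₀ p hp
  · exact h𝔤.zero_outside Q hQ p hp

end IsSymmetrySpace

/-! ### Integration of functions of `x` or of `(t, x)` -/

theorem IsOpenInterval.eq_add_mul_sub {S : Set ℝ} (hS : IsOpenInterval S) {g : ℝ → ℝ} {c : ℝ}
    (hg : ∀ x ∈ S, HasDerivAt g c x) {x₀ x : ℝ} (hx₀ : x₀ ∈ S) (hx : x ∈ S) :
    g x = g x₀ + c * (x - x₀) := by
  have hconst := hS.eq_of_hasDerivAt_zero (g := fun z => g z - c * (z - x₀)) (fun z hz =>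
    ((hg z hz).sub (((hasDerivAt_id' z).sub_const x₀).const_mul c)).congr_deriv (by ring)) hx hx₀
  linear_combination hconst

namespace SmoothOn₂

variable {T I : Set ℝ} {g : ℝ → ℝ → ℝ}

theorem deriv_deriv_x_eq_zero (hg : SmoothOn₂ T I g) (hI : IsOpen I) {t c : ℝ} (ht : t ∈ T)
    (hc : ∀ x ∈ I, deriv (g t) x = c) : ∀ x ∈ I, deriv (deriv (g t)) x = 0 :=
  eq_zero_of_hasDerivAt_of_const hI (fun _ hx => hg.hasDerivAt_deriv_x hI ht hx) hc

theorem eq_add_mul_sub_of_deriv_x (hg : SmoothOn₂ T I g) (hI : IsOpenInterval I) {t c : ℝ}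
    (ht : t ∈ T) (hc : ∀ x ∈ I, deriv (g t) x = c) {x₀ x : ℝ} (hx₀ : x₀ ∈ I) (hx : x ∈ I) :
    g t x = g t x₀ + c * (x - x₀) :=
  hI.eq_add_mul_sub (fun y hy => hc y hy ▸ hg.hasDerivAt_x hI.1 ht hy) hx₀ hx

theorem eq_of_deriv_x_eq_zero (hg : SmoothOn₂ T I g) (hI : IsOpenInterval I) {t : ℝ} (ht : t ∈ T)
    (h₀ : ∀ x ∈ I, deriv (g t) x = 0) {x₀ x : ℝ} (hx₀ : x₀ ∈ I) (hx : x ∈ I) :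
    g t x = g t x₀ := by
  simpa only [zero_mul, add_zero] using hg.eq_add_mul_sub_of_deriv_x hI ht h₀ hx₀ hx

theorem eq_of_deriv_t_eq_zero (hg : SmoothOn₂ T I g) (hT : IsOpenInterval T) {x : ℝ} (hx : x ∈ I)
    (h₀ : ∀ t ∈ T, deriv (fun s => g s x) t = 0) {t₀ t : ℝ} (ht₀ : t₀ ∈ T) (ht : t ∈ T) :
    g t x = g t₀ x :=
  hT.eq_of_hasDerivAt_zero (fun s hs => h₀ s hs ▸ hg.hasDerivAt_t hT.1 hs hx) ht ht₀

theorem eq_of_derivs_eq_zero (hg : SmoothOn₂ T I g) (hT : IsOpenInterval T)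
    (hI : IsOpenInterval I) (hx₀ : ∀ t ∈ T, ∀ x ∈ I, deriv (g t) x = 0)
    (ht₀ : ∀ t ∈ T, ∀ x ∈ I, deriv (fun s => g s x) t = 0) {t t' x x' : ℝ}
    (ht : t ∈ T) (ht' : t' ∈ T) (hx : x ∈ I) (hx' : x' ∈ I) : g t x = g t' x' :=
  (hg.eq_of_deriv_x_eq_zero hI ht (hx₀ t ht) hx' hx).trans
    (hg.eq_of_deriv_t_eq_zero hT hx' (fun s hs => ht₀ s hs x' hx') ht' ht)

theorem deriv_t_eq_of_deriv_x (hg : SmoothOn₂ T I g) (hT : IsOpen T) (hI : IsOpenInterval I)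
    {c : ℝ → ℝ} {c' : ℝ} (hc : ∀ t ∈ T, ∀ x ∈ I, deriv (g t) x = c t) {t : ℝ} (ht : t ∈ T)
    (hc' : HasDerivAt c c' t) {x₀ x : ℝ} (hx₀ : x₀ ∈ I) (hx : x ∈ I) :
    deriv (fun s => g s x) t = deriv (fun s => g s x₀) t + c' * (x - x₀) := by
  have hform : T.EqOn (fun s => g s x) fun s => g s x₀ + c s * (x - x₀) := fun s hs =>
    hg.eq_add_mul_sub_of_deriv_x hI hs (hc s hs) hx₀ hx
  exact (hform.deriv hT ht).trans
    ((hg.hasDerivAt_t hT ht hx₀).add (hc'.mul_const (x - x₀))).deriv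

theorem derivs_eq_const_mul (hg : SmoothOn₂ T I g) (hT : IsOpen T) (hI : IsOpen I)
    {h : ℝ → ℝ → ℝ} {c : ℝ} (hh : ∀ t ∈ T, ∀ x ∈ I, h t x = c * g t x) {t x : ℝ} (ht : t ∈ T)
    (hx : x ∈ I) :
    deriv (h t) x = c * deriv (g t) x ∧ deriv (deriv (h t)) x = c * deriv (deriv (g t)) x ∧
      deriv (fun s => h s x) t = c * deriv (fun s => g s x) t := by
  have hderiv {y : ℝ} (hy : y ∈ I) : deriv (h t) y = c * deriv (g t) y :=
    (Set.EqOn.deriv (hh t ht) hI hy).trans ((hg.hasDerivAt_x hI ht hy).const_mul c).deriv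
  refine ⟨hderiv hx, ?_, ?_⟩
  · exact (Set.EqOn.deriv (fun _ => hderiv) hI hx).trans
      ((hg.hasDerivAt_deriv_x hI ht hx).const_mul c).deriv
  · exact (Set.EqOn.deriv (fun s hs => hh s hs x hx) hT ht).trans
      ((hg.hasDerivAt_t hT ht hx).const_mul c).deriv

end SmoothOn₂

/-! ### Constant diffusivity -/

section ConstantDiffusivity

variable {T I J : Set ℝ} {f D K : ℝ → ℝ} {Q : PointSpace → PointSpace} {τ : ℝ → ℝ}
  {ξ a b : ℝ → ℝ → ℝ} {d : ℝ}

namespace SymmetryCoefficients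

section Equations

variable (h : SymmetryCoefficients T I J f D K Q τ ξ a b) (hadm : IsAdmissible I J f D K)
  (hD : ∀ u ∈ J, D u = d) {t x : ℝ} (ht : t ∈ T) (hx : x ∈ I)

include h hadm hD ht hx

theorem eq_uxx_of_const :
    ξ t x * deriv f x - f x * deriv τ t + 2 * f x * deriv (ξ t) x = 0 := by
  obtain ⟨u, hu⟩ := hadm.interval_u.2.2
  have heq := h.eq_uxx t ht x hx u hu
  rw [eq_zero_of_hasDerivAt_of_const hadm.interval_u.1 (fun _ => hadm.hasDerivAt_D) hD u hu,
    mul_zero, mul_zero] at heq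
  exact (mul_eq_zero.1 heq).resolve_left (hadm.D_ne_zero u hu)

theorem eq_ux_of_const {u : ℝ} (hu : u ∈ J) :
    K u * deriv (ξ t) x + f x * deriv (fun s => ξ s x) t + (a t x * u + b t x) * deriv K u
      + d * (2 * deriv (a t) x - deriv (deriv (ξ t)) x) = 0 := by
  have heq := h.eq_ux t ht x hx u hu
  rw [eq_zero_of_hasDerivAt_of_const hadm.interval_u.1 (fun _ => hadm.hasDerivAt_D) hD u hu,
    hD u hu] at heq
  refine mul_left_cancel₀ (hadm.f_ne_zero x hx) ?_
  linear_combination K u * h.eq_uxx_of_const hadm hD ht hx - heq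

omit hadm in
theorem eq_one_of_const {u : ℝ} (hu : u ∈ J) :
    f x * (deriv (fun s => a s x) t * u + deriv (fun s => b s x) t)
      = d * (deriv (deriv (a t)) x * u + deriv (deriv (b t)) x)
        + K u * (deriv (a t) x * u + deriv (b t) x) := by
  rw [h.eq_one t ht x hx u hu, hD u hu]

end Equations

section AffineConvection

variable (h : SymmetryCoefficients T I J f D K Q τ ξ a b) (hadm : IsAdmissible I J f D K)
  (hD : ∀ u ∈ J, D u = d) {α β : ℝ} (hα : α ≠ 0) (hK : ∀ u ∈ J, K u = α * u + β)

include h hadm hD hα hK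

theorem deriv_x_of_const_of_affine {t x : ℝ} (ht : t ∈ T) (hx : x ∈ I) :
    deriv (ξ t) x = -a t x ∧ deriv (a t) x = 0 := by
  have hJ := hadm.interval_u
  have hK' {u : ℝ} (hu : u ∈ J) : deriv K u = α :=
    (Set.EqOn.deriv hK hJ.1 hu).trans (by simp)
  have hux := (affine_coeffs_eq_zero hJ.infinite (a := β * deriv (ξ t) x
      + f x * deriv (fun s => ξ s x) t + α * b t x
      + d * (2 * deriv (a t) x - deriv (deriv (ξ t)) x))
    (b := α * (deriv (ξ t) x + a t x)) fun u hu => by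
      have heq := h.eq_ux_of_const hadm hD ht hx hu
      rw [hK' hu, hK u hu] at heq
      linear_combination heq).2
  have hone := (cubic_coeffs_eq_zero hJ.infinite
    (a := d * deriv (deriv (b t)) x + β * deriv (b t) x - f x * deriv (fun s => b s x) t)
    (b := d * deriv (deriv (a t)) x + β * deriv (a t) x + α * deriv (b t) x
      - f x * deriv (fun s => a s x) t)
    (c := α * deriv (a t) x) (d := 0) fun u hu => by
      have heq := h.eq_one_of_const hD ht hx hu
      rw [hK u hu] at heq
      linear_combination -heq).2.2.1
  exact ⟨eq_neg_of_add_eq_zero_left ((mul_eq_zero.1 hux).resolve_left hα),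
    (mul_eq_zero.1 hone).resolve_left hα⟩

theorem deriv_t_of_const_of_affine {t : ℝ} (ht : t ∈ T) :
    ∀ x ∈ I, f x * deriv (fun s => ξ s x) t + α * b t x = β * a t x ∧
      f x * deriv (fun s => a s x) t = α * deriv (b t) x := by
  intro x hx
  have hI := hadm.interval_x
  have hderiv {y : ℝ} (hy : y ∈ I) := h.deriv_x_of_const_of_affine hadm hD hα hK ht hy
  have hξ : ∀ y ∈ I, deriv (ξ t) y = -a t x := fun y hy => (hderiv hy).1.trans <|
    congrArg Neg.neg (h.smooth_a.eq_of_deriv_x_eq_zero hI ht (fun z hz => (hderiv hz).2) hx hy)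
  have hax := (hderiv hx).2
  have haxx := h.smooth_a.deriv_deriv_x_eq_zero hI.1 ht (fun y hy => (hderiv hy).2) x hx
  have hξxx := h.smooth_ξ.deriv_deriv_x_eq_zero hI.1 ht hξ x hx
  constructor
  · obtain ⟨u, hu⟩ := hadm.interval_u.2.2
    have hK' : deriv K u = α := (Set.EqOn.deriv hK hadm.interval_u.1 hu).trans (by simp)
    have heq := h.eq_ux_of_const hadm hD ht hx hu
    rw [hK', hK u hu, hξ x hx, hax, hξxx] at heq
    linear_combination heq
  · have hcoeffs := (affine_coeffs_eq_zero hadm.interval_u.infinite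
      (a := f x * deriv (fun s => b s x) t - d * deriv (deriv (b t)) x - β * deriv (b t) x)
      (b := f x * deriv (fun s => a s x) t - α * deriv (b t) x) fun u hu => by
        have heq := h.eq_one_of_const hD ht hx hu
        rw [hK u hu, hax, haxx] at heq
        linear_combination heq).2
    linear_combination hcoeffs

theorem deriv_f_eq_zero_of_deriv_b_ne_zero (hT : IsOpen T) {t₁ x₁ : ℝ} (ht₁ : t₁ ∈ T)
    (hx₁ : x₁ ∈ I) (hb : deriv (b t₁) x₁ ≠ 0) : ∀ x ∈ I, deriv f x = 0 := by
  have hI := hadm.interval_x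
  have hderiv_x {t x : ℝ} (ht : t ∈ T) (hx : x ∈ I) :=
    h.deriv_x_of_const_of_affine hadm hD hα hK ht hx
  have hderiv_t {x : ℝ} (hx : x ∈ I) := h.deriv_t_of_const_of_affine hadm hD hα hK ht₁ x hx
  have ha {t x : ℝ} (ht : t ∈ T) (hx : x ∈ I) : a t x = a t x₁ :=
    h.smooth_a.eq_of_deriv_x_eq_zero hI ht (fun y hy => (hderiv_x ht hy).2) hx₁ hx
  have hξ : ∀ t ∈ T, ∀ x ∈ I, deriv (ξ t) x = -a t x₁ := fun t ht x hx =>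
    (hderiv_x ht hx).1.trans (congrArg Neg.neg (ha ht hx))
  set a' := deriv (fun s => a s x₁) t₁
  set c' := deriv (fun s => ξ s x₁) t₁
  have ha₁ := h.smooth_a.hasDerivAt_t hT ht₁ hx₁
  have hat {x : ℝ} (hx : x ∈ I) : deriv (fun s => a s x) t₁ = a' :=
    Set.EqOn.deriv (fun t ht => ha ht hx) hT ht₁
  have hξt {x : ℝ} (hx : x ∈ I) : deriv (fun s => ξ s x) t₁ = c' + -a' * (x - x₁) :=
    h.smooth_ξ.deriv_t_eq_of_deriv_x hT hI hξ ht₁ ha₁.fun_neg hx₁ hx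
  have ha' : a' ≠ 0 := fun h₀ => mul_ne_zero hα hb <| by
    rw [← (hderiv_t hx₁).2, hat hx₁, h₀, mul_zero]
  have hdiff : ∀ x ∈ I, deriv f x * (c' + -a' * (x - x₁)) + f x * -a' + α * deriv (b t₁) x = 0 :=
    eq_zero_of_hasDerivAt_of_const hI.1 (c := β * a t₁ x₁)
      (g := fun x => f x * (c' + -a' * (x - x₁)) + α * b t₁ x)
      (fun x hx => (((hadm.hasDerivAt_f hx).mul ((((hasDerivAt_id' x).sub_const x₁).const_mul
        (-a')).const_add c')).add ((h.smooth_b.hasDerivAt_x hI.1 ht₁ hx).const_mul α)).congr_deriv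
        (by ring))
      fun x hx => by rw [← hξt hx, (hderiv_t hx).1, ha ht₁ hx]
  refine eq_zero_of_affine_mul_eq_zero hI.1 (contDiffOn_deriv_of_isOpen hI.1
    hadm.smooth_f).continuousOn (a := -a') (b := c' + a' * x₁) (.inl (neg_ne_zero.2 ha'))
    fun x hx => ?_
  have hfa := (hderiv_t hx).2
  rw [hat hx] at hfa
  linear_combination hdiff x hx + hfa

end AffineConvection

section HyperbolicConvection

variable (h : SymmetryCoefficients T I J f D K Q τ ξ a b) (hadm : IsAdmissible I J f D K)
  (hD : ∀ u ∈ J, D u = d) {r k₀ k₁ : ℝ} (hk₁ : k₁ ≠ 0) (hK : ∀ u ∈ J, (u - r) * (K u - k₀) = k₁)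

include h hadm hD hk₁ hK

theorem b_eq_of_hyperbolic {t x : ℝ} (ht : t ∈ T) (hx : x ∈ I) : b t x = -r * a t x := by
  have hJ := hadm.interval_u
  have hK' {u : ℝ} (hu : u ∈ J) : (u - r) ^ 2 * deriv K u = -k₁ := by
    have hdiff := eq_zero_of_hasDerivAt_of_const hJ.1 (g := fun u => (u - r) * (K u - k₀))
      (fun v hv => ((hasDerivAt_id' v).sub_const r).mul ((hadm.hasDerivAt_K hv).sub_const k₀)) hK
      u hu
    linear_combination (u - r) * hdiff - hK u hu
  have hroot := (cubic_coeffs_eq_zero (hJ.infinite.image (sub_left_injective (b := r)).injOn)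
    (a := -k₁ * (a t x * r + b t x)) (b := k₁ * deriv (ξ t) x - k₁ * a t x)
    (c := k₀ * deriv (ξ t) x + f x * deriv (fun s => ξ s x) t
      + d * (2 * deriv (a t) x - deriv (deriv (ξ t)) x)) (d := 0) <| by
      rintro _ ⟨u, hu, rfl⟩
      linear_combination (u - r) ^ 2 * h.eq_ux_of_const hadm hD ht hx hu
        - (a t x * u + b t x) * hK' hu - (u - r) * deriv (ξ t) x * hK u hu).1
  linear_combination (mul_eq_zero.1 hroot).resolve_left (neg_ne_zero.2 hk₁)

theorem deriv_a_eq_zero_of_hyperbolic (hT : IsOpen T) {t x : ℝ} (ht : t ∈ T) (hx : x ∈ I) :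
    deriv (a t) x = 0 := by
  obtain ⟨hbx, hbxx, hbt⟩ := h.smooth_a.derivs_eq_const_mul hT hadm.interval_x.1
    (fun s hs y hy => h.b_eq_of_hyperbolic hadm hD hk₁ hK hs hy) ht hx
  have hcoeffs := (affine_coeffs_eq_zero
    (hadm.interval_u.infinite.image (sub_left_injective (b := r)).injOn)
    (a := k₁ * deriv (a t) x) (b := d * deriv (deriv (a t)) x + k₀ * deriv (a t) x
      - f x * deriv (fun s => a s x) t) <| by
      rintro _ ⟨u, hu, rfl⟩
      have heq := h.eq_one_of_const hD ht hx hu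
      rw [hbxx, hbt, hbx] at heq
      linear_combination -heq - deriv (a t) x * hK u hu).1
  exact (mul_eq_zero.1 hcoeffs).resolve_left hk₁

end HyperbolicConvection

theorem deriv_a_eq_zero_of_const (h : SymmetryCoefficients T I J f D K Q τ ξ a b)
    (hT : IsOpen T) (hadm : IsAdmissible I J f D K) (hD : ∀ u ∈ J, D u = d)
    (hK : ∃ u ∈ J, deriv K u ≠ 0) {t x : ℝ} (ht : t ∈ T) (hx : x ∈ I) : deriv (a t) x = 0 := by
  have hJ := hadm.interval_u
  by_contra hγ
  set γ := deriv (a t) x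
  set α := f x * deriv (fun s => a s x) t - d * deriv (deriv (a t)) x with hα
  set β := f x * deriv (fun s => b s x) t - d * deriv (deriv (b t)) x with hβ
  set r := -deriv (b t) x / γ with hr
  have hhyp : ∀ u ∈ J, (u - r) * (K u - α / γ) = (β + α * r) / γ := by
    intro u hu
    have heq := h.eq_one_of_const hD ht hx hu
    rw [hr]
    field_simp
    linear_combination -γ * heq + γ * u * hα + γ * hβ
  have hne : (β + α * r) / γ ≠ 0 := by
    intro h₀
    obtain ⟨u, hu, hK'⟩ := hK
    have hconst := eq_zero_of_affine_mul_eq_zero hJ.1 (g := fun u => K u - α / γ)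
      (hadm.smooth_K.continuousOn.sub continuousOn_const) (a := 1) (b := -r) (.inl one_ne_zero)
      fun v hv => by rw [one_mul, ← sub_eq_add_neg, hhyp v hv, h₀]
    exact hK' (eq_zero_of_hasDerivAt_of_const hJ.1 (fun _ => hadm.hasDerivAt_K)
      (fun v hv => sub_eq_zero.1 (hconst v hv)) u hu)
  exact hγ (h.deriv_a_eq_zero_of_hyperbolic hadm hD hne hhyp hT ht hx)

section Vanishing

variable (h : SymmetryCoefficients T I J f D K Q τ ξ a b) (hT : IsOpenInterval T)
  (hadm : IsAdmissible I J f D K) (hD : ∀ u ∈ J, D u = d)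

include h hT hadm hD

theorem deriv_b_eq_zero_of_const (hK : ∃ u ∈ J, deriv K u ≠ 0) (hf : ∃ x ∈ I, deriv f x ≠ 0)
    {t x : ℝ} (ht : t ∈ T) (hx : x ∈ I) : deriv (b t) x = 0 := by
  by_contra hb
  have ha : ∀ y ∈ I, deriv (a t) y = 0 := fun y hy =>
    h.deriv_a_eq_zero_of_const hT.1 hadm hD hK ht hy
  set α := f x * deriv (fun s => a s x) t / deriv (b t) x with hα
  set β := (f x * deriv (fun s => b s x) t - d * deriv (deriv (b t)) x) / deriv (b t) x with hβ
  have hKaff : ∀ u ∈ J, K u = α * u + β := by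
    intro u hu
    have heq := h.eq_one_of_const hD ht hx hu
    rw [ha x hx, h.smooth_a.deriv_deriv_x_eq_zero hadm.interval_x.1 ht ha x hx] at heq
    rw [hα, hβ]
    field_simp
    linear_combination -heq
  have hα₀ : α ≠ 0 := fun hα₀ => by
    obtain ⟨u, hu, hK'⟩ := hK
    exact hK' (eq_zero_of_hasDerivAt_of_const hadm.interval_u.1 (fun _ => hadm.hasDerivAt_K)
      (fun v hv => by rw [hKaff v hv, hα₀, zero_mul]) u hu)
  obtain ⟨y, hy, hfy⟩ := hf
  exact hfy (h.deriv_f_eq_zero_of_deriv_b_ne_zero hadm hD hα₀ hKaff hT.1 ht hx hb y hy)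

theorem a_b_eq_of_const (hK : ∃ u ∈ J, deriv K u ≠ 0) (hf : ∃ x ∈ I, deriv f x ≠ 0)
    {t t' x x' : ℝ} (ht : t ∈ T) (ht' : t' ∈ T) (hx : x ∈ I) (hx' : x' ∈ I) :
    a t x = a t' x' ∧ b t x = b t' x' := by
  have hI := hadm.interval_x
  have hax : ∀ s ∈ T, ∀ y ∈ I, deriv (a s) y = 0 := fun s hs y hy =>
    h.deriv_a_eq_zero_of_const hT.1 hadm hD hK hs hy
  have hbx : ∀ s ∈ T, ∀ y ∈ I, deriv (b s) y = 0 := fun s hs y hy =>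
    h.deriv_b_eq_zero_of_const hT hadm hD hK hf hs hy
  have hderiv_t {s y : ℝ} (hs : s ∈ T) (hy : y ∈ I) :
      deriv (fun s => b s y) s = 0 ∧ deriv (fun s => a s y) s = 0 :=
    affine_coeffs_eq_zero hadm.interval_u.infinite fun u hu => by
      have heq := h.eq_one_of_const hD hs hy hu
      rw [hax s hs y hy, hbx s hs y hy, h.smooth_a.deriv_deriv_x_eq_zero hI.1 hs (hax s hs) y hy,
        h.smooth_b.deriv_deriv_x_eq_zero hI.1 hs (hbx s hs) y hy] at heq
      exact (mul_eq_zero.1 (by linear_combination heq)).resolve_left (hadm.f_ne_zero y hy)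
  exact ⟨h.smooth_a.eq_of_derivs_eq_zero hT hI hax (fun s hs y hy => (hderiv_t hs hy).2)
      ht ht' hx hx',
    h.smooth_b.eq_of_derivs_eq_zero hT hI hbx (fun s hs y hy => (hderiv_t hs hy).1) ht ht' hx hx'⟩

theorem ξ_eq_zero_of_const (hf : ∃ x ∈ I, deriv f x ≠ 0) {c k : ℝ}
    (hξ : ∀ t ∈ T, ∀ x ∈ I, deriv (ξ t) x = c)
    (hfξ : ∀ t ∈ T, ∀ x ∈ I, f x * deriv (fun s => ξ s x) t = k) {t₀ x₀ : ℝ} (ht₀ : t₀ ∈ T)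
    (hx₀ : x₀ ∈ I) (hξ₀ : ξ t₀ x₀ = 0) : ∀ t ∈ T, ∀ x ∈ I, ξ t x = 0 := by
  have hI := hadm.interval_x
  obtain ⟨y, hy, hfy⟩ := hf
  have hξt {t x : ℝ} (ht : t ∈ T) (hx : x ∈ I) : f x * deriv (fun s => ξ s x₀) t = k := by
    have heq := h.smooth_ξ.deriv_t_eq_of_deriv_x hT.1 hI hξ ht (hasDerivAt_const t c) hx₀ hx
    rw [zero_mul, add_zero] at heq
    rw [← heq, hfξ t ht x hx]
  have hξt₀ : ∀ t ∈ T, deriv (fun s => ξ s x₀) t = 0 := fun t ht => by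
    have hdiff := eq_zero_of_hasDerivAt_of_const hI.1
      (fun x hx => (hadm.hasDerivAt_f hx).mul_const (deriv (fun s => ξ s x₀) t))
      (fun x hx => hξt ht hx) y hy
    exact (mul_eq_zero.1 hdiff).resolve_left hfy
  have hξx₀ {t : ℝ} (ht : t ∈ T) : ξ t x₀ = 0 :=
    (h.smooth_ξ.eq_of_deriv_t_eq_zero hT hx₀ hξt₀ ht₀ ht).trans hξ₀
  have hξ_eq {t x : ℝ} (ht : t ∈ T) (hx : x ∈ I) : ξ t x = c * (x - x₀) := by
    rw [h.smooth_ξ.eq_add_mul_sub_of_deriv_x hI ht (hξ t ht) hx₀ hx, hξx₀ ht, zero_add]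
  have huxx {x : ℝ} (hx : x ∈ I) :
      c * (x - x₀) * deriv f x - f x * deriv τ t₀ + 2 * f x * c = 0 := by
    rw [← hξ_eq ht₀ hx, ← hξ t₀ ht₀ x hx, h.eq_uxx_of_const hadm hD ht₀ hx]
  have hτ : deriv τ t₀ = 2 * c :=
    mul_left_cancel₀ (hadm.f_ne_zero x₀ hx₀) (by linear_combination -huxx hx₀)
  have hc : c = 0 := by
    by_contra hc
    refine hfy (eq_zero_of_affine_mul_eq_zero hI.1 (contDiffOn_deriv_of_isOpen hI.1
      hadm.smooth_f).continuousOn (a := c) (b := -c * x₀) (.inl hc) (fun x hx => ?_) y hy)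
    linear_combination huxx hx + f x * hτ
  intro t ht x hx
  rw [hξ_eq ht hx, hc, zero_mul]

theorem exists_deriv_ξ_eq_of_const (hK : ∃ u ∈ J, deriv K u ≠ 0) (hf : ∃ x ∈ I, deriv f x ≠ 0)
    {t₀ x₀ u₁ : ℝ} (ht₀ : t₀ ∈ T) (hx₀ : x₀ ∈ I) (hu₁ : u₁ ∈ J)
    (hη₀ : a t₀ x₀ * u₁ + b t₀ x₀ = 0) :
    ∃ c, (∀ t ∈ T, ∀ x ∈ I, deriv (ξ t) x = c) ∧
      (∀ t ∈ T, ∀ x ∈ I, f x * deriv (fun s => ξ s x) t = -(K u₁ * c)) ∧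
      ∀ u ∈ J, c * (K u - K u₁) + a t₀ x₀ * (u - u₁) * deriv K u = 0 := by
  have hux {t x u : ℝ} (ht : t ∈ T) (hx : x ∈ I) (hu : u ∈ J) :
      K u * deriv (ξ t) x + f x * deriv (fun s => ξ s x) t + a t₀ x₀ * (u - u₁) * deriv K u
        - d * deriv (deriv (ξ t)) x = 0 := by
    have heq := h.eq_ux_of_const hadm hD ht hx hu
    have hab := h.a_b_eq_of_const hT hadm hD hK hf ht ht₀ hx hx₀
    rw [hab.1, hab.2, h.deriv_a_eq_zero_of_const hT.1 hadm hD hK ht hx] at heq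
    linear_combination heq - deriv K u * hη₀
  have hsub {t x u : ℝ} (ht : t ∈ T) (hx : x ∈ I) (hu : u ∈ J) :
      deriv (ξ t) x * (K u - K u₁) + a t₀ x₀ * (u - u₁) * deriv K u = 0 := by
    linear_combination hux ht hx hu - hux ht hx hu₁
  obtain ⟨u₂, hu₂, hKu₂⟩ : ∃ u ∈ J, K u ≠ K u₁ := by
    by_contra! hconst
    obtain ⟨u, hu, hK'⟩ := hK
    exact hK' (eq_zero_of_hasDerivAt_of_const hadm.interval_u.1 (fun _ => hadm.hasDerivAt_K)
      hconst u hu)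
  have hξ : ∀ t ∈ T, ∀ x ∈ I, deriv (ξ t) x = deriv (ξ t₀) x₀ := fun t ht x hx =>
    mul_right_cancel₀ (sub_ne_zero.2 hKu₂)
      (by linear_combination hsub ht hx hu₂ - hsub ht₀ hx₀ hu₂)
  refine ⟨_, hξ, fun t ht x hx => ?_, fun u hu => hsub ht₀ hx₀ hu⟩
  have heq := hux ht hx hu₁
  rw [h.smooth_ξ.deriv_deriv_x_eq_zero hadm.interval_x.1 ht (hξ t ht) x hx, hξ t ht x hx] at heq
  linear_combination heq

theorem eq_zero_of_const_of_apply_eq_zero (hK : ∃ u ∈ J, deriv K u ≠ 0)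
    (hf : ∃ x ∈ I, deriv f x ≠ 0) {p : PointSpace} (hp : p ∈ box T I J) (hQp : Q p = 0) :
    ∀ q ∈ box T I J, Q q = 0 := by
  obtain ⟨t₀, x₀, u₁⟩ := p
  obtain ⟨ht₀, hx₀, hu₁⟩ : t₀ ∈ T ∧ x₀ ∈ I ∧ u₁ ∈ J := hp
  have hJ := hadm.interval_u.1
  rw [h.eq t₀ ht₀ x₀ hx₀ u₁ hu₁] at hQp
  obtain ⟨hτ₀, hξ₀, hη₀⟩ : τ t₀ = 0 ∧ ξ t₀ x₀ = 0 ∧ a t₀ x₀ * u₁ + b t₀ x₀ = 0 := by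
    simpa only [Prod.mk_eq_zero] using hQp
  obtain ⟨c, hξx, hfξ, hsub⟩ := h.exists_deriv_ξ_eq_of_const hT hadm hD hK hf ht₀ hx₀ hu₁ hη₀
  have hξ := h.ξ_eq_zero_of_const hT hadm hD hf hξx hfξ ht₀ hx₀ hξ₀
  have hξ' {t x : ℝ} (ht : t ∈ T) (hx : x ∈ I) : deriv (ξ t) x = 0 :=
    eq_zero_of_hasDerivAt_of_const hadm.interval_x.1
      (fun y hy => h.smooth_ξ.hasDerivAt_x hadm.interval_x.1 ht hy) (hξ t ht) x hx
  have hτ' : ∀ t ∈ T, deriv τ t = 0 := fun t ht => by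
    have heq := h.eq_uxx_of_const hadm hD ht hx₀
    rw [hξ t ht x₀ hx₀, hξ' ht hx₀] at heq
    exact (mul_eq_zero.1 (by linear_combination -heq)).resolve_left (hadm.f_ne_zero x₀ hx₀)
  have hτ {t : ℝ} (ht : t ∈ T) : τ t = 0 :=
    (hT.eq_of_hasDerivAt_zero (fun s hs => hτ' s hs ▸ hasDerivAt_deriv_of_isOpen hT.1 h.smooth_τ hs)
      ht ht₀).trans hτ₀
  have ha : a t₀ x₀ = 0 := by
    by_contra ha
    obtain ⟨u, hu, hK'⟩ := hK
    refine hK' (eq_zero_of_affine_mul_eq_zero hJ (contDiffOn_deriv_of_isOpen hJ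
      hadm.smooth_K).continuousOn (a := a t₀ x₀) (b := -a t₀ x₀ * u₁) (.inl ha) (fun v hv => ?_)
      u hu)
    linear_combination hsub v hv - (K v - K u₁) * (hξx t₀ ht₀ x₀ hx₀).symm
      - (K v - K u₁) * hξ' ht₀ hx₀
  rintro ⟨t, x, u⟩ ⟨ht, hx, hu⟩
  have hab := h.a_b_eq_of_const hT hadm hD hK hf ht ht₀ hx hx₀
  have hη : a t x * u + b t x = 0 := by
    linear_combination hab.1 * u + hab.2 + hη₀ + (u - u₁) * ha
  rw [h.eq t ht x hx u hu, hτ ht, hξ t ht x hx, hη]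
  rfl

end Vanishing

end SymmetryCoefficients

theorem IsSymmetrySpace.deriv_f_eq_zero_of_const {𝔤 : Submodule ℝ (PointSpace → PointSpace)}
    (h𝔤 : IsSymmetrySpace f D K (box T I J) 𝔤) (hdim : 3 < Module.rank ℝ 𝔤)
    (hT : IsOpenInterval T) (hadm : IsAdmissible I J f D K) (hD : ∀ u ∈ J, D u = d)
    (hK : ∃ u ∈ J, deriv K u ≠ 0) : ∀ x ∈ I, deriv f x = 0 := by
  by_contra! hf
  obtain ⟨t₀, ht₀⟩ := hT.2.2
  obtain ⟨x₀, hx₀⟩ := hadm.interval_x.2.2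
  obtain ⟨u₁, hu₁⟩ := hadm.interval_u.2.2
  obtain ⟨Q, hQ, hQ₀, hQp⟩ := exists_mem_ne_zero_apply_eq_zero hdim (t₀, x₀, u₁)
  obtain ⟨τ, ξ, a, b, h⟩ := h𝔤.exists_symmetryCoefficients hT.1 hadm hQ
  exact hQ₀ (h𝔤.eq_zero_of_eqOn_zero hQ
    (h.eq_zero_of_const_of_apply_eq_zero hT hadm hD hK hf ⟨ht₀, hx₀, hu₁⟩ hQp))

end ConstantDiffusivity

/-! ### Nonconstant diffusivity -/

/-- The vector field `τ(t) ∂_t + ξ(t, x) ∂_x + A(t, x) (μ u + ν) ∂_u` is given by smooth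
coefficients satisfying the determining equations, where `(μ u + ν) D' = D` unless `A = 0`. This is
the general form of a symmetry when `D` is not constant. -/
structure ScaledCoefficients (T I J : Set ℝ) (f D K : ℝ → ℝ) (μ ν : ℝ)
    (Q : PointSpace → PointSpace) (τ : ℝ → ℝ) (ξ A : ℝ → ℝ → ℝ) : Prop where
  eq : ∀ t ∈ T, ∀ x ∈ I, ∀ u ∈ J, Q (t, x, u) = (τ t, ξ t x, A t x * (μ * u + ν))
  smooth_τ : ContDiffOn ℝ ∞ τ T
  smooth_ξ : SmoothOn₂ T I ξ
  smooth_A : SmoothOn₂ T I A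
  A_mul : ∀ t ∈ T, ∀ x ∈ I, ∀ u ∈ J, A t x * ((μ * u + ν) * deriv D u) = A t x * D u
  eq_uxx : ∀ t ∈ T, ∀ x ∈ I,
    ξ t x * deriv f x - f x * deriv τ t + 2 * f x * deriv (ξ t) x = A t x * f x
  eq_ux : ∀ t ∈ T, ∀ x ∈ I, ∀ u ∈ J,
    (A t x - deriv (ξ t) x) * K u - A t x * (μ * u + ν) * deriv K u
        - f x * deriv (fun s => ξ s x) t
      = D u * (2 * (μ + 1) * deriv (A t) x - deriv (deriv (ξ t)) x)
  eq_one : ∀ t ∈ T, ∀ x ∈ I, ∀ u ∈ J,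
    f x * deriv (fun s => A s x) t = D u * deriv (deriv (A t)) x + K u * deriv (A t) x

section NonconstantDiffusivity

variable {T I J : Set ℝ} {f D K : ℝ → ℝ} {μ ν : ℝ} {𝔤 : Submodule ℝ (PointSpace → PointSpace)}
  {Q : PointSpace → PointSpace} {τ : ℝ → ℝ} {ξ : ℝ → ℝ → ℝ}

theorem IsAdmissible.mul_add_ne_zero (hadm : IsAdmissible I J f D K)
    (hD : ∀ u ∈ J, (μ * u + ν) * deriv D u = D u) : ∀ u ∈ J, μ * u + ν ≠ 0 := fun u hu =>
  left_ne_zero_of_mul (hD u hu ▸ hadm.D_ne_zero u hu)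

theorem IsAdmissible.infinite_image_D (hadm : IsAdmissible I J f D K)
    (hD' : ∃ u ∈ J, deriv D u ≠ 0) : (D '' J).Infinite := by
  refine (hadm.interval_u.isPreconnected.image D hadm.smooth_D.continuousOn).infinite_of_nontrivial
    (Set.not_subsingleton_iff.1 fun hsub => ?_)
  obtain ⟨u, hu, hDu⟩ := hD'
  exact hDu (eq_zero_of_hasDerivAt_of_const hadm.interval_u.1 (fun _ => hadm.hasDerivAt_D)
    (fun v hv => hsub ⟨v, hv, rfl⟩ ⟨u, hu, rfl⟩) u hu)

namespace SymmetryCoefficients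

section Scaled

variable {a b A : ℝ → ℝ → ℝ} (h : SymmetryCoefficients T I J f D K Q τ ξ a b)

include h

theorem scaledCoefficients (hT : IsOpen T) (hadm : IsAdmissible I J f D K) (hA : SmoothOn₂ T I A)
    (hab : ∀ t ∈ T, ∀ x ∈ I, a t x = μ * A t x ∧ b t x = ν * A t x)
    (hφ : ∀ u ∈ J, μ * u + ν ≠ 0)
    (hD : ∀ t ∈ T, ∀ x ∈ I, ∀ u ∈ J, A t x * ((μ * u + ν) * deriv D u) = A t x * D u) :
    ScaledCoefficients T I J f D K μ ν Q τ ξ A := by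
  have hI := hadm.interval_x.1
  have ha {t x : ℝ} (ht : t ∈ T) (hx : x ∈ I) :=
    hA.derivs_eq_const_mul hT hI (fun t ht x hx => (hab t ht x hx).1) ht hx
  have hb {t x : ℝ} (ht : t ∈ T) (hx : x ∈ I) :=
    hA.derivs_eq_const_mul hT hI (fun t ht x hx => (hab t ht x hx).2) ht hx
  have huxx : ∀ t ∈ T, ∀ x ∈ I,
      ξ t x * deriv f x - f x * deriv τ t + 2 * f x * deriv (ξ t) x = A t x * f x := by
    intro t ht x hx
    obtain ⟨u, hu⟩ := hadm.interval_u.2.2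
    have heq := h.eq_uxx t ht x hx u hu
    rw [(hab t ht x hx).1, (hab t ht x hx).2] at heq
    refine mul_left_cancel₀ (hadm.D_ne_zero u hu) ?_
    linear_combination heq + f x * hD t ht x hx u hu
  refine ⟨fun t ht x hx u hu => ?_, h.smooth_τ, h.smooth_ξ, hA, hD, huxx,
    fun t ht x hx u hu => ?_, fun t ht x hx u hu => ?_⟩
  · rw [h.eq t ht x hx u hu, (hab t ht x hx).1, (hab t ht x hx).2]
    ring_nf
  · have hAx : deriv (A t) x * ((μ * u + ν) * deriv D u - D u) = 0 :=
      eq_zero_of_hasDerivAt_of_const hI (g := fun y => A t y * ((μ * u + ν) * deriv D u - D u))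
        (fun y hy => (hA.hasDerivAt_x hI ht hy).mul_const _)
        (fun y hy => by rw [mul_sub, hD t ht y hy u hu, sub_self]) x hx
    have heq := h.eq_ux t ht x hx u hu
    rw [(hab t ht x hx).1, (hab t ht x hx).2, (ha ht hx).1, (hb ht hx).1] at heq
    refine mul_left_cancel₀ (hadm.f_ne_zero x hx) ?_
    linear_combination heq - K u * huxx t ht x hx + 2 * f x * hAx
  · have heq := h.eq_one t ht x hx u hu
    rw [(ha ht hx).1, (ha ht hx).2.1, (ha ht hx).2.2, (hb ht hx).1, (hb ht hx).2.1,
      (hb ht hx).2.2] at heq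
    refine mul_left_cancel₀ (hφ u hu) ?_
    linear_combination heq

theorem scaledCoefficients_of_eta_eq_zero (hT : IsOpen T) (hadm : IsAdmissible I J f D K)
    (hη : ∀ p ∈ box T I J, (Q p).2.2 = 0) :
    ScaledCoefficients T I J f D K 0 1 Q τ ξ fun _ _ => 0 := by
  refine h.scaledCoefficients hT hadm contDiffOn_const (fun t ht x hx => ?_) (by simp) (by simp)
  obtain ⟨hb, ha⟩ := affine_coeffs_eq_zero hadm.interval_u.infinite (a := b t x) (b := a t x)
    fun u hu => by
      have hQ := hη (t, x, u) ⟨ht, hx, hu⟩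
      rw [h.eq t ht x hx u hu] at hQ
      linear_combination hQ
  exact ⟨by rw [ha, mul_zero], by rw [hb, mul_zero]⟩

theorem exists_scaledCoefficients_of_affine (hT : IsOpen T) (hadm : IsAdmissible I J f D K)
    (hD : ∀ u ∈ J, (μ * u + ν) * deriv D u = D u) :
    ∃ A, ScaledCoefficients T I J f D K μ ν Q τ ξ A := by
  obtain ⟨u₀, hu₀⟩ := hadm.interval_u.2.2
  have hφ := hadm.mul_add_ne_zero hD
  have hη {t x u : ℝ} (ht : t ∈ T) (hx : x ∈ I) (hu : u ∈ J) : f x * (a t x * u + b t x)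
      = (ξ t x * deriv f x - f x * deriv τ t + 2 * f x * deriv (ξ t) x) * (μ * u + ν) := by
    refine mul_right_cancel₀ (right_ne_zero_of_mul (hD u hu ▸ hadm.D_ne_zero u hu)) ?_
    linear_combination -h.eq_uxx t ht x hx u hu
      - (ξ t x * deriv f x - f x * deriv τ t + 2 * f x * deriv (ξ t) x) * hD u hu
  refine ⟨fun t x => (a t x * u₀ + b t x) / (μ * u₀ + ν), h.scaledCoefficients hT hadm
    (((h.smooth_a.mul contDiffOn_const).add h.smooth_b).div_const _) (fun t ht x hx => ?_) hφ
    fun _ _ _ _ u hu => by rw [hD u hu]⟩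
  have hη₀ : ∀ u ∈ J, (b t x * (μ * u₀ + ν) - ν * (a t x * u₀ + b t x))
      + (a t x * (μ * u₀ + ν) - μ * (a t x * u₀ + b t x)) * u = 0 := fun u hu =>
    mul_left_cancel₀ (hadm.f_ne_zero x hx) <| by
      linear_combination (μ * u₀ + ν) * hη ht hx hu - (μ * u + ν) * hη ht hx hu₀
  obtain ⟨hb, ha⟩ := affine_coeffs_eq_zero hadm.interval_u.infinite hη₀
  constructor
  · rw [mul_div_assoc', eq_div_iff (hφ u₀ hu₀)]
    linear_combination ha
  · rw [mul_div_assoc', eq_div_iff (hφ u₀ hu₀)]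
    linear_combination hb

theorem exists_affine_of_eta_ne_zero (hadm : IsAdmissible I J f D K)
    (hD' : ∃ u ∈ J, deriv D u ≠ 0) {p : PointSpace} (hp : p ∈ box T I J) (hη : (Q p).2.2 ≠ 0) :
    ∃ μ ν : ℝ, ∀ u ∈ J, (μ * u + ν) * deriv D u = D u := by
  obtain ⟨t, x, v⟩ := p
  obtain ⟨ht, hx, hv⟩ : t ∈ T ∧ x ∈ I ∧ v ∈ J := hp
  rw [h.eq t ht x hx v hv] at hη
  have hf := hadm.f_ne_zero x hx
  have heq := h.eq_uxx t ht x hx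
  set B := ξ t x * deriv f x - f x * deriv τ t + 2 * f x * deriv (ξ t) x
  have hB : B ≠ 0 := by
    intro hB
    obtain ⟨u, hu, hDu⟩ := hD'
    refine hDu (eq_zero_of_affine_mul_eq_zero hadm.interval_u.1
      (contDiffOn_deriv_of_isOpen hadm.interval_u.1 hadm.smooth_D).continuousOn (a := a t x)
      (b := b t x) ?_ (fun w hw => ?_) u hu)
    · by_contra! hab
      exact hη (by simp [hab.1, hab.2])
    · have hw := heq w hw
      rw [hB, mul_zero] at hw
      exact (mul_eq_zero.1 hw.symm).resolve_left hf
  refine ⟨f x * a t x / B, f x * b t x / B, fun u hu => ?_⟩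
  field_simp
  linear_combination -heq u hu

end Scaled

end SymmetryCoefficients

/-- All vector fields in `𝔤` have coefficients of the form `ScaledCoefficients`, with common
constants `μ` and `ν`. -/
def HasScaledCoefficients (T I J : Set ℝ) (f D K : ℝ → ℝ) (μ ν : ℝ)
    (𝔤 : Submodule ℝ (PointSpace → PointSpace)) : Prop :=
  (∀ u ∈ J, μ * u + ν ≠ 0) ∧ ∀ Q ∈ 𝔤, ∃ τ ξ A, ScaledCoefficients T I J f D K μ ν Q τ ξ A

theorem HasScaledCoefficients.exists_eq_zero (h : HasScaledCoefficients T I J f D K μ ν 𝔤)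
    (hJ : J.Nonempty) (hdim : 3 < Module.rank ℝ 𝔤) {t₀ x₀ : ℝ} (ht₀ : t₀ ∈ T) (hx₀ : x₀ ∈ I) :
    ∃ Q ∈ 𝔤, Q ≠ 0 ∧ ∃ τ ξ A, ScaledCoefficients T I J f D K μ ν Q τ ξ A ∧
      τ t₀ = 0 ∧ ξ t₀ x₀ = 0 ∧ A t₀ x₀ = 0 := by
  obtain ⟨u₀, hu₀⟩ := hJ
  obtain ⟨Q, hQ, hQ₀, hvanish⟩ := exists_mem_ne_zero_apply_eq_zero hdim (t₀, x₀, u₀)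
  obtain ⟨τ, ξ, A, hs⟩ := h.2 Q hQ
  simp only [hs.eq t₀ ht₀ x₀ hx₀ u₀ hu₀, Prod.mk_eq_zero] at hvanish
  obtain ⟨hτ, hξ, hA⟩ := hvanish
  exact ⟨Q, hQ, hQ₀, τ, ξ, A, hs, hτ, hξ, (mul_eq_zero.1 hA).resolve_right (h.1 u₀ hu₀)⟩

theorem IsSymmetrySpace.hasScaledCoefficients (h𝔤 : IsSymmetrySpace f D K (box T I J) 𝔤)
    (hT : IsOpen T) (hadm : IsAdmissible I J f D K) (hD' : ∃ u ∈ J, deriv D u ≠ 0) :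
    (∃ μ ν, (∀ u ∈ J, (μ * u + ν) * deriv D u = D u) ∧ HasScaledCoefficients T I J f D K μ ν 𝔤) ∨
      (∀ Q ∈ 𝔤, ∀ p ∈ box T I J, (Q p).2.2 = 0) ∧ HasScaledCoefficients T I J f D K 0 1 𝔤 := by
  by_cases hη : ∀ Q ∈ 𝔤, ∀ p ∈ box T I J, (Q p).2.2 = 0
  · refine .inr ⟨hη, by simp, fun Q hQ => ?_⟩
    obtain ⟨τ, ξ, a, b, h⟩ := h𝔤.exists_symmetryCoefficients hT hadm hQ
    exact ⟨τ, ξ, _, h.scaledCoefficients_of_eta_eq_zero hT hadm (hη Q hQ)⟩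
  · push Not at hη
    obtain ⟨Q, hQ, p, hp, hne⟩ := hη
    obtain ⟨τ, ξ, a, b, h⟩ := h𝔤.exists_symmetryCoefficients hT hadm hQ
    obtain ⟨μ, ν, hD⟩ := h.exists_affine_of_eta_ne_zero hadm hD' hp hne
    refine .inl ⟨μ, ν, hD, hadm.mul_add_ne_zero hD, fun R hR => ?_⟩
    obtain ⟨τ, ξ, a, b, h⟩ := h𝔤.exists_symmetryCoefficients hT hadm hR
    exact ⟨τ, ξ, h.exists_scaledCoefficients_of_affine hT hadm hD⟩

theorem ScaledCoefficients.eq_zero {A : ℝ → ℝ → ℝ}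
    (h : ScaledCoefficients T I J f D K μ ν Q τ ξ A)
    (h𝔤 : IsSymmetrySpace f D K (box T I J) 𝔤) (hT : IsOpenInterval T)
    (hadm : IsAdmissible I J f D K) (hQ : Q ∈ 𝔤) {t₀ : ℝ} (ht₀ : t₀ ∈ T) (hτ : τ t₀ = 0)
    (hξ : ∀ t ∈ T, ∀ x ∈ I, ξ t x = 0) (hA : ∀ t ∈ T, ∀ x ∈ I, A t x = 0) : Q = 0 := by
  obtain ⟨x₀, hx₀⟩ := hadm.interval_x.2.2
  have hτ' : ∀ t ∈ T, HasDerivAt τ 0 t := by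
    intro t ht
    have hξx := eq_zero_of_hasDerivAt_of_const hadm.interval_x.1
      (fun x hx => h.smooth_ξ.hasDerivAt_x hadm.interval_x.1 ht hx) (hξ t ht) x₀ hx₀
    have heq := h.eq_uxx t ht x₀ hx₀
    rw [hξ t ht x₀ hx₀, hA t ht x₀ hx₀, hξx] at heq
    have hfτ : f x₀ * deriv τ t = 0 := by linear_combination -heq
    exact (mul_eq_zero.1 hfτ).resolve_left (hadm.f_ne_zero x₀ hx₀) ▸
      hasDerivAt_deriv_of_isOpen hT.1 h.smooth_τ ht
  refine h𝔤.eq_zero_of_eqOn_zero hQ ?_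
  rintro ⟨t, x, u⟩ ⟨ht, hx, hu⟩
  rw [h.eq t ht x hx u hu, hT.eq_of_hasDerivAt_zero hτ' ht ht₀, hτ, hξ t ht x hx, hA t ht x hx,
    zero_mul]
  rfl

end NonconstantDiffusivity

section LinearRelation

variable {T I J : Set ℝ} {f D K : ℝ → ℝ} {μ ν k₁ k₀ : ℝ}
  {𝔤 : Submodule ℝ (PointSpace → PointSpace)} {Q : PointSpace → PointSpace} {τ : ℝ → ℝ}
  {ξ A : ℝ → ℝ → ℝ}

theorem coeffs_eq_zero_of_not_exists_eq_mul_add {𝕜 ι : Type*} [Field 𝕜] {s : Set ι} {g h : ι → 𝕜}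
    (hg : (g '' s).Infinite) (hgh : ¬∃ k₁ k₀, ∀ i ∈ s, h i = k₁ * g i + k₀) {a b c : 𝕜}
    (habc : ∀ i ∈ s, a + b * g i + c * h i = 0) : a = 0 ∧ b = 0 ∧ c = 0 := by
  have hc : c = 0 := by
    by_contra hc
    refine hgh ⟨-b / c, -a / c, fun i hi => ?_⟩
    field_simp
    linear_combination habc i hi
  obtain ⟨ha, hb⟩ := affine_coeffs_eq_zero hg (a := a) (b := b) <| by
    rintro _ ⟨i, hi, rfl⟩
    linear_combination habc i hi - h i * hc
  exact ⟨ha, hb, hc⟩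

namespace ScaledCoefficients

section NoRelation

variable (h : ScaledCoefficients T I J f D K μ ν Q τ ξ A) (hadm : IsAdmissible I J f D K)
  (hD' : ∃ u ∈ J, deriv D u ≠ 0) (hK : ¬∃ k₁ k₀, ∀ u ∈ J, K u = k₁ * D u + k₀)

include h hadm hD' hK

theorem derivs_A_eq_zero {t x : ℝ} (ht : t ∈ T) (hx : x ∈ I) :
    deriv (fun s => A s x) t = 0 ∧ deriv (A t) x = 0 := by
  obtain ⟨hAt, -, hAx⟩ := coeffs_eq_zero_of_not_exists_eq_mul_add (hadm.infinite_image_D hD') hK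
    (a := -(f x * deriv (fun s => A s x) t)) (b := deriv (deriv (A t)) x) (c := deriv (A t) x)
    fun u hu => by linear_combination -h.eq_one t ht x hx u hu
  exact ⟨(mul_eq_zero.1 (neg_eq_zero.1 hAt)).resolve_left (hadm.f_ne_zero x hx), hAx⟩

theorem derivs_ξ_eq_zero (hA : ∀ t ∈ T, ∀ x ∈ I, A t x = 0) {t x : ℝ} (ht : t ∈ T) (hx : x ∈ I) :
    deriv (fun s => ξ s x) t = 0 ∧ deriv (ξ t) x = 0 := by
  obtain ⟨hξt, -, hξx⟩ := coeffs_eq_zero_of_not_exists_eq_mul_add (hadm.infinite_image_D hD') hK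
    (a := -(f x * deriv (fun s => ξ s x) t)) (b := deriv (deriv (ξ t)) x) (c := -deriv (ξ t) x)
    fun u hu => by
      have heq := h.eq_ux t ht x hx u hu
      rw [hA t ht x hx, (h.derivs_A_eq_zero hadm hD' hK ht hx).2] at heq
      linear_combination heq
  exact ⟨(mul_eq_zero.1 (neg_eq_zero.1 hξt)).resolve_left (hadm.f_ne_zero x hx),
    neg_eq_zero.1 hξx⟩

end NoRelation

end ScaledCoefficients

theorem HasScaledCoefficients.exists_linear_relation
    (h : HasScaledCoefficients T I J f D K μ ν 𝔤) (h𝔤 : IsSymmetrySpace f D K (box T I J) 𝔤)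
    (hdim : 3 < Module.rank ℝ 𝔤) (hT : IsOpenInterval T) (hadm : IsAdmissible I J f D K)
    (hD' : ∃ u ∈ J, deriv D u ≠ 0) : ∃ k₁ k₀, ∀ u ∈ J, K u = k₁ * D u + k₀ := by
  have hI := hadm.interval_x
  by_contra hK
  obtain ⟨t₀, ht₀⟩ := hT.2.2
  obtain ⟨x₀, hx₀⟩ := hI.2.2
  obtain ⟨Q, hQ, hQ₀, τ, ξ, A, hs, hτ, hξ, hA⟩ :=
    h.exists_eq_zero hadm.interval_u.2.2 hdim ht₀ hx₀
  have hAconst : ∀ t ∈ T, ∀ x ∈ I, A t x = 0 := fun t ht x hx => hA ▸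
    hs.smooth_A.eq_of_derivs_eq_zero hT hI
      (fun _ ht _ hx => (hs.derivs_A_eq_zero hadm hD' hK ht hx).2)
      (fun _ ht _ hx => (hs.derivs_A_eq_zero hadm hD' hK ht hx).1) ht ht₀ hx hx₀
  have hξconst : ∀ t ∈ T, ∀ x ∈ I, ξ t x = 0 := fun t ht x hx => hξ ▸
    hs.smooth_ξ.eq_of_derivs_eq_zero hT hI
      (fun _ ht _ hx => (hs.derivs_ξ_eq_zero hadm hD' hK hAconst ht hx).2)
      (fun _ ht _ hx => (hs.derivs_ξ_eq_zero hadm hD' hK hAconst ht hx).1) ht ht₀ hx hx₀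
  exact hQ₀ (hs.eq_zero h𝔤 hT hadm hQ ht₀ hτ hξconst hAconst)

namespace ScaledCoefficients

section Equations

variable (h : ScaledCoefficients T I J f D K μ ν Q τ ξ A) (hadm : IsAdmissible I J f D K)
  (hD' : ∃ u ∈ J, deriv D u ≠ 0) (hK : ∀ u ∈ J, K u = k₁ * D u + k₀)
  {t x : ℝ} (ht : t ∈ T) (hx : x ∈ I)

include h hadm hD' hK ht hx

theorem eq_A_of_linear_relation :
    deriv (deriv (A t)) x = -k₁ * deriv (A t) x ∧
      f x * deriv (fun s => A s x) t = k₀ * deriv (A t) x := by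
  obtain ⟨hone, hlin⟩ := affine_coeffs_eq_zero (hadm.infinite_image_D hD')
    (a := k₀ * deriv (A t) x - f x * deriv (fun s => A s x) t)
    (b := deriv (deriv (A t)) x + k₁ * deriv (A t) x) <| by
      rintro _ ⟨u, hu, rfl⟩
      linear_combination -h.eq_one t ht x hx u hu - deriv (A t) x * hK u hu
  constructor <;> linarith

theorem eq_ξ_of_linear_relation :
    deriv (deriv (ξ t)) x = k₁ * deriv (ξ t) x + 2 * (μ + 1) * deriv (A t) x ∧
      f x * deriv (fun s => ξ s x) t = k₀ * (A t x - deriv (ξ t) x) := by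
  have hK' {u : ℝ} (hu : u ∈ J) : deriv K u = k₁ * deriv D u :=
    (Set.EqOn.deriv hK hadm.interval_u.1 hu).trans
      (((hadm.hasDerivAt_D hu).const_mul k₁).add_const k₀).deriv
  obtain ⟨hone, hlin⟩ := affine_coeffs_eq_zero (hadm.infinite_image_D hD')
    (a := k₀ * (A t x - deriv (ξ t) x) - f x * deriv (fun s => ξ s x) t)
    (b := deriv (deriv (ξ t)) x - k₁ * deriv (ξ t) x - 2 * (μ + 1) * deriv (A t) x) <| by
      rintro _ ⟨u, hu, rfl⟩
      have heq := h.eq_ux t ht x hx u hu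
      rw [hK u hu, hK' hu] at heq
      linear_combination heq + k₁ * h.A_mul t ht x hx u hu
  constructor <;> linarith

end Equations

end ScaledCoefficients

namespace ScaledCoefficients

section Derivatives

variable (h : ScaledCoefficients T I J f D K μ ν Q τ ξ A) (hT : IsOpenInterval T)
  (hadm : IsAdmissible I J f D K) (hD' : ∃ u ∈ J, deriv D u ≠ 0)
  (hK : ∀ u ∈ J, K u = k₁ * D u + k₀) {t₀ x₀ : ℝ} (ht₀ : t₀ ∈ T) (hx₀ : x₀ ∈ I)
  (hA : A t₀ x₀ = 0) (hAx : ∀ t ∈ T, ∀ x ∈ I, deriv (A t) x = 0)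

include h hT hadm hD' hK ht₀ hx₀ hA hAx

theorem A_eq_zero_of_deriv_x_eq_zero : ∀ t ∈ T, ∀ x ∈ I, A t x = 0 := fun t ht x hx =>
  (h.smooth_A.eq_of_derivs_eq_zero hT hadm.interval_x hAx (fun s hs y hy =>
    mul_left_cancel₀ (hadm.f_ne_zero y hy) <| by
      rw [(h.eq_A_of_linear_relation hadm hD' hK hs hy).2, hAx s hs y hy, mul_zero, mul_zero])
    ht ht₀ hx hx₀).trans hA

theorem eq_zero_of_derivs_x_eq_zero (h𝔤 : IsSymmetrySpace f D K (box T I J) 𝔤) (hQ : Q ∈ 𝔤)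
    (hτ : τ t₀ = 0) (hξ : ξ t₀ x₀ = 0) (hξx : ∀ t ∈ T, ∀ x ∈ I, deriv (ξ t) x = 0) : Q = 0 := by
  have hA₀ := h.A_eq_zero_of_deriv_x_eq_zero hT hadm hD' hK ht₀ hx₀ hA hAx
  refine h.eq_zero h𝔤 hT hadm hQ ht₀ hτ (fun t ht x hx => ?_) hA₀
  refine (h.smooth_ξ.eq_of_derivs_eq_zero hT hadm.interval_x hξx (fun s hs y hy =>
    mul_left_cancel₀ (hadm.f_ne_zero y hy) ?_) ht ht₀ hx hx₀).trans hξ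
  rw [(h.eq_ξ_of_linear_relation hadm hD' hK hs hy).2, hξx s hs y hy, hA₀ s hs y hy, sub_zero,
    mul_zero, mul_zero]

end Derivatives

end ScaledCoefficients

/-! ### The case `K = k₁ D` -/

namespace ScaledCoefficients

section Homogeneous

variable (h : ScaledCoefficients T I J f D K μ ν Q τ ξ A) (hadm : IsAdmissible I J f D K)
  (hD' : ∃ u ∈ J, deriv D u ≠ 0) (hK : ∀ u ∈ J, K u = k₁ * D u) {t₀ x₀ : ℝ} (ht₀ : t₀ ∈ T)
  (hx₀ : x₀ ∈ I)

include h hadm hD' hK ht₀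

theorem eq_of_homogeneous (hT : IsOpenInterval T) :
    ∀ t ∈ T, ∀ x ∈ I, ξ t x = ξ t₀ x ∧ A t x = A t₀ x := by
  intro t ht x hx
  have hK₀ : ∀ u ∈ J, K u = k₁ * D u + 0 := fun u hu => (hK u hu).trans (add_zero _).symm
  have hf := hadm.f_ne_zero x hx
  refine ⟨h.smooth_ξ.eq_of_deriv_t_eq_zero hT hx (fun s hs => ?_) ht₀ ht,
    h.smooth_A.eq_of_deriv_t_eq_zero hT hx (fun s hs => ?_) ht₀ ht⟩
  · simpa [hf] using (h.eq_ξ_of_linear_relation hadm hD' hK₀ hs hx).2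
  · simpa [hf] using (h.eq_A_of_linear_relation hadm hD' hK₀ hs hx).2

include hx₀

theorem A_eq_of_homogeneous (hA : A t₀ x₀ = 0) :
    ∀ x ∈ I, A t₀ x = deriv (A t₀) x₀ * expInt (-k₁) (x - x₀) := by
  intro x hx
  have hI := hadm.interval_x
  have hAx := hI.eq_add_mul_expInt (fun y hy => h.smooth_A.hasDerivAt_x hI.1 ht₀ hy)
    (fun y hy => (h.eq_A_of_linear_relation hadm hD' (k₀ := 0) (by simpa using hK) ht₀ hy).1 ▸
      h.smooth_A.hasDerivAt_deriv_x hI.1 ht₀ hy) hx₀ hx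
  rw [hAx, hA, zero_add]

theorem deriv_ξ_eq_of_homogeneous (hξ : ξ t₀ x₀ = 0) (hA : A t₀ x₀ = 0) :
    ∀ x ∈ I, deriv (ξ t₀) x = k₁ * ξ t₀ x
      + 2 * (μ + 1) * deriv (A t₀) x₀ * expInt (-k₁) (x - x₀) + deriv (ξ t₀) x₀ := by
  intro x hx
  have hI := hadm.interval_x
  have hderiv : ∀ y ∈ I, HasDerivAt
      (fun y => deriv (ξ t₀) y - k₁ * ξ t₀ y - 2 * (μ + 1) * A t₀ y) 0 y := fun y hy => by
    refine (((h.smooth_ξ.hasDerivAt_deriv_x hI.1 ht₀ hy).sub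
      ((h.smooth_ξ.hasDerivAt_x hI.1 ht₀ hy).const_mul k₁)).sub
      ((h.smooth_A.hasDerivAt_x hI.1 ht₀ hy).const_mul (2 * (μ + 1)))).congr_deriv ?_
    rw [(h.eq_ξ_of_linear_relation hadm hD' (k₀ := 0) (by simpa using hK) ht₀ hy).1]
    ring
  have hconst := hI.eq_of_hasDerivAt_zero hderiv hx hx₀
  simp only [hξ, hA, h.A_eq_of_homogeneous hadm hD' hK ht₀ hx₀ hA x hx] at hconst
  linear_combination hconst

theorem ξ_mul_exp_eq_of_homogeneous (hξ : ξ t₀ x₀ = 0) (hA : A t₀ x₀ = 0) :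
    ∀ x ∈ I, ξ t₀ x * Real.exp (-k₁ * (x - x₀)) = expInt (-k₁) (x - x₀) *
      ((μ + 1) * deriv (A t₀) x₀ * expInt (-k₁) (x - x₀) + deriv (ξ t₀) x₀) := by
  intro x hx
  have hI := hadm.interval_x
  set a₁ := deriv (A t₀) x₀
  set b := deriv (ξ t₀) x₀
  have hX := hasDerivAt_expInt_sub (-k₁) x₀
  have hderiv : ∀ y ∈ I, HasDerivAt (fun y => ξ t₀ y * Real.exp (-k₁ * (y - x₀))
      - expInt (-k₁) (y - x₀) * ((μ + 1) * a₁ * expInt (-k₁) (y - x₀) + b)) 0 y := fun y hy => by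
    refine (((h.smooth_ξ.hasDerivAt_x hI.1 ht₀ hy).mul
      (((hasDerivAt_id' y).sub_const x₀).const_mul (-k₁)).exp).sub
      ((hX y).mul (((hX y).const_mul ((μ + 1) * a₁)).add_const b))).congr_deriv ?_
    rw [h.deriv_ξ_eq_of_homogeneous hadm hD' hK ht₀ hx₀ hξ hA y hy]
    ring
  have hconst := hI.eq_of_hasDerivAt_zero hderiv hx hx₀
  simp only [hξ, sub_self, expInt_zero, zero_mul] at hconst
  linear_combination hconst

theorem eq_zero_of_homogeneous (h𝔤 : IsSymmetrySpace f D K (box T I J) 𝔤) (hT : IsOpenInterval T)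
    (hQ : Q ∈ 𝔤) (hτ : τ t₀ = 0) (hξ : ξ t₀ x₀ = 0) (hA : A t₀ x₀ = 0)
    (hξx : deriv (ξ t₀) x₀ = 0) (hAx : deriv (A t₀) x₀ = 0) : Q = 0 := by
  refine h.eq_zero h𝔤 hT hadm hQ ht₀ hτ (fun t ht x hx => ?_) fun t ht x hx => ?_
  · have hξexp := h.ξ_mul_exp_eq_of_homogeneous hadm hD' hK ht₀ hx₀ hξ hA x hx
    rw [hξx, hAx, mul_zero, zero_mul, zero_add, mul_zero] at hξexp
    rw [(h.eq_of_homogeneous hadm hD' hK ht₀ hT t ht x hx).1]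
    exact (mul_eq_zero.1 hξexp).resolve_right (Real.exp_ne_zero _)
  · rw [(h.eq_of_homogeneous hadm hD' hK ht₀ hT t ht x hx).2,
      h.A_eq_of_homogeneous hadm hD' hK ht₀ hx₀ hA x hx, hAx, zero_mul]

theorem eq_f_of_homogeneous (hξ : ξ t₀ x₀ = 0) (hA : A t₀ x₀ = 0) :
    ∀ x ∈ I, ((μ + 1) * deriv (A t₀) x₀ * expInt (-k₁) (x - x₀) + deriv (ξ t₀) x₀) *
      (deriv f x + 2 * k₁ * f x)
      = -(4 * μ + 3) * deriv (A t₀) x₀ * Real.exp (-k₁ * (x - x₀)) * f x := by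
  have hI := hadm.interval_x
  set a₁ := deriv (A t₀) x₀ with ha₁
  set b := deriv (ξ t₀) x₀ with hb
  have hτ : deriv τ t₀ = 2 * b := mul_left_cancel₀ (hadm.f_ne_zero x₀ hx₀) <| by
    linear_combination -h.eq_uxx t₀ ht₀ x₀ hx₀ + deriv f x₀ * hξ - f x₀ * hA
  have hf := hadm.smooth_f.continuousOn
  have hf' := (contDiffOn_deriv_of_isOpen hI.1 hadm.smooth_f).continuousOn
  refine fun x hx => sub_eq_zero.1 (eq_zero_of_forall_ne_eq_zero hI.1
    (g := fun x => ((μ + 1) * a₁ * expInt (-k₁) (x - x₀) + b) * (deriv f x + 2 * k₁ * f x)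
      - -(4 * μ + 3) * a₁ * Real.exp (-k₁ * (x - x₀)) * f x) (by fun_prop) x₀
    (fun y hy hyx₀ => ?_) x hx)
  refine mul_left_cancel₀ (mt expInt_eq_zero_iff.1 (sub_ne_zero.2 hyx₀) :
    expInt (-k₁) (y - x₀) ≠ 0) ?_
  have heq := h.eq_uxx t₀ ht₀ y hy
  rw [hτ, h.deriv_ξ_eq_of_homogeneous hadm hD' hK ht₀ hx₀ hξ hA y hy,
    h.A_eq_of_homogeneous hadm hD' hK ht₀ hx₀ hA y hy, ← ha₁, ← hb] at heq
  linear_combination Real.exp (-k₁ * (y - x₀)) * heq - (deriv f y + 2 * k₁ * f y) *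
    h.ξ_mul_exp_eq_of_homogeneous hadm hD' hK ht₀ hx₀ hξ hA y hy

end Homogeneous

end ScaledCoefficients

theorem IsSymmetrySpace.exists_eta_ne_zero (h𝔤 : IsSymmetrySpace f D K (box T I J) 𝔤)
    (hdim : 3 < Module.rank ℝ 𝔤) (hT : IsOpenInterval T) (hadm : IsAdmissible I J f D K)
    (hD' : ∃ u ∈ J, deriv D u ≠ 0) (hK : ∀ u ∈ J, K u = k₁ * D u) :
    ∃ Q ∈ 𝔤, ∃ p ∈ box T I J, (Q p).2.2 ≠ 0 := by
  by_contra! hη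
  obtain ⟨t₀, ht₀⟩ := hT.2.2
  obtain ⟨x₀, hx₀⟩ := hadm.interval_x.2.2
  obtain ⟨u₀, hu₀⟩ := hadm.interval_u.2.2
  obtain ⟨x₁, hx₁, hne⟩ := hadm.interval_x.exists_ne x₀
  obtain ⟨Q, hQ, hQ₀, hvanish⟩ := exists_mem_ne_zero_eq_zero_of_lt_rank (n := 3)
    (by exact_mod_cast hdim) ![evalT (t₀, x₀, u₀), evalX (t₀, x₀, u₀), evalX (t₀, x₁, u₀)]
  obtain ⟨τ, ξ, a, b, hc⟩ := h𝔤.exists_symmetryCoefficients hT.1 hadm hQ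
  have hs := hc.scaledCoefficients_of_eta_eq_zero hT.1 hadm (hη Q hQ)
  have hτ : τ t₀ = 0 := by
    simpa [evalT, hs.eq t₀ ht₀ x₀ hx₀ u₀ hu₀] using hvanish 0
  have hξ₀ : ξ t₀ x₀ = 0 := by
    simpa [evalX, hs.eq t₀ ht₀ x₀ hx₀ u₀ hu₀] using hvanish 1
  have hξ₁ : ξ t₀ x₁ = 0 := by
    simpa [evalX, hs.eq t₀ ht₀ x₁ hx₁ u₀ hu₀] using hvanish 2
  have hξx : deriv (ξ t₀) x₀ = 0 := by
    simpa [hξ₁, expInt_eq_zero_iff, sub_eq_zero, hne] using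
      hs.ξ_mul_exp_eq_of_homogeneous hadm hD' hK ht₀ hx₀ hξ₀ rfl x₁ hx₁
  exact hQ₀ (hs.eq_zero_of_homogeneous hadm hD' hK ht₀ hx₀ h𝔤 hT hQ hτ hξ₀ rfl hξx
    (deriv_const _ _))

theorem eq_zero_of_exp_relation_of_root (hadm : IsAdmissible I J f D K) {a₁ b x₀ : ℝ}
    (hab : a₁ ≠ 0 ∨ b ≠ 0)
    (hf : ∀ x ∈ I, ((μ + 1) * a₁ * expInt (-k₁) (x - x₀) + b) * (deriv f x + 2 * k₁ * f x)
      = -(4 * μ + 3) * a₁ * Real.exp (-k₁ * (x - x₀)) * f x) {c : ℝ} (hc : c ∈ I)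
    (hroot : (μ + 1) * a₁ * expInt (-k₁) (c - x₀) + b = 0) :
    ∀ x ∈ I, deriv f x + 2 * k₁ * f x = 0 := by
  have hI := hadm.interval_x.1
  have ha₁ : a₁ ≠ 0 := by
    rintro rfl
    exact hab.elim (· rfl) (· (by simpa using hroot))
  have hμ : 4 * μ + 3 = 0 := by
    refine mul_right_cancel₀ (mul_ne_zero (mul_ne_zero ha₁ (Real.exp_ne_zero (-k₁ * (c - x₀))))
      (hadm.f_ne_zero c hc)) ?_
    linear_combination hf c hc - (deriv f c + 2 * k₁ * f c) * hroot
  have hμ₁ : μ + 1 ≠ 0 := by linarith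
  refine eq_zero_of_forall_ne_eq_zero hI ((contDiffOn_deriv_of_isOpen hI
    hadm.smooth_f).continuousOn.add (continuousOn_const.mul hadm.smooth_f.continuousOn)) c
    fun x hx hxc => ?_
  have hfx := hf x hx
  rw [hμ, neg_zero, zero_mul, zero_mul, zero_mul] at hfx
  refine (mul_eq_zero.1 hfx).resolve_left fun hx₀ => hxc ?_
  have hexp : expInt (-k₁) (x - x₀) = expInt (-k₁) (c - x₀) :=
    mul_left_cancel₀ (mul_ne_zero hμ₁ ha₁) (by linear_combination hx₀ - hroot)
  exact sub_left_injective ((strictMono_expInt (-k₁)).injective hexp)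

theorem isReducible_of_exp_relation (hT : IsOpenInterval T) (hadm : IsAdmissible I J f D K)
    (hD : ∀ u ∈ J, (μ * u + ν) * deriv D u = D u) (hK : ∀ u ∈ J, K u = k₁ * D u) {a₁ b x₀ : ℝ}
    (hx₀ : x₀ ∈ I) (hab : a₁ ≠ 0 ∨ b ≠ 0)
    (hf : ∀ x ∈ I, ((μ + 1) * a₁ * expInt (-k₁) (x - x₀) + b) * (deriv f x + 2 * k₁ * f x)
      = -(4 * μ + 3) * a₁ * Real.exp (-k₁ * (x - x₀)) * f x) :
    IsReducible T I J f D K := by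
  by_cases! hroot : ∃ c ∈ I, (μ + 1) * a₁ * expInt (-k₁) (c - x₀) + b = 0
  · obtain ⟨c, hc, hroot⟩ := hroot
    refine isReducible_of_linear (a := 0) hT hadm hD hK hx₀ (by simp) fun x hx => ?_
    rw [eq_zero_of_exp_relation_of_root hadm hab hf hc hroot x hx]
    ring
  · have hb : b ≠ 0 := by simpa using hroot x₀ hx₀
    have hne : ∀ x ∈ I, 1 + (μ + 1) * (a₁ / b) * expInt (-k₁) (x - x₀) ≠ 0 := fun x hx h₀ =>
      hroot x hx (by field_simp at h₀; linear_combination h₀)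
    refine isReducible_of_linear (a := a₁ / b) hT hadm hD hK hx₀ (fun x hx => ?_) fun x hx => ?_
    · simpa using mul_pos_of_continuousOn_of_ne_zero hadm.interval_x.isPreconnected
        (by fun_prop) hne hx hx₀
    · have hfx := hf x hx
      generalize Real.exp (-k₁ * (x - x₀)) = z at hfx ⊢
      field_simp
      linear_combination hfx

theorem IsSymmetrySpace.isReducible_of_homogeneous (h𝔤 : IsSymmetrySpace f D K (box T I J) 𝔤)
    (hdim : 3 < Module.rank ℝ 𝔤) (hT : IsOpenInterval T) (hadm : IsAdmissible I J f D K)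
    (hD' : ∃ u ∈ J, deriv D u ≠ 0) (hK : ∀ u ∈ J, K u = k₁ * D u) : IsReducible T I J f D K := by
  obtain ⟨μ, ν, hD, h⟩ | ⟨hη, -⟩ := h𝔤.hasScaledCoefficients hT.1 hadm hD'
  · obtain ⟨t₀, ht₀⟩ := hT.2.2
    obtain ⟨x₀, hx₀⟩ := hadm.interval_x.2.2
    obtain ⟨Q, hQ, hQ₀, τ, ξ, A, hs, hτ, hξ, hA⟩ :=
      h.exists_eq_zero hadm.interval_u.2.2 hdim ht₀ hx₀
    refine isReducible_of_exp_relation hT hadm hD hK hx₀ ?_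
      (hs.eq_f_of_homogeneous hadm hD' hK ht₀ hx₀ hξ hA)
    by_contra! hzero
    exact hQ₀ (hs.eq_zero_of_homogeneous hadm hD' hK ht₀ hx₀ h𝔤 hT hQ hτ hξ hA hzero.2 hzero.1)
  · obtain ⟨Q, hQ, p, hp, hne⟩ := h𝔤.exists_eta_ne_zero hdim hT hadm hD' hK
    exact absurd (hη Q hQ p hp) hne

end LinearRelation

theorem SmoothOn₂.exists_eq_mul_add_of_deriv_x {T I : Set ℝ} {g : ℝ → ℝ → ℝ}
    (hg : SmoothOn₂ T I g) (hT : IsOpen T) (hI : IsOpenInterval I) {φ φ' c : ℝ → ℝ}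
    (hφ : ∀ x ∈ I, HasDerivAt φ (φ' x) x) (hc : ∀ t ∈ T, DifferentiableAt ℝ c t)
    (hgx : ∀ t ∈ T, ∀ x ∈ I, deriv (g t) x = c t * φ' x) :
    ∃ c₀ : ℝ → ℝ, ∀ t ∈ T, ∀ x ∈ I, g t x = c t * φ x + c₀ t ∧
      deriv (fun s => g s x) t = deriv c t * φ x + deriv c₀ t := by
  obtain ⟨x₀, hx₀⟩ := hI.2.2
  have hconst : ∀ t ∈ T, ∀ x ∈ I, g t x = c t * φ x + (g t x₀ - c t * φ x₀) := fun t ht x hx => by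
    have hderiv : ∀ y ∈ I, HasDerivAt (fun y => g t y - c t * φ y) 0 y := fun y hy =>
      ((hg.hasDerivAt_x hI.1 ht hy).sub ((hφ y hy).const_mul (c t))).congr_deriv
        (sub_eq_zero.2 (hgx t ht y hy))
    linear_combination hI.eq_of_hasDerivAt_zero hderiv hx hx₀
  have hc₀ : ∀ t ∈ T, DifferentiableAt ℝ (fun t => g t x₀ - c t * φ x₀) t := fun t ht =>
    (hg.hasDerivAt_t hT ht hx₀).differentiableAt.sub ((hc t ht).mul_const (φ x₀))
  refine ⟨fun t => g t x₀ - c t * φ x₀, fun t ht x hx => ⟨hconst t ht x hx, ?_⟩⟩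
  exact (Set.EqOn.deriv (fun s hs => hconst s hs x hx) hT ht).trans
    (((hc t ht).hasDerivAt.mul_const (φ x)).add (hc₀ t ht).hasDerivAt).deriv

theorem SmoothOn₂.exists_eq_mul_exp_add {T I : Set ℝ} {g : ℝ → ℝ → ℝ} (hg : SmoothOn₂ T I g)
    (hT : IsOpen T) (hI : IsOpenInterval I) {m : ℝ} (hm : m ≠ 0)
    (hgxx : ∀ t ∈ T, ∀ x ∈ I, HasDerivAt (deriv (g t)) (m * deriv (g t) x) x) :
    ∃ c₁ c₀ : ℝ → ℝ, ∀ t ∈ T, ∀ x ∈ I, g t x = c₁ t * Real.exp (m * x) + c₀ t ∧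
      deriv (g t) x = m * c₁ t * Real.exp (m * x) ∧
      deriv (fun s => g s x) t = deriv c₁ t * Real.exp (m * x) + deriv c₀ t := by
  obtain ⟨x₀, hx₀⟩ := hI.2.2
  set c₁ : ℝ → ℝ := fun t => deriv (g t) x₀ * Real.exp (-m * x₀) / m with hc₁
  have hgx : ∀ t ∈ T, ∀ x ∈ I, deriv (g t) x = c₁ t * (m * Real.exp (m * x)) := by
    intro t ht x hx
    rw [hI.eq_mul_exp (hgxx t ht) hx₀ hx, show m * (x - x₀) = -m * x₀ + m * x by ring,
      Real.exp_add]
    simp only [hc₁]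
    field_simp
  obtain ⟨c₀, hc₀⟩ := hg.exists_eq_mul_add_of_deriv_x hT hI
    (fun x _ => hasDerivAt_exp_const_mul m x)
    (fun t ht => ((hg.deriv_x hT hI.1).hasDerivAt_t hT ht hx₀).differentiableAt.mul_const
      (Real.exp (-m * x₀)) |>.div_const m) hgx
  exact ⟨c₁, c₀, fun t ht x hx =>
    ⟨(hc₀ t ht x hx).1, by rw [hgx t ht x hx]; ring, (hc₀ t ht x hx).2⟩⟩

/-! ### The case `K = k₁ D + k₀` with nonzero `k₁` and `k₀` -/

/-- Coefficients of the symmetry `τ ∂_t + ξ ∂_x + A (μ u + ν) ∂_u` of an equation with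
`K = k₁ D + k₀`, `k₁ ≠ 0`, in powers of `exp (-k₁ x)`: the functions `a₁, a₀` belong to `A` and
`b₁, b₀` to `k₁ ξ + (μ + 1) A`. The last three fields are the determining equations. -/
structure ExpCoefficients (T I : Set ℝ) (f : ℝ → ℝ) (μ k₁ k₀ : ℝ) (τ : ℝ → ℝ) (ξ A : ℝ → ℝ → ℝ)
    (a₁ a₀ b₁ b₀ : ℝ → ℝ) : Prop where
  A_eq : ∀ t ∈ T, ∀ x ∈ I, A t x = a₁ t * Real.exp (-k₁ * x) + a₀ t
  ξ_eq : ∀ t ∈ T, ∀ x ∈ I, k₁ * ξ t x + (μ + 1) * A t x = b₁ t * Real.exp (k₁ * x) + b₀ t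
  eq_A : ∀ t ∈ T, ∀ x ∈ I, f x * (deriv a₁ t * Real.exp (-k₁ * x) + deriv a₀ t)
    = -(k₀ * k₁ * a₁ t) * Real.exp (-k₁ * x)
  eq_ξ : ∀ t ∈ T, ∀ x ∈ I, f x * (deriv b₁ t + deriv b₀ t * Real.exp (-k₁ * x))
    = k₀ * k₁ * (-(2 * μ + 1) * a₁ t * Real.exp (-k₁ * x) ^ 2 + a₀ t * Real.exp (-k₁ * x) - b₁ t)
  eq_f : ∀ t ∈ T, ∀ x ∈ I, (b₁ t + (b₀ t - (μ + 1) * a₀ t) * Real.exp (-k₁ * x)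
      - (μ + 1) * a₁ t * Real.exp (-k₁ * x) ^ 2) * deriv f x
    = k₁ * f x * (-(2 * μ + 1) * a₁ t * Real.exp (-k₁ * x) ^ 2
      + (a₀ t + deriv τ t) * Real.exp (-k₁ * x) - 2 * b₁ t)

section ExpCoefficients

variable {T I J : Set ℝ} {f D K : ℝ → ℝ} {μ ν k₁ k₀ : ℝ}
  {𝔤 : Submodule ℝ (PointSpace → PointSpace)} {Q : PointSpace → PointSpace} {τ : ℝ → ℝ}
  {ξ A : ℝ → ℝ → ℝ} {a₁ a₀ b₁ b₀ : ℝ → ℝ}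

namespace ScaledCoefficients

section Structure

variable (h : ScaledCoefficients T I J f D K μ ν Q τ ξ A) (hT : IsOpen T)
  (hadm : IsAdmissible I J f D K) (hD' : ∃ u ∈ J, deriv D u ≠ 0)
  (hK : ∀ u ∈ J, K u = k₁ * D u + k₀) (hk₁ : k₁ ≠ 0)

include h hT hadm hD' hK hk₁

/-- The combination `k₁ ξ + (μ + 1) A` is chosen so that `A` drops out of the equation for the
second derivative of `ξ` in `x`. -/
theorem exists_ξ_eq_mul_exp_add : ∃ b₁ b₀ : ℝ → ℝ, ∀ t ∈ T, ∀ x ∈ I,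
    k₁ * ξ t x + (μ + 1) * A t x = b₁ t * Real.exp (k₁ * x) + b₀ t ∧
      k₁ * deriv (ξ t) x + (μ + 1) * deriv (A t) x = k₁ * b₁ t * Real.exp (k₁ * x) ∧
      k₁ * deriv (fun s => ξ s x) t + (μ + 1) * deriv (fun s => A s x) t
        = deriv b₁ t * Real.exp (k₁ * x) + deriv b₀ t := by
  have hI := hadm.interval_x
  set B : ℝ → ℝ → ℝ := fun t x => k₁ * ξ t x + (μ + 1) * A t x
  have hB : SmoothOn₂ T I B :=
    (contDiffOn_const.mul h.smooth_ξ).add (contDiffOn_const.mul h.smooth_A)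
  have hBx {t x : ℝ} (ht : t ∈ T) (hx : x ∈ I) :
      deriv (B t) x = k₁ * deriv (ξ t) x + (μ + 1) * deriv (A t) x :=
    (((h.smooth_ξ.hasDerivAt_x hI.1 ht hx).const_mul k₁).add
      ((h.smooth_A.hasDerivAt_x hI.1 ht hx).const_mul (μ + 1))).deriv
  have hBt {t x : ℝ} (ht : t ∈ T) (hx : x ∈ I) : deriv (fun s => B s x) t
      = k₁ * deriv (fun s => ξ s x) t + (μ + 1) * deriv (fun s => A s x) t :=
    (((h.smooth_ξ.hasDerivAt_t hT ht hx).const_mul k₁).add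
      ((h.smooth_A.hasDerivAt_t hT ht hx).const_mul (μ + 1))).deriv
  have hBxx : ∀ t ∈ T, ∀ x ∈ I, HasDerivAt (deriv (B t)) (k₁ * deriv (B t) x) x := by
    intro t ht x hx
    refine (hB.hasDerivAt_deriv_x hI.1 ht hx).congr_deriv <|
      (Set.EqOn.deriv (fun y hy => hBx ht hy) hI.1 hx).trans <|
      (((h.smooth_ξ.hasDerivAt_deriv_x hI.1 ht hx).const_mul k₁).add
        ((h.smooth_A.hasDerivAt_deriv_x hI.1 ht hx).const_mul (μ + 1))).deriv.trans ?_
    rw [(h.eq_ξ_of_linear_relation hadm hD' hK ht hx).1,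
      (h.eq_A_of_linear_relation hadm hD' hK ht hx).1, hBx ht hx]
    ring
  obtain ⟨b₁, b₀, hb⟩ := hB.exists_eq_mul_exp_add hT hI hk₁ hBxx
  exact ⟨b₁, b₀, fun t ht x hx => ⟨(hb t ht x hx).1, hBx ht hx ▸ (hb t ht x hx).2.1,
    hBt ht hx ▸ (hb t ht x hx).2.2⟩⟩

theorem exists_expCoefficients :
    ∃ a₁ a₀ b₁ b₀, ExpCoefficients T I f μ k₁ k₀ τ ξ A a₁ a₀ b₁ b₀ := by
  obtain ⟨a₁, a₀, hA⟩ := h.smooth_A.exists_eq_mul_exp_add hT hadm.interval_x (neg_ne_zero.2 hk₁)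
    fun t ht x hx => (h.smooth_A.hasDerivAt_deriv_x hadm.interval_x.1 ht hx).congr_deriv
      (h.eq_A_of_linear_relation hadm hD' hK ht hx).1
  obtain ⟨b₁, b₀, hξ⟩ := h.exists_ξ_eq_mul_exp_add hT hadm hD' hK hk₁
  have hexp (x : ℝ) : Real.exp (k₁ * x) * Real.exp (-k₁ * x) = 1 := by
    rw [← Real.exp_add, neg_mul, add_neg_cancel, Real.exp_zero]
  refine ⟨a₁, a₀, b₁, b₀, fun t ht x hx => (hA t ht x hx).1, fun t ht x hx => (hξ t ht x hx).1,
    fun t ht x hx => ?_, fun t ht x hx => ?_, fun t ht x hx => ?_⟩ <;>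
  obtain ⟨hA, hAx, hAt⟩ := hA t ht x hx <;>
  obtain ⟨hξ, hξx, hξt⟩ := hξ t ht x hx
  · rw [← hAt, (h.eq_A_of_linear_relation hadm hD' hK ht hx).2, hAx]
    ring
  · linear_combination Real.exp (-k₁ * x) *
      (k₁ * (h.eq_ξ_of_linear_relation hadm hD' hK ht hx).2
        + (μ + 1) * (h.eq_A_of_linear_relation hadm hD' hK ht hx).2
        - f x * hξt - k₀ * hξx + k₀ * k₁ * hA + 2 * k₀ * (μ + 1) * hAx)
      - (f x * deriv b₁ t + k₀ * k₁ * b₁ t) * hexp x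
  · linear_combination Real.exp (-k₁ * x) * (k₁ * h.eq_uxx t ht x hx
        - deriv f x * hξ - 2 * f x * hξx + (μ + 1) * deriv f x * hA
        + k₁ * f x * hA + 2 * (μ + 1) * f x * hAx)
      - (b₁ t * deriv f x + 2 * k₁ * f x * b₁ t) * hexp x

end Structure

end ScaledCoefficients

theorem IsOpenInterval.infinite_image_exp (hI : IsOpenInterval I) {m : ℝ} (hm : m ≠ 0) :
    ((fun x => Real.exp (m * x)) '' I).Infinite :=
  hI.infinite.image (Real.exp_injective.comp (mul_right_injective₀ hm)).injOn

namespace ExpCoefficients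

variable (h : ExpCoefficients T I f μ k₁ k₀ τ ξ A a₁ a₀ b₁ b₀)

include h

theorem exists_mul_eq_exp (hI : IsOpen I) (hk₁ : k₁ ≠ 0) (hk₀ : k₀ ≠ 0)
    (hf : ∃ x ∈ I, deriv f x ≠ 0) {t : ℝ} (ht : t ∈ T) (ha : a₁ t ≠ 0) :
    ∃ γ δ, γ ≠ 0 ∧ γ * (k₀ * k₁ * a₁ t) = -deriv a₀ t ∧
      ∀ x ∈ I, f x * (γ + δ * Real.exp (-k₁ * x)) = Real.exp (-k₁ * x) := by
  have hfz : ∀ x ∈ I, f x * (-deriv a₀ t / (k₀ * k₁ * a₁ t)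
      + -deriv a₁ t / (k₀ * k₁ * a₁ t) * Real.exp (-k₁ * x)) = Real.exp (-k₁ * x) := by
    intro x hx
    have heq := h.eq_A t ht x hx
    generalize Real.exp (-k₁ * x) = z at heq ⊢
    field_simp
    linear_combination -heq
  refine ⟨_, _, fun hγ => ?_,
    div_mul_cancel₀ _ (mul_ne_zero (mul_ne_zero hk₀ hk₁) ha), hfz⟩
  rw [hγ] at hfz
  have hfδ : ∀ x ∈ I, f x = 1 / (-deriv a₁ t / (k₀ * k₁ * a₁ t)) := fun x hx =>
    eq_one_div_of_mul_eq_one_left <|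
      mul_right_cancel₀ (Real.exp_ne_zero (-k₁ * x)) (by linear_combination hfz x hx)
  obtain ⟨x, hx, hne⟩ := hf
  exact hne ((Set.EqOn.deriv hfδ hI hx).trans (deriv_const _ _))

theorem a₁_eq_zero (hT : IsOpen T) (hI : IsOpenInterval I) (hk₁ : k₁ ≠ 0) (hk₀ : k₀ ≠ 0)
    (hf : ∃ x ∈ I, deriv f x ≠ 0) {t : ℝ} (ht : t ∈ T) : a₁ t = 0 := by
  by_contra ha
  obtain ⟨γ, δ, hγ₀, hγ, hfz⟩ := h.exists_mul_eq_exp hI.1 hk₁ hk₀ hf ht ha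
  have hpoly : ∀ s ∈ T, k₀ * k₁ * (γ * b₁ s) = 0 ∧
      deriv b₁ s + k₀ * k₁ * (δ * b₁ s - γ * a₀ s) = 0 := by
    intro s hs
    obtain ⟨hone, hz, -, -⟩ := cubic_coeffs_eq_zero
      (hI.infinite_image_exp (neg_ne_zero.2 hk₁)) (a := k₀ * k₁ * (γ * b₁ s))
      (b := deriv b₁ s + k₀ * k₁ * (δ * b₁ s - γ * a₀ s))
      (c := deriv b₀ s + k₀ * k₁ * (γ * (2 * μ + 1) * a₁ s - δ * a₀ s))
      (d := k₀ * k₁ * δ * (2 * μ + 1) * a₁ s) <| by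
        rintro _ ⟨x, hx, rfl⟩
        linear_combination (γ + δ * Real.exp (-k₁ * x)) * h.eq_ξ s hs x hx
          - (deriv b₁ s + deriv b₀ s * Real.exp (-k₁ * x)) * hfz x hx
    exact ⟨hone, hz⟩
  have hb₁ : ∀ s ∈ T, b₁ s = 0 := fun s hs => by simpa [hγ₀, hk₀, hk₁] using (hpoly s hs).1
  have ha₀ : ∀ s ∈ T, a₀ s = 0 := fun s hs => by
    simpa [hb₁ s hs, (Set.EqOn.deriv hb₁ hT hs).trans (deriv_const _ _), hγ₀, hk₀, hk₁]
      using (hpoly s hs).2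
  refine mul_ne_zero hγ₀ (mul_ne_zero (mul_ne_zero hk₀ hk₁) ha) ?_
  rw [hγ, (Set.EqOn.deriv ha₀ hT ht).trans (deriv_const _ _), neg_zero]

end ExpCoefficients

theorem deriv_mul_eq_of_mul_eq_exp {m α β β₁ β₀ c : ℝ} (hI : IsOpen I)
    (hf : DifferentiableOn ℝ f I)
    (hfz : ∀ x ∈ I, f x * (β₁ + β₀ * Real.exp (m * x)) = c * (α * Real.exp (m * x) - β)) :
    ∀ x ∈ I, deriv f x * (β₁ + β₀ * Real.exp (m * x))
      = m * Real.exp (m * x) * (c * α - β₀ * f x) := by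
  intro x hx
  have hexp := hasDerivAt_exp_const_mul m x
  have hleft := (hf.differentiableAt (hI.mem_nhds hx)).hasDerivAt.mul
    ((hexp.const_mul β₀).const_add β₁)
  have hright := ((hexp.const_mul α).sub_const β).const_mul c
  linear_combination hleft.deriv.symm.trans ((Set.EqOn.deriv hfz hI hx).trans hright.deriv)

/-- With `z = exp (-k₁ x)`, the first relation determines `f` as a fractional linear function of `z`
and turns the second one into a polynomial identity in `z`. -/
theorem eq_zero_of_exp_relations (hI : IsOpenInterval I) (hf : DifferentiableOn ℝ f I)
    (hk₁ : k₁ ≠ 0) {α β β₁ β₀ b s c : ℝ} (hc : c ≠ 0)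
    (hfz : ∀ x ∈ I, f x * (β₁ + β₀ * Real.exp (-k₁ * x)) = c * (α * Real.exp (-k₁ * x) - β))
    (hf' : ∀ x ∈ I, (β + b * Real.exp (-k₁ * x)) * deriv f x
      = k₁ * f x * (s * Real.exp (-k₁ * x) - 2 * β)) : β = 0 := by
  by_contra hβ
  have hinf := hI.infinite_image_exp (neg_ne_zero.2 hk₁)
  obtain ⟨hone, hz, -, -⟩ := cubic_coeffs_eq_zero hinf
    (a := 2 * β ^ 2 * β₁)
    (b := β * (β₀ * β + α * β₁) - β * β₁ * s - 2 * β * (α * β₁ - β * β₀))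
    (c := b * (β₀ * β + α * β₁) + s * (α * β₁ - β * β₀) - 2 * β * (α * β₀))
    (d := α * β₀ * s) <| by
      rintro _ ⟨x, hx, rfl⟩
      have hderiv := deriv_mul_eq_of_mul_eq_exp hI.1 hf hfz x hx
      have hfzx := hfz x hx
      have hf'x := hf' x hx
      refine mul_left_cancel₀ (mul_ne_zero hc hk₁) ?_
      beta_reduce
      generalize Real.exp (-k₁ * x) = z at hderiv hfzx hf'x ⊢
      linear_combination -(β₁ + β₀ * z) ^ 2 * hf'x + (β + b * z) * (β₁ + β₀ * z) * hderiv
        + (β + b * z) * k₁ * z * β₀ * hfzx - k₁ * (β₁ + β₀ * z) * (s * z - 2 * β) * hfzx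
  have hβ₁ : β₁ = 0 := by simpa [hβ] using hone
  have hβ₀ : β₀ = 0 := by
    have : 3 * β ^ 2 * β₀ = 0 := by
      rw [hβ₁] at hz
      linear_combination hz
    simpa [hβ] using this
  obtain ⟨hβ', -⟩ := affine_coeffs_eq_zero hinf (a := -(c * β)) (b := c * α) <| by
    rintro _ ⟨x, hx, rfl⟩
    have heq := hfz x hx
    rw [hβ₁, hβ₀] at heq
    linear_combination -heq
  exact mul_ne_zero hc hβ (neg_eq_zero.1 hβ')

theorem ExpCoefficients.b₁_eq_zero (h : ExpCoefficients T I f μ k₁ k₀ τ ξ A a₁ a₀ b₁ b₀)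
    (hI : IsOpenInterval I) (hf : DifferentiableOn ℝ f I) (hk₁ : k₁ ≠ 0) (hk₀ : k₀ ≠ 0) {t : ℝ}
    (ht : t ∈ T) (ha₁ : a₁ t = 0) : b₁ t = 0 :=
  eq_zero_of_exp_relations hI hf hk₁ (mul_ne_zero hk₀ hk₁) (α := a₀ t) (β₁ := deriv b₁ t)
    (β₀ := deriv b₀ t) (b := b₀ t - (μ + 1) * a₀ t) (s := a₀ t + deriv τ t)
    (fun x hx => by linear_combination h.eq_ξ t ht x hx
      - k₀ * k₁ * (2 * μ + 1) * Real.exp (-k₁ * x) ^ 2 * ha₁)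
    (fun x hx => by linear_combination h.eq_f t ht x hx
      + ((μ + 1) * deriv f x - k₁ * f x * (2 * μ + 1)) * Real.exp (-k₁ * x) ^ 2 * ha₁)

theorem HasScaledCoefficients.deriv_f_eq_zero_of_mul_ne_zero
    (h : HasScaledCoefficients T I J f D K μ ν 𝔤) (h𝔤 : IsSymmetrySpace f D K (box T I J) 𝔤)
    (hdim : 3 < Module.rank ℝ 𝔤) (hT : IsOpenInterval T) (hadm : IsAdmissible I J f D K)
    (hD' : ∃ u ∈ J, deriv D u ≠ 0) (hK : ∀ u ∈ J, K u = k₁ * D u + k₀) (hk₁ : k₁ ≠ 0)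
    (hk₀ : k₀ ≠ 0) : ∀ x ∈ I, deriv f x = 0 := by
  by_contra! hf'
  have hI := hadm.interval_x
  obtain ⟨t₀, ht₀⟩ := hT.2.2
  obtain ⟨x₀, hx₀⟩ := hI.2.2
  obtain ⟨Q, hQ, hQ₀, τ, ξ, A, hs, hτ, hξ, hA⟩ := h.exists_eq_zero hadm.interval_u.2.2 hdim ht₀ hx₀
  obtain ⟨a₁, a₀, b₁, b₀, hc⟩ := hs.exists_expCoefficients hT.1 hadm hD' hK hk₁
  have ha₁ : ∀ t ∈ T, a₁ t = 0 := fun t => hc.a₁_eq_zero hT.1 hI hk₁ hk₀ hf'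
  have hb₁ : ∀ t ∈ T, b₁ t = 0 := fun t ht => hc.b₁_eq_zero hI
    (hadm.smooth_f.differentiableOn (by simp)) hk₁ hk₀ ht (ha₁ t ht)
  have hAx : ∀ t ∈ T, ∀ x ∈ I, A t x = a₀ t := fun t ht x hx => by
    rw [hc.A_eq t ht x hx, ha₁ t ht, zero_mul, zero_add]
  have hξx : ∀ t ∈ T, ∀ x ∈ I, ξ t x = (b₀ t - (μ + 1) * a₀ t) / k₁ := fun t ht x hx => by
    rw [eq_div_iff hk₁]
    linear_combination hc.ξ_eq t ht x hx - (μ + 1) * hAx t ht x hx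
      + Real.exp (k₁ * x) * hb₁ t ht
  exact hQ₀ <| hs.eq_zero_of_derivs_x_eq_zero hT hadm hD' hK ht₀ hx₀ hA
    (fun t ht x hx => (Set.EqOn.deriv (hAx t ht) hI.1 hx).trans (deriv_const _ _)) h𝔤 hQ hτ hξ
    (fun t ht x hx => (Set.EqOn.deriv (hξx t ht) hI.1 hx).trans (deriv_const _ _))

end ExpCoefficients

/-! ### The case of constant nonzero `K` -/

theorem SmoothOn₂.exists_eq_mul_add {T I : Set ℝ} {g : ℝ → ℝ → ℝ} (hg : SmoothOn₂ T I g)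
    (hT : IsOpen T) (hI : IsOpenInterval I)
    (hgxx : ∀ t ∈ T, ∀ x ∈ I, HasDerivAt (deriv (g t)) 0 x) :
    ∃ c₁ c₀ : ℝ → ℝ, (∀ t ∈ T, DifferentiableAt ℝ c₁ t) ∧ ∀ t ∈ T, ∀ x ∈ I,
      g t x = c₁ t * x + c₀ t ∧ deriv (g t) x = c₁ t ∧
        deriv (fun s => g s x) t = deriv c₁ t * x + deriv c₀ t := by
  obtain ⟨x₀, hx₀⟩ := hI.2.2
  have hc₁ : ∀ t ∈ T, DifferentiableAt ℝ (fun t => deriv (g t) x₀) t := fun t ht =>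
    ((hg.deriv_x hT hI.1).hasDerivAt_t hT ht hx₀).differentiableAt
  have hgx : ∀ t ∈ T, ∀ x ∈ I, deriv (g t) x = deriv (g t) x₀ := fun t ht x hx =>
    hI.eq_of_hasDerivAt_zero (hgxx t ht) hx hx₀
  obtain ⟨c₀, hc₀⟩ := hg.exists_eq_mul_add_of_deriv_x hT hI (fun x _ => hasDerivAt_id' x) hc₁
    (fun t ht x hx => (hgx t ht x hx).trans (mul_one _).symm)
  exact ⟨_, c₀, hc₁, fun t ht x hx => ⟨(hc₀ t ht x hx).1, hgx t ht x hx, (hc₀ t ht x hx).2⟩⟩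

section OneVariable

variable {T I : Set ℝ} {f : ℝ → ℝ}

theorem deriv_eq_neg_mul_sq_of_mul_affine_eq_const {a b c : ℝ} (hI : IsOpen I)
    (hf : DifferentiableOn ℝ f I) (hc : c ≠ 0) (h : ∀ x ∈ I, f x * (b * x + a) = c) :
    ∀ x ∈ I, deriv f x = -(b / c) * f x ^ 2 := by
  intro x hx
  have hderiv := ((hf.differentiableAt (hI.mem_nhds hx)).hasDerivAt.mul
    (((hasDerivAt_id' x).const_mul b).add_const a)).deriv.symm.trans
      ((Set.EqOn.deriv h hI hx).trans (deriv_const x c))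
  field_simp
  linear_combination f x * hderiv - deriv f x * h x hx

theorem div_ne_zero_of_mul_affine_eq_const {a b c : ℝ} (hI : IsOpen I)
    (hf : DifferentiableOn ℝ f I) (hc : c ≠ 0) (hf' : ∃ x ∈ I, deriv f x ≠ 0)
    (h : ∀ x ∈ I, f x * (b * x + a) = c) : b / c ≠ 0 := by
  obtain ⟨x, hx, hne⟩ := hf'
  intro hbc
  exact hne <| by
    rw [deriv_eq_neg_mul_sq_of_mul_affine_eq_const hI hf hc h x hx, hbc, neg_zero, zero_mul]

/-- If `b₁ t₁ ≠ 0`, the first relation at `t₁` makes `1 / f` affine; comparing coefficients of `x`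
in both relations then gives a homogeneous linear equation for `b₁` and `b₁ t₀ = 0`. -/
theorem eq_zero_of_affine_relations {b₁ b₀ c : ℝ → ℝ} {k₀ t₀ x₀ : ℝ} (hT : IsOpenInterval T)
    (hI : IsOpenInterval I) (hf : DifferentiableOn ℝ f I) (hf' : ∃ x ∈ I, deriv f x ≠ 0)
    (hk₀ : k₀ ≠ 0) (hb₁ : ∀ t ∈ T, DifferentiableAt ℝ b₁ t)
    (hfb : ∀ t ∈ T, ∀ x ∈ I, f x * (deriv b₁ t * x + deriv b₀ t) = -k₀ * b₁ t)
    (hf'b : ∀ t ∈ T, ∀ x ∈ I, (b₁ t * x + b₀ t) * deriv f x = f x * (c t - 2 * b₁ t))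
    (ht₀ : t₀ ∈ T) (hx₀ : x₀ ∈ I) (hroot : b₁ t₀ * x₀ + b₀ t₀ = 0) : ∀ t ∈ T, b₁ t = 0 := by
  by_contra! hne
  obtain ⟨t₁, ht₁, hb₁t₁⟩ := hne
  have hk : -k₀ * b₁ t₁ ≠ 0 := mul_ne_zero (neg_ne_zero.2 hk₀) hb₁t₁
  set δ := deriv b₁ t₁ / (-k₀ * b₁ t₁)
  set γ := deriv b₀ t₁ / (-k₀ * b₁ t₁)
  have hδ : δ ≠ 0 := div_ne_zero_of_mul_affine_eq_const hI.1 hf hk hf' (hfb t₁ ht₁)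
  have hfδ : ∀ x ∈ I, f x * (δ * x + γ) = 1 := fun x hx => by
    rw [div_mul_eq_mul_div, ← add_div, mul_div_assoc', hfb t₁ ht₁ x hx, div_self hk]
  have hderiv : ∀ t ∈ T, deriv b₁ t = -k₀ * δ * b₁ t := fun t ht => by
    obtain ⟨-, hlin⟩ := affine_coeffs_eq_zero hI.infinite (a := deriv b₀ t + k₀ * γ * b₁ t)
      (b := deriv b₁ t + k₀ * δ * b₁ t) fun x hx => by
        linear_combination (δ * x + γ) * hfb t ht x hx
          - (deriv b₁ t * x + deriv b₀ t) * hfδ x hx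
    linear_combination hlin
  have hγ : δ * b₀ t₀ = γ * b₁ t₀ := by
    obtain ⟨hone, hlin⟩ := affine_coeffs_eq_zero hI.infinite
      (a := δ * b₀ t₀ + (c t₀ - 2 * b₁ t₀) * γ) (b := δ * (b₁ t₀ + (c t₀ - 2 * b₁ t₀)))
      fun x hx => by
        have hf'x := hf'b t₀ ht₀ x hx
        rw [deriv_eq_neg_mul_sq_of_mul_affine_eq_const hI.1 hf hk (hfb t₁ ht₁) x hx] at hf'x
        linear_combination -(δ * x + γ) ^ 2 * hf'x - ((b₁ t₀ * x + b₀ t₀) * δ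
          * (f x * (δ * x + γ) + 1) + (δ * x + γ) * (c t₀ - 2 * b₁ t₀)) * hfδ x hx
    linear_combination hone - γ * (mul_eq_zero.1 hlin).resolve_left hδ
  have hb₁t₀ : b₁ t₀ = 0 := by
    linear_combination -b₁ t₀ * hfδ x₀ hx₀ + f x₀ * (δ * hroot - hγ)
  refine hb₁t₁ ?_
  rw [hT.eq_mul_exp (g := b₁) (m := -k₀ * δ) (fun t ht => hderiv t ht ▸ (hb₁ t ht).hasDerivAt)
    ht₀ ht₁, hb₁t₀, zero_mul]

end OneVariable

/-- Coefficients of the symmetry `τ ∂_t + ξ ∂_x + A (μ u + ν) ∂_u` of an equation with constant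
`K = k₀` in powers of `x`: the functions `a₁, a₀` belong to `A` and `b₁, b₀` to
`ξ - (μ + 1) x A`. The last two fields are determining equations. -/
structure AffineCoefficients (T I : Set ℝ) (f : ℝ → ℝ) (μ k₀ : ℝ) (ξ A : ℝ → ℝ → ℝ)
    (a₁ a₀ b₁ b₀ : ℝ → ℝ) : Prop where
  differentiableAt_b₁ : ∀ t ∈ T, DifferentiableAt ℝ b₁ t
  A_eq : ∀ t ∈ T, ∀ x ∈ I, A t x = a₁ t * x + a₀ t
  ξ_eq : ∀ t ∈ T, ∀ x ∈ I, ξ t x - (μ + 1) * (x * A t x) = b₁ t * x + b₀ t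
  eq_A : ∀ t ∈ T, ∀ x ∈ I, f x * (deriv a₁ t * x + deriv a₀ t) = k₀ * a₁ t
  eq_ξ : ∀ t ∈ T, ∀ x ∈ I, f x * (deriv b₁ t * x + deriv b₀ t)
    = -k₀ * ((3 * μ + 2) * a₁ t * x + μ * a₀ t + b₁ t)

section AffineCoefficients

variable {T I J : Set ℝ} {f D K : ℝ → ℝ} {μ ν k₀ : ℝ}
  {𝔤 : Submodule ℝ (PointSpace → PointSpace)} {Q : PointSpace → PointSpace} {τ : ℝ → ℝ}
  {ξ A : ℝ → ℝ → ℝ} {a₁ a₀ b₁ b₀ : ℝ → ℝ}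

namespace ScaledCoefficients

section Structure

variable (h : ScaledCoefficients T I J f D K μ ν Q τ ξ A) (hT : IsOpen T)
  (hadm : IsAdmissible I J f D K) (hD' : ∃ u ∈ J, deriv D u ≠ 0) (hK : ∀ u ∈ J, K u = k₀)

include h hT hadm hD' hK

/-- The combination `ξ - (μ + 1) x A` is chosen so that its second derivative in `x` vanishes. -/
theorem exists_ξ_eq_mul_add : ∃ b₁ b₀ : ℝ → ℝ, (∀ t ∈ T, DifferentiableAt ℝ b₁ t) ∧
    ∀ t ∈ T, ∀ x ∈ I, ξ t x - (μ + 1) * (x * A t x) = b₁ t * x + b₀ t ∧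
      deriv (ξ t) x - (μ + 1) * (A t x + x * deriv (A t) x) = b₁ t ∧
      deriv (fun s => ξ s x) t - (μ + 1) * (x * deriv (fun s => A s x) t)
        = deriv b₁ t * x + deriv b₀ t := by
  have hI := hadm.interval_x
  have hK₀ : ∀ u ∈ J, K u = 0 * D u + k₀ := fun u hu => by rw [hK u hu, zero_mul, zero_add]
  set B : ℝ → ℝ → ℝ := fun t x => ξ t x - (μ + 1) * (x * A t x)
  have hB : SmoothOn₂ T I B :=
    h.smooth_ξ.sub (contDiffOn_const.mul (contDiff_snd.contDiffOn.mul h.smooth_A))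
  have hBx {t x : ℝ} (ht : t ∈ T) (hx : x ∈ I) :
      deriv (B t) x = deriv (ξ t) x - (μ + 1) * (A t x + x * deriv (A t) x) :=
    ((h.smooth_ξ.hasDerivAt_x hI.1 ht hx).sub (((hasDerivAt_id' x).mul
      (h.smooth_A.hasDerivAt_x hI.1 ht hx)).const_mul (μ + 1))).deriv.trans (by ring)
  have hBt {t x : ℝ} (ht : t ∈ T) (hx : x ∈ I) : deriv (fun s => B s x) t
      = deriv (fun s => ξ s x) t - (μ + 1) * (x * deriv (fun s => A s x) t) :=
    ((h.smooth_ξ.hasDerivAt_t hT ht hx).sub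
      (((h.smooth_A.hasDerivAt_t hT ht hx).const_mul x).const_mul (μ + 1))).deriv
  have hBxx : ∀ t ∈ T, ∀ x ∈ I, HasDerivAt (deriv (B t)) 0 x := by
    intro t ht x hx
    refine (hB.hasDerivAt_deriv_x hI.1 ht hx).congr_deriv <|
      (Set.EqOn.deriv (fun y hy => hBx ht hy) hI.1 hx).trans <|
      ((h.smooth_ξ.hasDerivAt_deriv_x hI.1 ht hx).sub
        (((h.smooth_A.hasDerivAt_x hI.1 ht hx).add ((hasDerivAt_id' x).mul
          (h.smooth_A.hasDerivAt_deriv_x hI.1 ht hx))).const_mul (μ + 1))).deriv.trans ?_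
    rw [(h.eq_ξ_of_linear_relation hadm hD' hK₀ ht hx).1,
      (h.eq_A_of_linear_relation hadm hD' hK₀ ht hx).1]
    ring
  obtain ⟨b₁, b₀, hb₁, hb⟩ := hB.exists_eq_mul_add hT hI hBxx
  exact ⟨b₁, b₀, hb₁, fun t ht x hx => ⟨(hb t ht x hx).1, hBx ht hx ▸ (hb t ht x hx).2.1,
    hBt ht hx ▸ (hb t ht x hx).2.2⟩⟩

theorem exists_affineCoefficients :
    ∃ a₁ a₀ b₁ b₀, AffineCoefficients T I f μ k₀ ξ A a₁ a₀ b₁ b₀ := by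
  have hK₀ : ∀ u ∈ J, K u = 0 * D u + k₀ := fun u hu => by rw [hK u hu, zero_mul, zero_add]
  obtain ⟨a₁, a₀, -, hA⟩ := h.smooth_A.exists_eq_mul_add hT hadm.interval_x
    fun t ht x hx => (h.smooth_A.hasDerivAt_deriv_x hadm.interval_x.1 ht hx).congr_deriv <| by
      rw [(h.eq_A_of_linear_relation hadm hD' hK₀ ht hx).1, neg_zero, zero_mul]
  obtain ⟨b₁, b₀, hb₁, hξ⟩ := h.exists_ξ_eq_mul_add hT hadm hD' hK
  refine ⟨a₁, a₀, b₁, b₀, hb₁, fun t ht x hx => (hA t ht x hx).1, fun t ht x hx =>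
    (hξ t ht x hx).1, fun t ht x hx => ?_, fun t ht x hx => ?_⟩ <;>
  obtain ⟨hA, hAx, hAt⟩ := hA t ht x hx
  · rw [← hAt, (h.eq_A_of_linear_relation hadm hD' hK₀ ht hx).2, hAx]
  · obtain ⟨-, hξx, hξt⟩ := hξ t ht x hx
    have heqξ := (h.eq_ξ_of_linear_relation hadm hD' hK₀ ht hx).2
    have heqA := (h.eq_A_of_linear_relation hadm hD' hK₀ ht hx).2
    linear_combination heqξ - (μ + 1) * x * heqA - f x * hξt - k₀ * hξx
      - k₀ * μ * hA - 2 * k₀ * (μ + 1) * x * hAx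

end Structure

end ScaledCoefficients

theorem AffineCoefficients.exists_deriv_eq_neg_mul_sq
    (h : AffineCoefficients T I f μ k₀ ξ A a₁ a₀ b₁ b₀) (hI : IsOpenInterval I)
    (hf : DifferentiableOn ℝ f I) (hf' : ∃ x ∈ I, deriv f x ≠ 0) (hk₀ : k₀ ≠ 0) {t : ℝ}
    (ht : t ∈ T) (ha₁ : a₁ t ≠ 0) : μ = -2 / 3 ∧ ∃ d ≠ 0, ∀ x ∈ I, deriv f x = -d * f x ^ 2 := by
  have hk : k₀ * a₁ t ≠ 0 := mul_ne_zero hk₀ ha₁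
  have hne := div_ne_zero_of_mul_affine_eq_const hI.1 hf hk hf' (h.eq_A t ht)
  refine ⟨?_, _, hne, deriv_eq_neg_mul_sq_of_mul_affine_eq_const hI.1 hf hk (h.eq_A t ht)⟩
  obtain ⟨-, -, hsq, -⟩ := cubic_coeffs_eq_zero hI.infinite
    (a := a₁ t * deriv b₀ t + (μ * a₀ t + b₁ t) * deriv a₀ t)
    (b := a₁ t * deriv b₁ t + (3 * μ + 2) * a₁ t * deriv a₀ t
      + (μ * a₀ t + b₁ t) * deriv a₁ t)
    (c := (3 * μ + 2) * (a₁ t * deriv a₁ t)) (d := 0) fun x hx => mul_left_cancel₀ hk₀ <| by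
      linear_combination (deriv a₁ t * x + deriv a₀ t) * h.eq_ξ t ht x hx
        - (deriv b₁ t * x + deriv b₀ t) * h.eq_A t ht x hx
  have hμ := (mul_eq_zero.1 hsq).resolve_right (mul_ne_zero ha₁ (div_ne_zero_iff.1 hne).1)
  linarith

theorem HasScaledCoefficients.exists_deriv_f_eq_neg_mul_sq
    (h : HasScaledCoefficients T I J f D K μ ν 𝔤) (h𝔤 : IsSymmetrySpace f D K (box T I J) 𝔤)
    (hdim : 3 < Module.rank ℝ 𝔤) (hT : IsOpenInterval T) (hadm : IsAdmissible I J f D K)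
    (hD' : ∃ u ∈ J, deriv D u ≠ 0) (hK : ∀ u ∈ J, K u = k₀) (hk₀ : k₀ ≠ 0)
    (hf' : ∃ x ∈ I, deriv f x ≠ 0) :
    μ = -2 / 3 ∧ ∃ d ≠ 0, ∀ x ∈ I, deriv f x = -d * f x ^ 2 := by
  have hI := hadm.interval_x
  have hf : DifferentiableOn ℝ f I := hadm.smooth_f.differentiableOn (by simp)
  have hK₀ : ∀ u ∈ J, K u = 0 * D u + k₀ := fun u hu => by rw [hK u hu, zero_mul, zero_add]
  obtain ⟨t₀, ht₀⟩ := hT.2.2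
  obtain ⟨x₀, hx₀⟩ := hI.2.2
  obtain ⟨Q, hQ, hQ₀, τ, ξ, A, hs, hτ, hξ, hA⟩ := h.exists_eq_zero hadm.interval_u.2.2 hdim ht₀ hx₀
  obtain ⟨a₁, a₀, b₁, b₀, hc⟩ := hs.exists_affineCoefficients hT.1 hadm hD' hK
  by_contra hcon
  have ha₁ : ∀ t ∈ T, a₁ t = 0 := fun t ht => by
    by_contra hne
    exact hcon (hc.exists_deriv_eq_neg_mul_sq hI hf hf' hk₀ ht hne)
  have hA₀ := hs.A_eq_zero_of_deriv_x_eq_zero hT hadm hD' hK₀ ht₀ hx₀ hA fun t ht x hx =>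
    (Set.EqOn.deriv (hc.A_eq t ht) hI.1 hx).trans <| by simp [ha₁ t ht]
  have hξ_eq : ∀ t ∈ T, ∀ x ∈ I, ξ t x = b₁ t * x + b₀ t := fun t ht x hx => by
    rw [← hc.ξ_eq t ht x hx, hA₀ t ht x hx, mul_zero, mul_zero, sub_zero]
  have hξx : ∀ t ∈ T, ∀ x ∈ I, deriv (ξ t) x = b₁ t := fun t ht x hx =>
    (Set.EqOn.deriv (hξ_eq t ht) hI.1 hx).trans <| by simp
  have hb₁ := eq_zero_of_affine_relations (c := deriv τ) hT hI hf hf' hk₀ hc.differentiableAt_b₁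
    (fun t ht x hx => by
      have ha₀ : a₀ t = 0 := by
        rw [← hA₀ t ht x hx, hc.A_eq t ht x hx, ha₁ t ht, zero_mul, zero_add]
      linear_combination hc.eq_ξ t ht x hx - k₀ * (3 * μ + 2) * x * ha₁ t ht - k₀ * μ * ha₀)
    (fun t ht x hx => by
      have heq := hs.eq_uxx t ht x hx
      rw [hξx t ht x hx, hξ_eq t ht x hx, hA₀ t ht x hx] at heq
      linear_combination heq) ht₀ hx₀ (hξ_eq t₀ ht₀ x₀ hx₀ ▸ hξ)
  refine hQ₀ (hs.eq_zero_of_derivs_x_eq_zero hT hadm hD' hK₀ ht₀ hx₀ hA (fun t ht x hx => ?_) h𝔤 hQ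
    hτ hξ fun t ht x hx => (hξx t ht x hx).trans (hb₁ t ht))
  exact (Set.EqOn.deriv (hA₀ t ht) hI.1 hx).trans (deriv_const _ _)

end AffineCoefficients

/-! ### The reduction theorem -/

section Reduction

variable {T I J : Set ℝ} {f D K : ℝ → ℝ} {𝔤 : Submodule ℝ (PointSpace → PointSpace)}

theorem IsSymmetrySpace.exists_deriv_D_ne_zero (h𝔤 : IsSymmetrySpace f D K (box T I J) 𝔤)
    (hdim : 3 < Module.rank ℝ 𝔤) (hT : IsOpenInterval T) (hadm : IsAdmissible I J f D K)
    (hf' : ∃ x ∈ I, deriv f x ≠ 0) : ∃ u ∈ J, deriv D u ≠ 0 := by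
  by_contra! hD'
  obtain ⟨u₀, hu₀⟩ := hadm.interval_u.2.2
  obtain ⟨u, hu, hDK⟩ := hadm.nonlinear
  obtain ⟨x, hx, hne⟩ := hf'
  have hD : ∀ v ∈ J, D v = D u₀ := fun v hv => hadm.interval_u.eq_of_hasDerivAt_zero
    (fun w hw => hD' w hw ▸ hadm.hasDerivAt_D hw) hv hu₀
  exact hne (h𝔤.deriv_f_eq_zero_of_const hdim hT hadm hD
    ⟨u, hu, hDK.resolve_left (not_not.2 (hD' u hu))⟩ x hx)

theorem HasScaledCoefficients.homogeneous_or_inverse_linear {μ ν : ℝ}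
    (h : HasScaledCoefficients T I J f D K μ ν 𝔤) (h𝔤 : IsSymmetrySpace f D K (box T I J) 𝔤)
    (hdim : 3 < Module.rank ℝ 𝔤) (hT : IsOpenInterval T) (hadm : IsAdmissible I J f D K)
    (hf' : ∃ x ∈ I, deriv f x ≠ 0) :
    (∃ k₁, ∀ u ∈ J, K u = k₁ * D u) ∨ μ = -2 / 3 ∧
      (∃ k₀ ≠ 0, ∀ u ∈ J, K u = k₀) ∧ ∃ d ≠ 0, ∀ x ∈ I, deriv f x = -d * f x ^ 2 := by
  have hD' := h𝔤.exists_deriv_D_ne_zero hdim hT hadm hf'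
  obtain ⟨k₁, k₀, hK⟩ := h.exists_linear_relation h𝔤 hdim hT hadm hD'
  by_cases hk₀ : k₀ = 0
  · exact .inl ⟨k₁, by simpa [hk₀] using hK⟩
  by_cases hk₁ : k₁ = 0
  · have hK₀ : ∀ u ∈ J, K u = k₀ := by simpa [hk₁] using hK
    obtain ⟨hμ, hd⟩ := h.exists_deriv_f_eq_neg_mul_sq h𝔤 hdim hT hadm hD' hK₀ hk₀ hf'
    exact .inr ⟨hμ, ⟨k₀, hk₀, hK₀⟩, hd⟩
  · obtain ⟨x, hx, hne⟩ := hf'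
    exact absurd (h.deriv_f_eq_zero_of_mul_ne_zero h𝔤 hdim hT hadm hD' hK hk₁ hk₀ x hx) hne

theorem theorem4_general (hT : IsOpenInterval T) (hadm : IsAdmissible I J f D K)
    (h𝔤 : IsSymmetrySpace f D K (box T I J) 𝔤) (hdim : 4 ≤ Module.rank ℝ 𝔤) :
    IsReducible T I J f D K := by
  have hdim' : 3 < Module.rank ℝ 𝔤 := lt_of_lt_of_le (by norm_num) hdim
  by_cases! hf' : ∀ x ∈ I, deriv f x = 0
  · exact isReducible_of_deriv_f_eq_zero hT hadm hf'
  have hD' := h𝔤.exists_deriv_D_ne_zero hdim' hT hadm hf'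
  obtain ⟨μ, ν, hD, h⟩ | ⟨-, h⟩ := h𝔤.hasScaledCoefficients hT.1 hadm hD'
  · obtain ⟨k₁, hK⟩ | ⟨rfl, ⟨k₀, hk₀, hK⟩, d, hd, hf⟩ :=
      h.homogeneous_or_inverse_linear h𝔤 hdim' hT hadm hf'
    · exact h𝔤.isReducible_of_homogeneous hdim' hT hadm hD' hK
    · exact isReducible_of_inverse_linear hT hadm hD hK hk₀ hd hf
  · obtain ⟨k₁, hK⟩ | ⟨hμ, -⟩ := h.homogeneous_or_inverse_linear h𝔤 hdim' hT hadm hf'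
    · exact h𝔤.isReducible_of_homogeneous hdim' hT hadm hD' hK
    · norm_num at hμ

end Reduction

theorem theorem4 (T I J : Set ℝ) (f D K : ℝ → ℝ)
    (hT : IsOpenInterval T) (hadm : IsAdmissible I J f D K)
    (𝔤 : Submodule ℝ (PointSpace → PointSpace))
    (h𝔤 : IsInvarianceAlgebra f D K (box T I J) 𝔤)
    (hdim : 4 ≤ Module.rank ℝ 𝔤) :
    ∃ (I₁ J₁ : Set ℝ) (D₁ K₁ : ℝ → ℝ)
      (Φ : OpenPartialHomeomorph PointSpace PointSpace),
      IsAdmissible I₁ J₁ (fun _ => 1) D₁ K₁ ∧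
      IsPointTransformation (box T I J) Φ ∧
      (∀ p ∈ box T I J, (Φ p).2.1 ∈ I₁ ∧ (Φ p).2.2 ∈ J₁) ∧
      MapsEquation (box T I J) Φ f D K (fun _ => 1) D₁ K₁ :=
  theorem4_general hT hadm h𝔤.isSymmetrySpace hdim
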